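/- **Setting.** Let $\beta$ be a positive braid word on $N-n+1$ strands whose permutation fixes $k$, and let $\gamma$ be a positive braid word on $n$ strands. Strands are numbered from bottom to top and oriented from left to right; at each crossing of $\beta$ or $\gamma$ the descending strand is the overstrand. $\Lambda=\Lambda(\beta,k;\gamma)$ is the link whose Lagrangian projection is the blackboard-framed closure, around the figure-eight diagram of the unknot, of the $N$-stranded braid obtained from $\beta$ by replacing the $k$-th strand by $n$ parallel strands (the satellite strands) and inserting $\gamma$ (the purple box) on them at the right end of $\beta$. Its Reeb chords are: the chords $c_{ij}$, $1\le i,j\le N$, of degree $1$ (the $i$-th strand returning to the left over the $j$-th strand leaving the braid on the right), and, in degree $0$, the crossings of $\gamma$, one crossing for each crossing of $\beta$ not involving the $k$-th strand, and a group of $n$ crossings, ordered by the satellite strands from bottom to top, for each crossing of $\beta$ that involves the $k$-th strand. Base points are labelled by units of a commutative coefficient ring $R$ (e.g. by monomials $\pm s_i^{\pm1}$ in $\mathbb{Z}[s_1^{\pm1},\dots,s_q^{\pm1}]$); there may be arbitrarily many, provided that those on the satellite strands lie in the purple box and that none of the others lies between two crossings of the same group of $n$ crossings (in $\beta$ or among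 the $c_{ij}$). The algebra $\mathcal A_\Lambda$ is the unital tensor algebra over $R$ on the Reeb chords. **Elementary maps.** A Reidemeister III move at a triangle of strands $T$ over $M$ over $B$ is legal if each of the three strands meets its two crossings consecutively, in orders compatible with a planar triangle. If the Reeb signs of the corners of the triangle are $-$ at $TB$ and $+$ at $TM$ and $MB$, it induces $x_{TB}\mapsto x_{TB}+\sigma\,x_{TM}x_{MB}$, where $\sigma=\pm1$ is the product of the orientation signs of the quadrant at $TB$ opposite to the triangle and of the quadrants at $TM$ and $MB$ bounded by the side of the triangle leading to $TB$ and the ray of $M$ leaving the triangle; here the orientation sign is $-1$ for the quadrants to the right of the understrand at a positive crossing and $+1$ otherwise. All other chords are fixed. A base point labelled $s$ that moves through a crossing $x$ against the orientation induces $x\mapsto sx$ if it moves on the overstrand and $x\mapsto xs^{-1}$ if it moves on the understrand; all other chords are fixed. **The loop.** The purple-box loop $\vartheta$ pushes the purple box, against the orientation, through one strand after the other: from right to left through $\beta$, then on the returning strands through the $N$ leaving strands, then on the leaving strands through the $N$ returning strands, back to its initial place. Each passage through a strand is done by pushing the columns of base points and the crossings of the box one after the other, from left to right, by base point and Reidemeister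 III moves. The monodromy $\mathcal A(\vartheta):\mathcal A_\Lambda\to\mathcal A_\Lambda$ is the composition of the induced maps, the first move acting first, followed by the identification of the chords of the final diagram with the chords of the initial diagram in the same places. **Path matrix.** If the crossings $a_1,\dots,a_r$ of $\gamma$ occur at positions $k_1,\dots,k_r$ and the base points in the box have labels $\mathbf t_0,\dots,\mathbf t_r$ ($\mathbf t_\ell\in (R^\times)^n$, the label $1$ meaning no base point), put $P_\gamma=D(\mathbf t_0)P_{k_1}(a_1)D(\mathbf t_1)\cdots P_{k_r}(a_r)D(\mathbf t_r)$, where $D$ denotes diagonal matrices and $P_j(a)$ is the identity except for the block $\left(\begin{smallmatrix}0&1\\1&a\end{smallmatrix}\right)$ in rows and columns $j,j+1$. Let $\widetilde P_\gamma$ be the $N\times N$ matrix that is $P_\gamma$ in rows and columns $k,\dots,k+n-1$ and the identity elsewhere, and $C=(c_{ij})$. **Proposition.** All moves of $\vartheta$ are legal, and the final diagram is the initial one after the identification of chords. $P_\gamma$ and $\widetilde P_\gamma$ are invertible over $\mathcal A_\Lambda$, and: 1. $\mathcal A(\vartheta)(C)=\widetilde P_\gamma\, C\,\widetilde P_\gamma^{-1}$.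 2. $\mathcal A(\vartheta)$ fixes all crossings that do not involve the satellite strands, and all crossings of the purple box $\gamma$. 3. If $h_1,\dots,h_n$ is the group coming from a crossing of $\beta$ at which the $k$-th strand is the overstrand, then $\mathcal A(\vartheta)(h)=P_\gamma h$ for the column $h=(h_1,\dots,h_n)^T$. 4. If $h'_1,\dots,h'_n$ is the group coming from a crossing of $\beta$ at which the $k$-th strand is the understrand, then $\mathcal A(\vartheta)(h'_1,\dots,h'_n)=(h'_1,\dots,h'_n)\,P_\gamma^{-1}$ as row vectors over $\mathcal A_\Lambda$. In particular, after any homomorphism of $R$-algebras from $\mathcal A_\Lambda$ to a commutative $R$-algebra, the column $h'=(h_1',\dots,h_n')^T$ is transformed by left multiplication with $(P_\gamma^T)^{-1}$. -/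

import Mathlib

/-! ## Positive braid words and their path matrices

Strands are numbered from bottom to top, starting from `0`, and run from left to right. -/

/-- A positive braid word on `n` strands; its `ℓ`-th letter is the crossing of the strands in
positions `gen ℓ` and `gen ℓ + 1`. -/
structure PositiveBraid (n : ℕ) where
  len : ℕ
  gen : Fin len → Fin n
  gen_lt : ∀ ℓ, (gen ℓ : ℕ) + 1 < n

namespace PositiveBraid

variable {n : ℕ} (b : PositiveBraid n)

/-- Lower position at the `ℓ`-th crossing. -/
def lower (ℓ : Fin b.len) : Fin n := b.gen ℓ

/-- Upper position at the `ℓ`-th crossing. -/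
def upper (ℓ : Fin b.len) : Fin n := ⟨(b.gen ℓ : ℕ) + 1, b.gen_lt ℓ⟩

/-- `b.track ℓ i` is the position, after the first `ℓ` crossings, of the strand that enters the
braid from the left in position `i`. -/
def track : ℕ → Equiv.Perm (Fin n)
  | 0 => 1
  | ℓ + 1 => if h : ℓ < b.len then Equiv.swap (b.lower ⟨ℓ, h⟩) (b.upper ⟨ℓ, h⟩) * track ℓ
      else track ℓ

/-- The Coxeter projection of the braid: the strand entering at `i` leaves at `b.perm i`. -/
def perm : Equiv.Perm (Fin n) := b.track b.len

/-- The matrix `P_k(a)` of the `ℓ`-th crossing: the identity except for the block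
`(0 1; 1 a)` in the rows and columns of the two crossing positions. -/
def crossingMatrix {A : Type*} [Ring A] (ℓ : Fin b.len) (a : A) : Matrix (Fin n) (Fin n) A :=
  fun i j =>
    if i = b.lower ℓ then (if j = b.upper ℓ then 1 else 0)
    else if i = b.upper ℓ then (if j = b.lower ℓ then 1 else if j = b.upper ℓ then a else 0)
    else if i = j then 1 else 0

/-- The path matrix `D(t₀) P_{k₁}(a₁) D(t₁) ⋯ P_{k_r}(a_r) D(t_r)`, with a column of base points
before the first crossing and after each crossing. -/
def pathMatrix {A : Type*} [Ring A] (t : Fin (b.len + 1) → Fin n → A) (a : Fin b.len → A) :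
    Matrix (Fin n) (Fin n) A :=
  Matrix.diagonal (t 0) *
    (List.ofFn fun ℓ : Fin b.len =>
      b.crossingMatrix ℓ (a ℓ) * Matrix.diagonal (t ℓ.succ)).prod

end PositiveBraid

/-! ## Link diagrams with base points, elementary moves and their algebra maps

A Lagrangian projection, up to planar isotopy, is recorded by its oriented signed Gauss diagram:
one lists, along the oriented link, the passages through crossings (over or under) and through
base points, and records the sign of each crossing. -/

/-- The points met when traversing the link: the over- or undercrossing at `x`, or the base
point `b`. -/
inductive Passage (X B : Type*) where
  | over (x : X)
  | under (x : X)
  | pt (b : B)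

/-- A diagram with crossings (Reeb chords) `X` and base points `B` labelled by units of the
coefficient ring. -/
@[ext]
structure LinkDiagram (R : Type*) [CommRing R] (X B : Type*) where
  /-- `follows u v`: the passage `v` comes immediately after `u` along the oriented link. -/
  follows : Passage X B → Passage X B → Prop
  /-- The sign of a crossing: `1` for even, `-1` for odd degree of the Reeb chord. -/
  sign : X → ℤˣ
  label : B → Rˣ

/-- Elementary moves.

* `triple tm tb mb` is the Reidemeister III move at a triangle formed by a top strand `T`, a
  middle strand `M` and a bottom strand `B`, where `tm`, `tb`, `mb` are the crossings `T` over `M`,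
  `T` over `B`, `M` over `B`.
* `slide b x isOver back` moves the base point `b` through the crossing `x` along its over-
  (`isOver = true`) or understrand, against (`back = true`) or along the orientation. -/
inductive DiagramMove (X B : Type*) where
  | triple (tm tb mb : X)
  | slide (b : B) (x : X) (isOver back : Bool)

namespace LinkDiagram

variable {R : Type*} [CommRing R] {X B : Type*} (D : LinkDiagram R X B)

/-- `D.adj 1 u v`: `v` comes directly after `u`; `D.adj (-1) u v`: directly before. -/
def adj (e : ℤˣ) (u v : Passage X B) : Prop :=
  if e = 1 then D.follows u v else D.follows v u

open Classical in
/-- `1` if the top strand runs from `tb` to `tm`, and `-1` if it runs from `tm` to `tb`. -/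
noncomputable def dirTop (tm tb : X) : ℤˣ :=
  if D.follows (.over tb) (.over tm) then 1 else -1

/-- In a planar triangle with side vectors `α d_T` (from `tb` to `tm`), `μ d_M` (from `tm` to
`mb`) and `β d_B` (from `mb` to `tb`) along the oriented strands one has
`α d_T + μ d_M + β d_B = 0`. As the sign of a crossing is the sign of
`det (d_over, d_under)`, this determines the signs of `μ` and `β` from that of `α`.
Here: the sign of `μ`. -/
noncomputable def dirMiddle (tm tb mb : X) : ℤˣ :=
  -(D.dirTop tm tb * D.sign tb * D.sign mb)

/-- The sign of `β`; see `dirMiddle`. -/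
noncomputable def dirBottom (tm tb mb : X) : ℤˣ :=
  D.dirTop tm tb * D.sign tm * D.sign mb

/-- The orientation sign of a quadrant of the crossing `x`. The quadrant is bounded by a ray of the
overstrand, pointing along (`e = 1`) or against (`e = -1`) its orientation, and by a ray of the
understrand. At a positive crossing the two quadrants to the right of the understrand have
sign `-1` (these are the ones with `e = 1`); all other quadrants have sign `1`. -/
def quadrantSign (x : X) (e : ℤˣ) : ℤˣ :=
  if D.sign x = 1 then -e else 1

/-- The sign of the Reidemeister III map: the product of the orientation signs of three
quadrants. These are, at `tb`, the quadrant opposite to the triangle, and, at `tm` and at `mb`, the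
quadrant bounded by the side of the triangle leading to `tb` and by the ray of `M` that leaves
the triangle. -/
noncomputable def tripleSign (tm tb mb : X) : ℤˣ :=
  D.quadrantSign tb (-D.dirTop tm tb) * D.quadrantSign tm (-D.dirTop tm tb) *
    D.quadrantSign mb (D.dirMiddle tm tb mb)

/-- The legality of a move in the diagram `D`. -/
def LegalMove : DiagramMove X B → Prop
  | .triple tm tb mb =>
      tm ≠ tb ∧ tm ≠ mb ∧ tb ≠ mb ∧
      D.adj (D.dirTop tm tb) (.over tb) (.over tm) ∧
      D.adj (D.dirMiddle tm tb mb) (.under tm) (.over mb) ∧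
      D.adj (D.dirBottom tm tb mb) (.under mb) (.under tb)
  | .slide b x isOver back =>
      D.adj (if back then 1 else -1) (if isOver then .over x else .under x) (.pt b)

open Classical in
/-- The exchange of passages effected by a move: in a Reidemeister III move each of the three
strands meets its two crossings in the opposite order afterwards. -/
noncomputable def exchange (s : DiagramMove X B) : Equiv.Perm (Passage X B) :=
  match s with
  | .triple tm tb mb =>
      Equiv.swap (Passage.over tb) (Passage.over tm) *
        Equiv.swap (Passage.under tm) (Passage.over mb) *
        Equiv.swap (Passage.under mb) (Passage.under tb)
  | .slide b x isOver _ =>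
      Equiv.swap (if isOver then Passage.over x else Passage.under x) (Passage.pt b)

/-- The diagram after the move. -/
noncomputable def move (s : DiagramMove X B) : LinkDiagram R X B where
  follows u v := D.follows ((exchange s).symm u) ((exchange s).symm v)
  sign := D.sign
  label := D.label

open Classical in
/-- The algebra map `A_Λ → A_Λ'` of an elementary move from `Λ` to `Λ'`, where `A_Λ` is the unital
tensor algebra over the coefficient ring generated by the Reeb chords.

The Reidemeister III move is of type III_b (at the corners of the triangle the Reeb signs are
`-` at `tb` and `+` at `tm`, `mb`) if and only if the product of the three crossing signs is `1`;
otherwise it is of type III_a, with identity map. A base point with label `s` moving against the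
orientation through `x` gives `x ↦ s x` on the overstrand and `x ↦ x s⁻¹` on the understrand;
moving along the orientation gives the inverse map. -/
noncomputable def moveMap : DiagramMove X B → (FreeAlgebra R X →ₐ[R] FreeAlgebra R X)
  | .triple tm tb mb =>
      FreeAlgebra.lift R fun x =>
        if x = tb ∧ D.sign tm * D.sign tb * D.sign mb = 1 then
          FreeAlgebra.ι R tb +
            ((D.tripleSign tm tb mb : ℤˣ) : ℤ) • (FreeAlgebra.ι R tm * FreeAlgebra.ι R mb)
        else FreeAlgebra.ι R x
  | .slide b x isOver back =>
      FreeAlgebra.lift R fun y =>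
        if y = x then
          ((if isOver = back then D.label b else (D.label b)⁻¹ : Rˣ) : R) • FreeAlgebra.ι R x
        else FreeAlgebra.ι R y

/-- All moves of the sequence are legal. -/
def Legal : LinkDiagram R X B → List (DiagramMove X B) → Prop
  | _, [] => True
  | D, s :: l => D.LegalMove s ∧ Legal (D.move s) l

/-- The diagram at the end of a sequence of moves. -/
noncomputable def run : LinkDiagram R X B → List (DiagramMove X B) → LinkDiagram R X B
  | D, [] => D
  | D, s :: l => run (D.move s) l

/-- The composition of the algebra maps of a sequence of moves, the first move acting first. -/
noncomputable def inducedMap : LinkDiagram R X B → List (DiagramMove X B) →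
    (FreeAlgebra R X →ₐ[R] FreeAlgebra R X)
  | _, [] => AlgHom.id R _
  | D, s :: l => (inducedMap (D.move s) l).comp (D.moveMap s)

end LinkDiagram

/-- Renaming the crossings. -/
def Passage.rename {X B : Type*} (f : X → X) : Passage X B → Passage X B
  | .over x => .over (f x)
  | .under x => .under (f x)
  | .pt b => .pt b

/-- The diagram `D` in which the crossing `x` is called `e x`. -/
def LinkDiagram.relabel {R : Type*} [CommRing R] {X B : Type*} (D : LinkDiagram R X B)
    (e : Equiv.Perm X) : LinkDiagram R X B where
  follows u v := D.follows (u.rename e.symm) (v.rename e.symm)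
  sign x := D.sign (e.symm x)
  label := D.label

/-! ## The link `Λ(β, k; γ)` -/

/-- A positive braid word `β` on `m + 1` strands, a fixed point `k` of its permutation, and a
positive braid word `γ` on `n` strands, so that `Λ(β, k; γ)` has `N = m + n` braid strands. -/
structure SatelliteBraid (m n : ℕ) where
  β : PositiveBraid (m + 1)
  k : Fin (m + 1)
  fixed : β.perm k = k
  γ : PositiveBraid n

namespace SatelliteBraid

variable {m n : ℕ} (S : SatelliteBraid m n)

/-- Position of the satellited strand in `β` just before crossing `ℓ`. -/
def satPos (ℓ : Fin S.β.len) : Fin (m + 1) := S.β.track ℓ S.k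

/-- The crossing `ℓ` of `β` involves the satellited strand. -/
abbrev IsSat (ℓ : Fin S.β.len) : Prop :=
  S.satPos ℓ = S.β.lower ℓ ∨ S.satPos ℓ = S.β.upper ℓ

/-- The `N` braid strands, named by their positions at the left (or right) end of `β`: the strands
of `β` other than the `k`-th one, and the `n` strands replacing the `k`-th one. -/
abbrev Strand : Type := {i : Fin (m + 1) // i ≠ S.k} ⊕ Fin n

/-- The strands that replace the strand `i` of `β`, from bottom to top. -/
def block (i : Fin (m + 1)) : List S.Strand :=
  if h : i = S.k then (List.finRange n).map Sum.inr else [Sum.inl ⟨i, h⟩]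

/-- All strands, from bottom to top. -/
def strands : List S.Strand := (List.finRange (m + 1)).flatMap S.block

/-- The Reeb chords of `Λ(β, k; γ)`. -/
inductive Chord where
  /-- The chords `c_{ij}` of degree `1`: the `i`-th returning strand over the `j`-th strand leaving
  the braid on its right. -/
  | c (i j : S.Strand)
  /-- The crossings of `γ`. -/
  | box (ℓ : Fin S.γ.len)
  /-- The crossings of `β` not involving the satellited strand. -/
  | outer (ℓ : {ℓ : Fin S.β.len // ¬ S.IsSat ℓ})
  /-- The group of `n` crossings arising from a crossing of `β` with the satellited strand; the
  `q`-th one lies on the `q`-th satellite strand from the bottom. -/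
  | sat (ℓ : {ℓ : Fin S.β.len // S.IsSat ℓ}) (q : Fin n)

/-- The degrees of the Reeb chords. -/
def Chord.degree {S : SatelliteBraid m n} : S.Chord → ℕ
  | .c _ _ => 1
  | .box _ => 0
  | .outer _ => 0
  | .sat _ _ => 0

/-- The base points. There is one on each arc of the box containing `γ`, and, outside the
satellite sublink, one on each arc of the diagram that does not lie between two crossings of the
same group; absent base points are the ones labelled by `1`. -/
inductive BasePoint where
  /-- In column `ℓ` of the box, in position `q`. -/
  | box (ℓ : Fin (S.γ.len + 1)) (q : Fin n)
  /-- In column `ℓ` of `β`, in position `i`. -/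
  | outer (ℓ : Fin (S.β.len + 1)) (i : Fin (m + 1))
  /-- On strand `j` leaving `β` on its right, before it meets the returning block `i`. -/
  | leaving (j : {i : Fin (m + 1) // i ≠ S.k}) (i : Fin (m + 1))
  /-- On the returning strand `i`, before it meets the leaving block `j`. -/
  | returning (i : {i : Fin (m + 1) // i ≠ S.k}) (j : Fin (m + 1))

/-- Passages. -/
abbrev Pass : Type := Passage S.Chord S.BasePoint

/-- What a strand of `β` other than the satellited one meets at the crossing `ℓ` if it is in
position `p`. The descending strand is the overstrand. An ascending strand crosses the satellite
strands from bottom to top, a descending one from top to bottom. -/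
def outerCrossing (ℓ : Fin S.β.len) (p : Fin (m + 1)) : List S.Pass :=
  if p = S.β.lower ℓ then
    if h : S.IsSat ℓ then (List.finRange n).map fun q => .under (.sat ⟨ℓ, h⟩ q)
    else [.under (.outer ⟨ℓ, h⟩)]
  else if p = S.β.upper ℓ then
    if h : S.IsSat ℓ then (List.finRange n).reverse.map fun q => .over (.sat ⟨ℓ, h⟩ q)
    else [.over (.outer ⟨ℓ, h⟩)]
  else []

/-- The passages inside `β` of the strand that enters `β` in position `i`. -/
def outerBraid (i : {i : Fin (m + 1) // i ≠ S.k}) : List S.Pass :=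
  (List.finRange S.β.len).flatMap
      (fun ℓ : Fin S.β.len => .pt (.outer ℓ.castSucc (S.β.track ℓ i)) :: S.outerCrossing ℓ (S.β.track ℓ i)) ++
    [.pt (.outer (Fin.last _) (S.β.perm i))]

/-- The passages inside `β` of the `q`-th satellite strand. -/
def satBraid (q : Fin n) : List S.Pass :=
  (List.finRange S.β.len).flatMap fun ℓ =>
    if h : S.IsSat ℓ then
      if S.satPos ℓ = S.β.lower ℓ then [.under (.sat ⟨ℓ, h⟩ q)] else [.over (.sat ⟨ℓ, h⟩ q)]
    else []

/-- The passages inside the box of the strand that enters the box in position `q`. -/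
def boxBraid (q : Fin n) : List S.Pass :=
  (List.finRange S.γ.len).flatMap
      (fun ℓ : Fin S.γ.len => .pt (.box ℓ.castSucc (S.γ.track ℓ q)) ::
        (if S.γ.track ℓ q = S.γ.lower ℓ then [.under (.box ℓ)]
          else if S.γ.track ℓ q = S.γ.upper ℓ then [.over (.box ℓ)] else [])) ++
    [.pt (.box (Fin.last _) (S.γ.perm q))]

/-- The first passage through the square grid: the strand leaving the braid in position `j`
crosses under the returning strands, the top one first. -/
def leavingPass (j : S.Strand) : List S.Pass :=
  (List.finRange (m + 1)).reverse.flatMap fun i =>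
    (match j with
      | .inl j => [.pt (.leaving j i)]
      | .inr _ => []) ++
    (S.block i).reverse.map fun l => .under (.c l j)

/-- The second passage through the square grid: the returning strand `i` crosses over the leaving
strands, the bottom one first. -/
def returningPass (i : S.Strand) : List S.Pass :=
  (List.finRange (m + 1)).flatMap fun j =>
    (match i with
      | .inl i => [.pt (.returning i j)]
      | .inr _ => []) ++
    (S.block j).map fun l => .over (.c i l)

theorem perm_ne {i : Fin (m + 1)} (h : i ≠ S.k) : S.β.perm i ≠ S.k := fun h' =>
  h (S.β.perm.injective (h'.trans S.fixed.symm))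

/-- The position in which a strand leaves the braid. -/
def exit : S.Strand → S.Strand
  | .inl i => .inl ⟨S.β.perm i, S.perm_ne i.2⟩
  | .inr q => .inr (S.γ.perm q)

/-- The passages met when going once around the figure-eight unknot, starting at the left end of
the braid `β` and returning there in position `S.exit i`. The box with `γ` is to the right of
`β`. -/
def strandWord (i : S.Strand) : List S.Pass :=
  (match i with
    | .inl i => S.outerBraid i
    | .inr q => S.satBraid q ++ S.boxBraid q) ++
  S.leavingPass (S.exit i) ++ S.returningPass (S.exit i)

/-- The diagram of `Λ(β, k; γ)`, with base points labelled by `t`: the blackboard-framed satellite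
closure around the figure-eight diagram of the unknot. -/
def diagram {R : Type*} [CommRing R] (t : S.BasePoint → Rˣ) :
    LinkDiagram R S.Chord S.BasePoint where
  follows u v := ∃ i, [u, v] <:+: S.strandWord i ++ S.strandWord (S.exit i)
  sign x := (-1) ^ x.degree
  label := t

/-! ## The purple-box loop -/

/-- Push the box, against the orientation, through one strand. The `n` strands of the box pass over
(`isOver = true`) or under this strand, and `h q` is the crossing with the strand that enters the
box in position `q`. The columns of base points and the crossings of the box are pushed one after
the other, beginning at the left end of the box. -/
def pushBox (isOver : Bool) (h : Fin n → S.Chord) : List (DiagramMove S.Chord S.BasePoint) :=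
  let column (ℓ : Fin (S.γ.len + 1)) : List (DiagramMove S.Chord S.BasePoint) :=
    (List.finRange n).map fun q => .slide (.box ℓ q) (h ((S.γ.track ℓ).symm q)) isOver true
  (List.finRange S.γ.len).flatMap (fun ℓ : Fin S.γ.len =>
    let a : S.Chord := .box ℓ
    let hOver := h ((S.γ.track ℓ).symm (S.γ.upper ℓ))
    let hUnder := h ((S.γ.track ℓ).symm (S.γ.lower ℓ))
    column ℓ.castSucc ++
      [if isOver then .triple a hOver hUnder else .triple hOver hUnder a]) ++
  column (Fin.last _)

/-- Push the box through `β`, from right to left. -/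
def pushThroughBraid : List (DiagramMove S.Chord S.BasePoint) :=
  (List.finRange S.β.len).reverse.flatMap fun ℓ =>
    if h : S.IsSat ℓ then
      S.pushBox (decide (S.satPos ℓ = S.β.upper ℓ)) fun q => .sat ⟨ℓ, h⟩ q
    else []

/-- After a planar isotopy around the left end of the diagram, the box lies on the returning
strands; push it through the leaving strands. -/
def pushThroughReturning : List (DiagramMove S.Chord S.BasePoint) :=
  S.strands.reverse.flatMap fun j => S.pushBox true fun q => .c (.inr q) j

/-- The box lies now on the loop at the right end of the diagram; push it through the returning
strands, to the right end of `β`. As the box has passed through them, the returning satellite strand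
in position `p` carries the crossings that were in position `γ.perm⁻¹ p` at the beginning. -/
def pushThroughLeaving : List (DiagramMove S.Chord S.BasePoint) :=
  S.strands.flatMap fun i => S.pushBox false fun q => .c (i.map id S.γ.perm.symm) (.inr q)

/-- The purple-box loop `ϑ`, as a sequence of Reidemeister III and base point moves. -/
def purpleLoop : List (DiagramMove S.Chord S.BasePoint) :=
  S.pushThroughBraid ++ S.pushThroughReturning ++ S.pushThroughLeaving

/-- At the end of the loop the diagram agrees with the initial one, but the crossings on the
satellite strands have changed places according to the permutation of `γ`. This map sends a crossing
of the final diagram to the crossing of the initial diagram in the same place. -/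
def place (e : Equiv.Perm (Fin n)) : S.Chord → S.Chord
  | .c i j => .c (i.map id e) (j.map id e)
  | .box ℓ => .box ℓ
  | .outer ℓ => .outer ℓ
  | .sat ℓ q => .sat ℓ (e q)

/-- The identification of the Reeb chords of the final diagram with those of the initial one. -/
def identification : Equiv.Perm S.Chord where
  toFun := S.place S.γ.perm
  invFun := S.place S.γ.perm.symm
  left_inv x := by rcases x with ⟨_ | _, _ | _⟩ | _ | _ | _ <;> simp [place]
  right_inv x := by rcases x with ⟨_ | _, _ | _⟩ | _ | _ | _ <;> simp [place]

variable {R : Type*} [CommRing R] (t : S.BasePoint → Rˣ)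

/-- The underlying algebra of the Legendrian contact DGA: the unital tensor algebra over the
coefficient ring on the Reeb chords. -/
abbrev Alg (R : Type*) [CommRing R] : Type _ := FreeAlgebra R S.Chord

/-- The purple-box monodromy `A(ϑ)`. -/
noncomputable def monodromy : S.Alg R →ₐ[R] S.Alg R :=
  (FreeAlgebra.lift R fun x => FreeAlgebra.ι R (S.identification x)).comp
    ((S.diagram t).inducedMap S.purpleLoop)

/-- The path matrix `P_γ`. -/
noncomputable def boxMatrix : Matrix (Fin n) (Fin n) (S.Alg R) :=
  S.γ.pathMatrix (fun ℓ q => algebraMap R (S.Alg R) (t (.box ℓ q)))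
    (fun ℓ => FreeAlgebra.ι R (.box ℓ))

/-- The `N × N` matrix that is `P_γ` on the satellite strands and the identity elsewhere. -/
noncomputable def extendedBoxMatrix : Matrix S.Strand S.Strand (S.Alg R) :=
  Matrix.fromBlocks 1 0 0 (S.boxMatrix t)

/-- The matrix `C` of the degree `1` chords. -/
noncomputable def chordMatrix (R : Type*) [CommRing R] : Matrix S.Strand S.Strand (S.Alg R) :=
  fun i j => FreeAlgebra.ι R (.c i j)

/-- The column of the crossings in the group coming from the crossing `ℓ` of `β`. -/
noncomputable def group (R : Type*) [CommRing R] (ℓ : {ℓ : Fin S.β.len // S.IsSat ℓ}) :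
    Fin n → S.Alg R :=
  fun q => FreeAlgebra.ι R (.sat ℓ q)

end SatelliteBraid

/-! ## Sequences of moves as conjugations -/

/-! The proof separates the bookkeeping of passages, which decides legality and whether the loop
closes up, from the algebra maps.

Passages. A move only permutes the names of passages, and the permutation does not depend on the
diagram. A sequence of moves therefore conjugates the diagram by one permutation (`run_eq_conj`),
which can be computed without any diagram. Pushing the box through one strand is an induction over
its columns and crossings, with invariant `PushState`: the part already pushed stands before the
crossing with that strand, the rest after it, and the pushed-through strand meets its `n` crossings
in the order given by `γ.track ℓ`. In total, the box jumps over one crossing of each satellite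
strand, and along the other strand the crossings are permuted by `γ.perm⁻¹`. Passing successively
through separated groups (`totalExchange_pushAll`, `realizes_pushAll`) gives explicit words for the
diagram after each of the three stages. The final words are the initial ones, indexed by the strands
moved by `γ.perm`, up to the identification of chords (`map_rename_wordAfterLoop`).

Signs. All `n` crossings with a pushed-through strand have the same sign `s`, and box crossings have
sign `1`. Every triangle thus has sign product `s * s = 1`, so every move is of type III_b. Its sign
is `+1` if the box passes over the strand and `-1` if it passes under, whatever `s` is
(`PushState.realizes_crossing`).

Algebra. Let `v` be the vector of the `n` crossings of one group, listed by their current position.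
If the box passes over, one column and one crossing of the box replace the column `v` by `D P_j(a)
v'`, where `v'` is listed by the new positions. If it passes under, the image `w` of the row `v`
satisfies `w D P_j(a) = v'`. Later moves fix the crossings of the box, hence all matrices found so
far, so these factors accumulate in the order of the box to `P_γ` (`composeMaps_pushBox_over`,
`composeMaps_pushBox_under`). The remaining permutation `γ.perm⁻¹` is cancelled by the
identification. A group in `β` is met once. The chords `c_{ij}` are acted on through their rows on
the returning strands and then through their columns on the leaving strands, which gives the
conjugation by the extended matrix. The equations with a factor on the right are proved before
inverting, so only invertibility of the matrices over a noncommutative ring is needed. -/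

theorem List.pair_infix_map_equiv {α β : Type*} (E : α ≃ β) (l : List α) (u v : β) :
    [u, v] <:+: l.map E ↔ [E.symm u, E.symm v] <:+: l := by
  constructor
  · intro h
    have := h.map E.symm
    simpa using this
  · intro h
    have := h.map E
    simpa using this

/-- A pair of neighbours straddles at most one junction, because the nonempty middle word separates
the two. -/
theorem List.pair_infix_append_append {α : Type*} {u v : α} {X Y Z : List α} (hY : Y ≠ [])
    (h : [u, v] <:+: X ++ Y ++ Z) : [u, v] <:+: X ++ Y ∨ [u, v] <:+: Y ++ Z := by
  rw [List.infix_append_iff] at h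
  rcases h with h | h | ⟨l₁, l₂, h, h₁, h₂⟩
  · exact Or.inl h
  · exact Or.inr (h.trans (List.suffix_append _ _).isInfix)
  · rcases l₁ with _ | ⟨a, l₁⟩
    · simp only [List.nil_append] at h
      subst h
      exact Or.inr (h₂.isInfix.trans (List.suffix_append _ _).isInfix)
    · rcases l₁ with _ | ⟨b, l₁⟩
      · simp only [List.cons_append, List.nil_append, List.cons.injEq] at h
        obtain ⟨rfl, rfl⟩ := h
        right
        -- The pair straddles the junction before `Z`; as `Y` is nonempty, its first member is the
        -- last letter of `Y`.
        have h₃ : [u] <:+ Y := by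
          rcases List.eq_nil_or_concat Y with rfl | ⟨Y', y, rfl⟩
          · exact absurd rfl hY
          · obtain ⟨T, hT⟩ := h₁
            rw [List.concat_eq_append, ← List.append_assoc] at hT
            have := (List.append_inj' hT rfl).2
            rw [this]
            simp
        obtain ⟨T, rfl⟩ := h₃
        obtain ⟨T', rfl⟩ := h₂
        exact ⟨T, T', by simp⟩
      · simp only [List.cons_append, List.cons.injEq] at h
        obtain ⟨rfl, rfl, h⟩ := h
        have : l₁ = [] := (List.append_eq_nil_iff.1 h.symm).1
        subst this
        exact Or.inl h₁.isInfix

namespace LinkDiagram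

variable {R : Type*} [CommRing R] {X B : Type*}

/-- The diagram in which the passage `u` is replaced by `E u`. -/
def conj (D : LinkDiagram R X B) (E : Equiv.Perm (Passage X B)) : LinkDiagram R X B where
  follows u v := D.follows (E.symm u) (E.symm v)
  sign := D.sign
  label := D.label

theorem conj_one (D : LinkDiagram R X B) : D.conj 1 = D := rfl

theorem conj_conj (D : LinkDiagram R X B) (E F : Equiv.Perm (Passage X B)) :
    (D.conj E).conj F = D.conj (F * E) := rfl

/-- The composite exchange of passages of a sequence of moves. -/
noncomputable def totalExchange : List (DiagramMove X B) → Equiv.Perm (Passage X B)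
  | [] => 1
  | s :: l => totalExchange l * exchange s

theorem totalExchange_append (l₁ l₂ : List (DiagramMove X B)) :
    totalExchange (l₁ ++ l₂) = totalExchange l₂ * totalExchange l₁ := by
  induction l₁ with
  | nil => simp [totalExchange]
  | cons s l ih => simp [totalExchange, ih, mul_assoc]

/-- Each exchange is a permutation independent of the diagram to which the move is applied, so
successive moves are conjugations that compose. -/
theorem run_eq_conj (D : LinkDiagram R X B) (l : List (DiagramMove X B)) :
    D.run l = D.conj (totalExchange l) := by
  induction l generalizing D with
  | nil => rfl
  | cons s l ih => rw [run, ih]; rfl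

/-- All moves of the sequence are legal, and the move `s` induces the algebra map `φ s`. -/
def Realizes (φ : DiagramMove X B → (FreeAlgebra R X →ₐ[R] FreeAlgebra R X)) :
    LinkDiagram R X B → List (DiagramMove X B) → Prop
  | _, [] => True
  | D, s :: l => D.LegalMove s ∧ D.moveMap s = φ s ∧ Realizes φ (D.move s) l

/-- The composition of prescribed algebra maps of a sequence of moves. -/
noncomputable def composeMaps (φ : DiagramMove X B → (FreeAlgebra R X →ₐ[R] FreeAlgebra R X)) :
    List (DiagramMove X B) → (FreeAlgebra R X →ₐ[R] FreeAlgebra R X)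
  | [] => AlgHom.id R _
  | s :: l => (composeMaps φ l).comp (φ s)

variable {φ : DiagramMove X B → (FreeAlgebra R X →ₐ[R] FreeAlgebra R X)}

theorem composeMaps_append (l₁ l₂ : List (DiagramMove X B)) :
    composeMaps φ (l₁ ++ l₂) = (composeMaps φ l₂).comp (composeMaps φ l₁) := by
  induction l₁ with
  | nil => rfl
  | cons s l ih => simp [composeMaps, ih, AlgHom.comp_assoc]

theorem Realizes.legal {D : LinkDiagram R X B} {l : List (DiagramMove X B)}
    (h : D.Realizes φ l) : D.Legal l := by
  induction l generalizing D with
  | nil => trivial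
  | cons s l ih => exact ⟨h.1, ih h.2.2⟩

theorem Realizes.inducedMap_eq {D : LinkDiagram R X B} {l : List (DiagramMove X B)}
    (h : D.Realizes φ l) : D.inducedMap l = composeMaps φ l := by
  induction l generalizing D with
  | nil => rfl
  | cons s l ih => rw [inducedMap, composeMaps, ih h.2.2, h.2.1]

theorem realizes_append {D : LinkDiagram R X B} {l₁ l₂ : List (DiagramMove X B)} :
    D.Realizes φ (l₁ ++ l₂) ↔ D.Realizes φ l₁ ∧ (D.conj (totalExchange l₁)).Realizes φ l₂ := by
  induction l₁ generalizing D with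
  | nil => simp [Realizes, totalExchange, conj_one]
  | cons s l ih =>
    have : (D.conj (totalExchange (s :: l))) = (D.move s).conj (totalExchange l) := rfl
    simp only [List.cons_append, Realizes, ih, this, and_assoc]

/-- The link passes successively through the members of the list `l`. -/
def Along (D : LinkDiagram R X B) (l : List (Passage X B)) : Prop :=
  ∀ u v, [u, v] <:+: l → D.follows u v

theorem Along.mono {D : LinkDiagram R X B} {l l' : List (Passage X B)} (h : D.Along l)
    (h' : l' <:+: l) : D.Along l' := fun u v huv => h u v (huv.trans h')

theorem Along.conj {D : LinkDiagram R X B} {l : List (Passage X B)} (h : D.Along l)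
    (E : Equiv.Perm (Passage X B)) : (D.conj E).Along (l.map E) := fun u v huv =>
  h _ _ ((List.pair_infix_map_equiv E l u v).1 huv)

/-- `D` is the diagram obtained by traversing the words `W i`, where the word `W i` is followed by
the word `W (next i)`. -/
def IsTraversal {ι : Type*} (D : LinkDiagram R X B) (W : ι → List (Passage X B))
    (next : ι → ι) : Prop :=
  ∀ u v, D.follows u v ↔ ∃ i, [u, v] <:+: W i ++ W (next i)

theorem IsTraversal.along {ι : Type*} {D : LinkDiagram R X B} {W : ι → List (Passage X B)}
    {next : ι → ι} (h : D.IsTraversal W next) (i : ι) : D.Along (W i) := fun u v huv =>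
  (h u v).2 ⟨i, huv.trans (List.prefix_append _ _).isInfix⟩

theorem IsTraversal.conj {ι : Type*} {D : LinkDiagram R X B} {W : ι → List (Passage X B)}
    {next : ι → ι} (h : D.IsTraversal W next) (E : Equiv.Perm (Passage X B)) :
    (D.conj E).IsTraversal (fun i => (W i).map E) next := fun u v => by
  simp only [← List.map_append, List.pair_infix_map_equiv]
  exact h _ _

/-- Cutting the link at other points gives the same adjacencies. This is the planar isotopy that
carries the box around the left end of the braid, from the beginning of one word to the end of the
preceding one. Nonemptiness ensures that a pair of neighbours never spans a whole word of either
cutting. -/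
theorem IsTraversal.rotate {ι : Type*} {D : LinkDiagram R X B} {V W : ι → List (Passage X B)}
    {next : Equiv.Perm ι} (h : D.IsTraversal (fun i => V i ++ W i) next)
    (h₁ : ∀ i, V i ++ W i ≠ []) (h₂ : ∀ i, W i ++ V (next i) ≠ []) :
    D.IsTraversal (fun i => W i ++ V (next i)) next := by
  intro u v
  rw [h u v]
  constructor
  -- With `i = next j`, the word `W i ++ V (next i)` lies in the middle of the concatenation, so the
  -- pair is contained in the two rotated words that start either at `j` or at `next j`.
  · rintro ⟨i, hi⟩
    obtain ⟨j, rfl⟩ := next.surjective i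
    have := List.pair_infix_append_append (X := V (next j)) (Y := W (next j) ++ V (next (next j)))
      (Z := W (next (next j))) (h₂ _) (by simpa using hi)
    rcases this with hi | hi
    · exact ⟨j, hi.trans ⟨W j, [], by simp⟩⟩
    · exact ⟨next j, hi.trans ⟨[], V (next (next (next j))), by simp⟩⟩
  · rintro ⟨i, hi⟩
    have := List.pair_infix_append_append (X := W i) (Y := V (next i) ++ W (next i))
      (Z := V (next (next i))) (h₁ _) (by simpa using hi)
    rcases this with hi | hi
    · exact ⟨i, hi.trans ⟨V i, [], by simp⟩⟩
    · exact ⟨next i, hi.trans ⟨[], W (next (next i)), by simp⟩⟩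

end LinkDiagram

namespace SatelliteBraid

variable {m n : ℕ} (S : SatelliteBraid m n) {R : Type*} [CommRing R] (t : S.BasePoint → Rˣ)

/-! ## Pushing the box through one strand -/

open Classical in
/-- The algebra map of a move of the purple-box loop. -/
noncomputable def loopMap : DiagramMove S.Chord S.BasePoint → (S.Alg R →ₐ[R] S.Alg R)
  | .triple tm tb mb =>
      FreeAlgebra.lift R fun x =>
        if x = tb then
          FreeAlgebra.ι R tb + (if ∃ ℓ, tm = .box ℓ then (1 : ℤ) else -1) •
            (FreeAlgebra.ι R tm * FreeAlgebra.ι R mb)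
        else FreeAlgebra.ι R x
  | .slide b x isOver back =>
      FreeAlgebra.lift R fun y =>
        if y = x then
          ((if isOver = back then t b else (t b)⁻¹ : Rˣ) : R) • FreeAlgebra.ι R x
        else FreeAlgebra.ι R y

variable {S}

/-- The over- or undercrossing at `x`. -/
def passAt (o : Bool) (x : S.Chord) : S.Pass := if o then .over x else .under x

theorem passAt_inj {o o' : Bool} {x y : S.Chord} : passAt o x = passAt o' y ↔ o = o' ∧ x = y := by
  cases o <;> cases o' <;> simp [passAt]

theorem passAt_ne_pt {o : Bool} {x : S.Chord} {b : S.BasePoint} : passAt o x ≠ .pt b := by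
  cases o <;> simp [passAt]

theorem over_eq_passAt (x : S.Chord) : (.over x : S.Pass) = passAt true x := rfl

/-- A passage of the box. -/
def IsBoxPass : S.Pass → Prop
  | .over x => ∃ ℓ, x = .box ℓ
  | .under x => ∃ ℓ, x = .box ℓ
  | .pt b => ∃ ℓ q, b = .box ℓ q

/-- A passage of the box or through one of the crossings `h q`. -/
def Touched (h : Fin n → S.Chord) (u : S.Pass) : Prop :=
  IsBoxPass u ∨ ∃ o q, u = passAt o (h q)

variable (S) in
/-- The passage through the `ℓ`-th crossing of the box of the strand entering the box in
position `q`. -/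
def boxCrossing (ℓ : Fin S.γ.len) (q : Fin n) : List S.Pass :=
  if S.γ.track ℓ q = S.γ.lower ℓ then [.under (.box ℓ)]
  else if S.γ.track ℓ q = S.γ.upper ℓ then [.over (.box ℓ)] else []

/-- The base point moves pushing a column of base points through a strand. -/
def pushColumn (o : Bool) (h : Fin n → S.Chord) (ℓ : Fin (S.γ.len + 1)) :
    List (DiagramMove S.Chord S.BasePoint) :=
  (List.finRange n).map fun q => .slide (.box ℓ q) (h ((S.γ.track ℓ).symm q)) o true

/-- The Reidemeister III move pushing a crossing of the box through a strand. -/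
def pushCrossing (o : Bool) (h : Fin n → S.Chord) (ℓ : Fin S.γ.len) :
    DiagramMove S.Chord S.BasePoint :=
  if o then .triple (.box ℓ) (h ((S.γ.track ℓ).symm (S.γ.upper ℓ)))
      (h ((S.γ.track ℓ).symm (S.γ.lower ℓ)))
  else .triple (h ((S.γ.track ℓ).symm (S.γ.upper ℓ))) (h ((S.γ.track ℓ).symm (S.γ.lower ℓ)))
      (.box ℓ)

theorem _root_.PositiveBraid.lower_ne_upper {n : ℕ} (b : PositiveBraid n) (ℓ : Fin b.len) :
    b.lower ℓ ≠ b.upper ℓ := by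
  intro h
  have := congrArg Fin.val h
  simp [PositiveBraid.lower, PositiveBraid.upper] at this

theorem _root_.PositiveBraid.track_succ {n : ℕ} (b : PositiveBraid n) (ℓ : Fin b.len) :
    b.track (ℓ + 1) = Equiv.swap (b.lower ℓ) (b.upper ℓ) * b.track ℓ := by
  simp [PositiveBraid.track]

theorem mem_boxCrossing {ℓ : Fin S.γ.len} {q : Fin n} {u : S.Pass}
    (hu : u ∈ S.boxCrossing ℓ q) : u = .under (.box ℓ) ∨ u = .over (.box ℓ) := by
  unfold boxCrossing at hu
  split_ifs at hu <;> simp_all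

/-! ### Sliding a column of base points through a strand -/

section Column

variable {o : Bool} {h : Fin n → S.Chord} {ℓ : Fin (S.γ.len + 1)} {τ : Fin n → Fin n}

/-- The transpositions have disjoint supports, since `q ↦ h (τ q)` is injective and `L` has no
repetition. In the application `τ` is the inverse of `γ.track ℓ`: the base point in position `q` of
the column lies on the strand that entered the box in position `τ q`. -/
theorem exchange_slides (hh : Function.Injective fun q => h (τ q)) (L : List (Fin n))
    (hL : L.Nodup) :
    let F := LinkDiagram.totalExchange (X := S.Chord) (B := S.BasePoint)
      (L.map fun q => .slide (.box ℓ q) (h (τ q)) o true)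
    (∀ q ∈ L, F (passAt o (h (τ q))) = .pt (.box ℓ q)) ∧
    (∀ q ∈ L, F (.pt (.box ℓ q)) = passAt o (h (τ q))) ∧
    (∀ u, (∀ q ∈ L, u ≠ passAt o (h (τ q)) ∧ u ≠ .pt (.box ℓ q)) → F u = u) := by
  classical
  induction L with
  | nil => simp [LinkDiagram.totalExchange]
  | cons q L ih =>
    obtain ⟨hq, hL⟩ := List.nodup_cons.1 hL
    obtain ⟨h₁, h₂, h₃⟩ := ih hL
    have hne : ∀ p ∈ L, p ≠ q := fun p hp e => hq (e ▸ hp)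
    have e₁ : ∀ p ∈ L, passAt o (h (τ p)) ≠ passAt o (h (τ q)) := fun p hp e =>
      hne p hp (hh (passAt_inj.1 e).2)
    intro F
    have hF : ∀ u, F u = LinkDiagram.totalExchange
        (L.map fun q => .slide (.box ℓ q) (h (τ q)) o true)
        (Equiv.swap (passAt o (h (τ q))) (.pt (.box ℓ q)) u) := by
      intro u
      simp only [F, List.map_cons, LinkDiagram.totalExchange, Equiv.Perm.mul_apply,
        LinkDiagram.exchange]
      congr!
    refine ⟨?_, ?_, ?_⟩
    · intro p hp
      rcases List.mem_cons.1 hp with rfl | hp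
      · rw [hF, Equiv.swap_apply_left, h₃]
        exact fun p' hp' => ⟨fun e => passAt_ne_pt e.symm, by simpa using (hne p' hp').symm⟩
      · rw [hF, Equiv.swap_apply_of_ne_of_ne (e₁ p hp) passAt_ne_pt, h₁ p hp]
    · intro p hp
      rcases List.mem_cons.1 hp with rfl | hp
      · rw [hF, Equiv.swap_apply_right, h₃]
        exact fun p' hp' => ⟨(e₁ p' hp').symm, passAt_ne_pt⟩
      · rw [hF, Equiv.swap_apply_of_ne_of_ne passAt_ne_pt.symm (by simpa using hne p hp), h₂ p hp]
    · intro u hu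
      rw [hF, Equiv.swap_apply_of_ne_of_ne (hu q (by simp)).1 (hu q (by simp)).2, h₃]
      exact fun p hp => hu p (by simp [hp])

/-- Base points in one column lie on different strands, so a slide does not disturb the adjacency
needed by the later ones. -/
theorem realizes_slides {D : LinkDiagram R S.Chord S.BasePoint} (hD : D.label = t)
    (hh : Function.Injective fun q => h (τ q)) (L : List (Fin n)) (hL : L.Nodup)
    (hf : ∀ q ∈ L, D.follows (passAt o (h (τ q))) (.pt (.box ℓ q))) :
    D.Realizes (S.loopMap t) (L.map fun q => .slide (.box ℓ q) (h (τ q)) o true) := by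
  classical
  induction L generalizing D with
  | nil => trivial
  | cons q L ih =>
    obtain ⟨hq, hL⟩ := List.nodup_cons.1 hL
    have hne : ∀ p ∈ L, p ≠ q := fun p hp e => hq (e ▸ hp)
    refine ⟨?_, ?_, ?_⟩
    · simpa [LinkDiagram.LegalMove, LinkDiagram.adj, passAt] using hf q (by simp)
    · subst hD
      rfl
    · refine ih (D := D.move _) hD hL fun p hp => ?_
      have e : ∀ u : S.Pass, u ≠ passAt o (h (τ q)) → u ≠ .pt (.box ℓ q) →
          (LinkDiagram.exchange (.slide (.box ℓ q) (h (τ q)) o true)).symm u = u := by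
        intro u h₁ h₂
        simp only [LinkDiagram.exchange, Equiv.symm_swap]
        exact Equiv.swap_apply_of_ne_of_ne h₁ h₂
      simp only [LinkDiagram.move]
      rw [e _ _ passAt_ne_pt, e _ passAt_ne_pt.symm]
      · exact hf p (by simp [hp])
      · simpa using hne p hp
      · exact fun e => hne p hp (hh (passAt_inj.1 e).2)

end Column

/-- The effect on the passages of pushing a part of the box through a strand: the strand entering
the box in position `q` passes through `pre q` before, and through `suf q` after, the crossing
`h q`, and the crossing `h (π q)` is in position `q`. -/
structure PushState (o : Bool) (h : Fin n → S.Chord) (E : Equiv.Perm S.Pass)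
    (pre suf : Fin n → List S.Pass) (π : Fin n → Fin n) : Prop where
  word : ∀ q, (passAt o (h q) :: S.boxBraid q).map E = pre q ++ passAt o (h q) :: suf q
  opp : ∀ q, E (passAt (!o) (h q)) = passAt (!o) (h (π q))
  fixed : ∀ u, ¬ Touched h u → E u = u

/-- The conditions on a diagram under which the box can be pushed through the strand crossing the
satellite strands in the crossings `h q`, apart from the position of the box. -/
structure Crossable (D : LinkDiagram R S.Chord S.BasePoint) (o : Bool) (h : Fin n → S.Chord)
    (s : ℤˣ) : Prop where
  injective : Function.Injective h
  ne_box : ∀ q ℓ, h q ≠ .box ℓ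
  sign_eq : ∀ q, D.sign (h q) = s
  adj : ∀ q q' : Fin n, (q : ℕ) + 1 = q' →
    D.adj (if o then s else -s) (passAt (!o) (h q)) (passAt (!o) (h q'))
  not_follows : o = false → s = 1 → ∀ q q' : Fin n, (q : ℕ) + 1 = q' →
    ¬ D.follows (.over (h q)) (.over (h q'))

/-! ### Pushing one column or one crossing of the box through a strand -/

section Step

variable {o : Bool} {h : Fin n → S.Chord} {s : ℤˣ} {E : Equiv.Perm S.Pass}
  {pre suf : Fin n → List S.Pass} {π : Fin n → Fin n} {D : LinkDiagram R S.Chord S.BasePoint}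

theorem PushState.along (hE : PushState o h E pre suf π)
    (hD : ∀ q, D.Along (passAt o (h q) :: S.boxBraid q)) (q : Fin n) :
    (D.conj E).Along (pre q ++ passAt o (h q) :: suf q) := by
  rw [← hE.word]
  exact (hD q).conj E

theorem PushState.follows (hE : PushState o h E pre suf π)
    (hD : ∀ q, D.Along (passAt o (h q) :: S.boxBraid q)) {q : Fin n} {u : S.Pass}
    {l : List S.Pass} (hq : suf q = u :: l) :
    (D.conj E).follows (passAt o (h q)) u :=
  hE.along hD q _ _ ⟨pre q, l, by simp [hq]⟩

/-- Only base points and the passages of the satellite strands themselves are exchanged. The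
opposite passages on the pushed-through strand do not move, hence `π` is unchanged. -/
theorem PushState.column (hE : PushState o h E pre suf π) (hh : Function.Injective h)
    (ℓ : Fin (S.γ.len + 1)) {suf' : Fin n → List S.Pass}
    (hsuf : ∀ q, suf q = .pt (.box ℓ (S.γ.track ℓ q)) :: suf' q)
    (hpre : ∀ q, ∀ u ∈ pre q ++ suf' q,
      (∀ p, u ≠ passAt o (h p)) ∧ ∀ p, u ≠ .pt (.box ℓ p)) :
    PushState o h (LinkDiagram.totalExchange (pushColumn o h ℓ) * E)
      (fun q => pre q ++ [.pt (.box ℓ (S.γ.track ℓ q))]) suf' π := by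
  obtain ⟨h₁, h₂, h₃⟩ := exchange_slides (o := o) (ℓ := ℓ) (τ := (S.γ.track ℓ).symm)
    (hh.comp (Equiv.injective _)) (List.finRange n) (List.nodup_finRange n)
  change (∀ q ∈ List.finRange n, LinkDiagram.totalExchange (pushColumn o h ℓ) _ = _) at h₁
  change (∀ q ∈ List.finRange n, LinkDiagram.totalExchange (pushColumn o h ℓ) _ = _) at h₂
  change (∀ u, _ → LinkDiagram.totalExchange (pushColumn o h ℓ) _ = _) at h₃
  refine ⟨fun q => ?_, fun q => ?_, fun u hu => ?_⟩
  · have hm : ∀ l : List S.Pass, (∀ u ∈ l, u ∈ pre q ++ suf' q) →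
        l.map (LinkDiagram.totalExchange (pushColumn o h ℓ)) = l := by
      intro l hl
      conv_rhs => rw [← List.map_id l]
      refine List.map_congr_left fun u hu => h₃ u fun p _ => ?_
      exact ⟨(hpre q u (hl u hu)).1 _, (hpre q u (hl u hu)).2 _⟩
    have h₁' := h₁ (S.γ.track ℓ q) (List.mem_finRange _)
    have h₂' := h₂ (S.γ.track ℓ q) (List.mem_finRange _)
    rw [Equiv.symm_apply_apply] at h₁' h₂'
    rw [Equiv.Perm.coe_mul, ← List.map_map, hE.word q, hsuf q, List.map_append, List.map_cons,
      List.map_cons, h₁', h₂', hm _ (by simp +contextual), hm _ (by simp +contextual)]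
    simp
  · rw [Equiv.Perm.mul_apply, hE.opp, h₃]
    intro p _
    exact ⟨fun e => by simpa using (passAt_inj.1 e).1, passAt_ne_pt⟩
  · rw [Equiv.Perm.mul_apply, hE.fixed u hu, h₃]
    intro p _
    refine ⟨?_, ?_⟩
    · rintro rfl
      exact hu (Or.inr ⟨_, _, rfl⟩)
    · rintro rfl
      exact hu (Or.inl ⟨_, _, rfl⟩)

theorem PushState.realizes_column (hE : PushState o h E pre suf π) (hh : Function.Injective h)
    (hDt : D.label = t) (hD : ∀ q, D.Along (passAt o (h q) :: S.boxBraid q))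
    (ℓ : Fin (S.γ.len + 1)) {suf' : Fin n → List S.Pass}
    (hsuf : ∀ q, suf q = .pt (.box ℓ (S.γ.track ℓ q)) :: suf' q) :
    (D.conj E).Realizes (S.loopMap t) (pushColumn o h ℓ) := by
  refine realizes_slides (D := D.conj E) (τ := (S.γ.track ℓ).symm) t hDt (hh.comp (Equiv.injective _)) _
    (List.nodup_finRange n) fun q _ => ?_
  refine hE.follows hD (l := suf' ((S.γ.track ℓ).symm q)) ?_
  rw [hsuf, Equiv.apply_symm_apply]

/-- The three transpositions of the Reidemeister III move are disjoint. Written with `passAt`, their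
effect is the same for a box passing over and for a box passing under: both box strands interchange
the crossing of the box with the crossing of the pushed-through strand, and the latter strand
interchanges its two crossings. -/
theorem exchange_pushCrossing (hh : Function.Injective h) (hbox : ∀ q ℓ, h q ≠ .box ℓ)
    (ℓ : Fin S.γ.len) :
    let G := LinkDiagram.exchange (pushCrossing o h ℓ)
    let hO := h ((S.γ.track ℓ).symm (S.γ.upper ℓ))
    let hU := h ((S.γ.track ℓ).symm (S.γ.lower ℓ))
    (G (passAt o hO) = .over (.box ℓ) ∧ G (.over (.box ℓ)) = passAt o hO) ∧
    (G (passAt o hU) = .under (.box ℓ) ∧ G (.under (.box ℓ)) = passAt o hU) ∧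
    (G (passAt (!o) hO) = passAt (!o) hU ∧ G (passAt (!o) hU) = passAt (!o) hO) ∧
    ∀ u, (∀ o', u ≠ passAt o' hO) → (∀ o', u ≠ passAt o' hU) → (∀ o', u ≠ passAt o' (.box ℓ)) →
      G u = u := by
  classical
  intro G hO hU
  have hne : hO ≠ hU := fun e => S.γ.lower_ne_upper ℓ
    ((Equiv.injective _ (hh e)).symm)
  let a : S.Chord := .box ℓ
  have h₁ : hO ≠ a := hbox _ _
  have h₂ : hU ≠ a := hbox _ _
  have hG : ∀ u, G u = if o then
      Equiv.swap (Passage.over hO) (Passage.over a)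
        (Equiv.swap (Passage.under a) (Passage.over hU)
          (Equiv.swap (Passage.under hU) (Passage.under hO) u)) else
      Equiv.swap (Passage.over hU) (Passage.over hO)
        (Equiv.swap (Passage.under hO) (Passage.over a)
          (Equiv.swap (Passage.under a) (Passage.under hU) u)) := by
    intro u
    cases o <;> simp only [G, pushCrossing, LinkDiagram.exchange] <;> simp <;> congr!
  change (G (passAt o hO) = .over a ∧ G (.over a) = passAt o hO) ∧
    (G (passAt o hU) = .under a ∧ G (.under a) = passAt o hU) ∧
    (G (passAt (!o) hO) = passAt (!o) hU ∧ G (passAt (!o) hU) = passAt (!o) hO) ∧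
    ∀ u, (∀ o', u ≠ passAt o' hO) → (∀ o', u ≠ passAt o' hU) → (∀ o', u ≠ passAt o' a) → G u = u
  -- The three chords become atoms: what remains depends only on their being distinct.
  clear_value G hO hU a
  have hn := hne.symm
  have hn₁ := h₁.symm
  have hn₂ := h₂.symm
  refine ⟨?_, ?_, ?_, ?_⟩
  · cases o <;> simp [passAt, Equiv.swap_apply_def, *]
  · cases o <;> simp [passAt, Equiv.swap_apply_def, *]
  · cases o <;> simp [passAt, Equiv.swap_apply_def, *]
  · intro u e₁ e₂ e₃
    simp only [Bool.forall_bool, passAt, if_true, Bool.false_eq_true, if_false] at e₁ e₂ e₃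
    cases o <;> simp [Equiv.swap_apply_def, *]

/-- The interchange of the two crossings on the pushed-through strand is the transposition by which
`γ.track (ℓ + 1)` differs from `γ.track ℓ`, so the position function keeps the form of an inverse
track. -/
theorem PushState.crossing (ℓ : Fin S.γ.len)
    (hE : PushState o h E pre suf (S.γ.track ℓ).symm) (hh : Function.Injective h)
    (hbox : ∀ q ℓ, h q ≠ .box ℓ) {suf' : Fin n → List S.Pass}
    (hsuf : ∀ q, suf q = S.boxCrossing ℓ q ++ suf' q)
    (hpre : ∀ q, ∀ u ∈ pre q ++ suf' q,
      (∀ o' p, u ≠ passAt o' (h p)) ∧ ∀ o', u ≠ passAt o' (.box ℓ)) :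
    PushState o h (LinkDiagram.exchange (pushCrossing o h ℓ) * E)
      (fun q => pre q ++ S.boxCrossing ℓ q) suf' (S.γ.track (ℓ + 1)).symm := by
  obtain ⟨⟨h₁, h₁'⟩, ⟨h₂, h₂'⟩, ⟨h₃, h₃'⟩, h₄⟩ := exchange_pushCrossing (o := o) hh hbox ℓ
  refine ⟨fun q => ?_, fun q => ?_, fun u hu => ?_⟩
  · have hm : ∀ l : List S.Pass, (∀ u ∈ l, u ∈ pre q ++ suf' q) →
        l.map (LinkDiagram.exchange (pushCrossing o h ℓ)) = l := by
      intro l hl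
      conv_rhs => rw [← List.map_id l]
      refine List.map_congr_left fun u hu => h₄ u ?_ ?_ ?_
      · exact fun o' => (hpre q u (hl u hu)).1 _ _
      · exact fun o' => (hpre q u (hl u hu)).1 _ _
      · exact fun o' => (hpre q u (hl u hu)).2 _
    rw [Equiv.Perm.coe_mul, ← List.map_map, hE.word q, hsuf q, List.map_append, List.map_cons,
      List.map_append, hm (pre q) (by simp +contextual), hm (suf' q) (by simp +contextual)]
    unfold boxCrossing
    split_ifs with c₁ c₂
    · have : q = (S.γ.track ℓ).symm (S.γ.lower ℓ) := by rw [← c₁, Equiv.symm_apply_apply]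
      rw [this]
      simp [h₂, h₂']
    · have : q = (S.γ.track ℓ).symm (S.γ.upper ℓ) := by rw [← c₂, Equiv.symm_apply_apply]
      rw [this]
      simp [h₁, h₁']
    · rw [h₄]
      · simp
      · intro o' e
        exact c₂ (by rw [hh (passAt_inj.1 e).2, Equiv.apply_symm_apply])
      · intro o' e
        exact c₁ (by rw [hh (passAt_inj.1 e).2, Equiv.apply_symm_apply])
      · intro o' e
        exact hbox _ _ (passAt_inj.1 e).2
  · have e : (S.γ.track (ℓ + 1)).symm q =
        (S.γ.track ℓ).symm (Equiv.swap (S.γ.lower ℓ) (S.γ.upper ℓ) q) := by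
      rw [S.γ.track_succ]; rfl
    rw [Equiv.Perm.mul_apply, hE.opp, e]
    by_cases c₁ : q = S.γ.lower ℓ
    · rw [c₁, Equiv.swap_apply_left, h₃']
    by_cases c₂ : q = S.γ.upper ℓ
    · rw [c₂, Equiv.swap_apply_right, h₃]
    rw [Equiv.swap_apply_of_ne_of_ne c₁ c₂, h₄]
    · exact fun o' e => c₂ (Equiv.injective _ (hh (passAt_inj.1 e).2))
    · exact fun o' e => c₁ (Equiv.injective _ (hh (passAt_inj.1 e).2))
    · exact fun o' e => hbox _ _ (passAt_inj.1 e).2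
  · rw [Equiv.Perm.mul_apply, hE.fixed u hu, h₄]
    · rintro o' rfl
      exact hu (Or.inr ⟨_, _, rfl⟩)
    · rintro o' rfl
      exact hu (Or.inr ⟨_, _, rfl⟩)
    · rintro o' rfl
      exact hu (Or.inl (by cases o' <;> exact ⟨_, rfl⟩))

/-- On the box strands the crossing of the box directly follows the crossing with the pushed-through
strand. On the latter strand the two crossings are neighbours because they occupy the adjacent
positions `lower` and `upper`. With signs `s`, `s`, `1` at the three corners, these adjacencies
agree with the directions forced by planarity, and the sign of the map does not depend on `s`. -/
theorem PushState.realizes_crossing (ℓ : Fin S.γ.len)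
    (hE : PushState o h E pre suf (S.γ.track ℓ).symm)
    (hC : Crossable D o h s) (hsign : ∀ ℓ, D.sign (.box ℓ) = 1)
    (hD : ∀ q, D.Along (passAt o (h q) :: S.boxBraid q))
    {suf' : Fin n → List S.Pass} (hsuf : ∀ q, suf q = S.boxCrossing ℓ q ++ suf' q) :
    (D.conj E).Realizes (S.loopMap t) [pushCrossing o h ℓ] := by
  obtain ⟨hh, hbox, hs, hadj, hnot⟩ := hC
  set hO := h ((S.γ.track ℓ).symm (S.γ.upper ℓ)) with hhO
  set hU := h ((S.γ.track ℓ).symm (S.γ.lower ℓ)) with hhU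
  have hne : hO ≠ hU := fun e => S.γ.lower_ne_upper ℓ
    ((Equiv.injective _ (hh e)).symm)
  have h₁ : hO ≠ .box ℓ := hbox _ _
  have h₂ : hU ≠ .box ℓ := hbox _ _
  have fO : (D.conj E).follows (passAt o hO) (.over (.box ℓ)) :=
    hE.follows hD (l := suf' _) (by
      rw [hsuf, boxCrossing, if_neg, if_pos]
      · rfl
      · simp
      · simpa using (S.γ.lower_ne_upper ℓ).symm)
  have fU : (D.conj E).follows (passAt o hU) (.under (.box ℓ)) :=
    hE.follows hD (l := suf' _) (by
      rw [hsuf, boxCrossing, if_pos]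
      · rfl
      · simp)
  have sO : (D.conj E).sign hO = s := hs _
  have sU : (D.conj E).sign hU = s := hs _
  have sa : (D.conj E).sign (.box ℓ) = 1 := hsign _
  -- By the invariant `opp`, the crossing now in position `q` of the pushed-through strand stands
  -- where `h q` stood in `D`, so adjacency can be read off in the original diagram.
  have hEs : ∀ q, E.symm (passAt (!o) (h ((S.γ.track ℓ).symm q))) = passAt (!o) (h q) := fun q => by
    rw [← hE.opp, Equiv.symm_apply_apply]
  have hlu : ((S.γ.lower ℓ : Fin n) : ℕ) + 1 = S.γ.upper ℓ := rfl
  have fA : (D.conj E).adj (if o then s else -s) (passAt (!o) hU) (passAt (!o) hO) := by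
    have := hadj _ _ hlu
    unfold LinkDiagram.adj LinkDiagram.conj at *
    simp only [hhO, hhU, hEs]
    exact this
  have ss : s * s = 1 := Int.units_mul_self s
  cases o
  · have hnot' : s = 1 → ¬ (D.conj E).follows (.over hU) (.over hO) := by
      intro h1
      have := hnot rfl h1 _ _ hlu
      rw [over_eq_passAt, over_eq_passAt] at this ⊢
      simp only [Bool.not_false] at hEs
      simpa only [LinkDiagram.conj, hhO, hhU, hEs] using this
    have dT : (D.conj E).dirTop hO hU = -s := by
      unfold LinkDiagram.dirTop
      -- The value `-1` is the default of `dirTop`. For `s = 1` it is therefore not enough that the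
      -- top strand runs from `hO` to `hU`; the reverse adjacency has to be excluded, which is the
      -- purpose of `not_follows`.
      rcases Int.units_eq_one_or s with rfl | rfl
      · rw [if_neg (hnot' rfl)]
      · rw [if_pos, neg_neg]
        simpa [LinkDiagram.adj, passAt] using fA
    have dM : (D.conj E).dirMiddle hO hU (.box ℓ) = 1 := by
      simp [LinkDiagram.dirMiddle, dT, sU, sa, ss]
    have dB : (D.conj E).dirBottom hO hU (.box ℓ) = -1 := by
      simp [LinkDiagram.dirBottom, dT, sO, sa, ss]
    refine ⟨?_, ?_, trivial⟩
    · simp only [pushCrossing, Bool.false_eq_true, if_false, LinkDiagram.LegalMove]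
      refine ⟨hne, h₁, h₂, ?_, ?_, ?_⟩
      · rw [← hhO, ← hhU, dT]
        exact fA
      · rw [← hhO, ← hhU, dM]
        simpa [LinkDiagram.adj, passAt] using fO
      · rw [← hhO, ← hhU, dB]
        have : (-1 : ℤˣ) ≠ 1 := by decide
        simpa [LinkDiagram.adj, passAt, this] using fU
    · simp only [pushCrossing, Bool.false_eq_true, if_false, LinkDiagram.moveMap, loopMap]
      rw [← hhO, ← hhU, sO, sU, sa, if_neg (by rintro ⟨ℓ', e⟩; exact hbox _ _ e)]
      -- The quadrant signs at the two crossings with the top strand are equal and cancel; the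
      -- quadrant at the positive crossing of the box contributes `-1`.
      have : (D.conj E).tripleSign hO hU (.box ℓ) = -1 := by
        rw [LinkDiagram.tripleSign, LinkDiagram.quadrantSign, LinkDiagram.quadrantSign,
          LinkDiagram.quadrantSign, dT, dM, sO, sU, sa, Int.units_mul_self]
        simp
      congr 1
      funext x
      by_cases hx : x = hU
      · rw [if_pos ⟨hx, by rw [mul_one, ss]⟩, if_pos hx, this]
        rfl
      · rw [if_neg fun e => hx e.1, if_neg hx]
  · have dT : (D.conj E).dirTop (.box ℓ) hO = 1 := if_pos fO
    have dM : (D.conj E).dirMiddle (.box ℓ) hO hU = -1 := by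
      simp [LinkDiagram.dirMiddle, dT, sO, sU, ss]
    have dB : (D.conj E).dirBottom (.box ℓ) hO hU = s := by
      simp [LinkDiagram.dirBottom, dT, sU, sa]
    refine ⟨?_, ?_, trivial⟩
    · simp only [pushCrossing, if_true, LinkDiagram.LegalMove]
      refine ⟨h₁.symm, h₂.symm, hne, ?_, ?_, ?_⟩
      · rw [← hhO, dT]
        simpa [LinkDiagram.adj, passAt] using fO
      · rw [← hhO, ← hhU, dM]
        have : (-1 : ℤˣ) ≠ 1 := by decide
        simpa [LinkDiagram.adj, passAt, this] using fU
      · rw [← hhO, ← hhU, dB]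
        exact fA
    · simp only [pushCrossing, if_true, LinkDiagram.moveMap, loopMap]
      rw [← hhO, ← hhU, sO, sU, sa, if_pos ⟨ℓ, rfl⟩]
      -- All three quadrants are bounded by a ray against the orientation of the overstrand, so each
      -- has sign `1`.
      have : (D.conj E).tripleSign (.box ℓ) hO hU = 1 := by
        simp [LinkDiagram.tripleSign, LinkDiagram.quadrantSign, dT, dM, sO, sU, sa]
      congr 1
      funext x
      by_cases hx : x = hO
      · rw [if_pos ⟨hx, by rw [one_mul, ss]⟩, if_pos hx, this]
        rfl
      · rw [if_neg fun e => hx e.1, if_neg hx]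

end Step

end SatelliteBraid

/-! ### Pushing the whole box through a strand, layer by layer -/

namespace SatelliteBraid

variable {m n : ℕ} {S : SatelliteBraid m n} {R : Type*} [CommRing R] (t : S.BasePoint → Rˣ)

theorem IsBoxPass.ne_passAt {u : S.Pass} (hu : IsBoxPass u) {x : S.Chord}
    (hx : ∀ ℓ, x ≠ .box ℓ) (o : Bool) : u ≠ passAt o x := by
  rintro rfl
  cases o <;> obtain ⟨ℓ, hℓ⟩ := hu <;> exact hx ℓ hℓ

theorem isBoxPass_of_mem_boxCrossing {ℓ : Fin S.γ.len} {q : Fin n} {u : S.Pass}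
    (hu : u ∈ S.boxCrossing ℓ q) : IsBoxPass u := by
  rcases mem_boxCrossing hu with rfl | rfl <;> exact ⟨_, rfl⟩

/-- The base point in the `ℓ`-th column of the box and the passage through the `ℓ`-th crossing. -/
def boxColumn (S : SatelliteBraid m n) (q : Fin n) (ℓ : Fin S.γ.len) : List S.Pass :=
  .pt (.box ℓ.castSucc (S.γ.track ℓ q)) :: S.boxCrossing ℓ q

/-- The moves pushing the `ℓ`-th column of base points and the `ℓ`-th crossing of the box. -/
def pushLayer (o : Bool) (h : Fin n → S.Chord) (ℓ : Fin S.γ.len) :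
    List (DiagramMove S.Chord S.BasePoint) :=
  pushColumn o h ℓ.castSucc ++ [pushCrossing o h ℓ]

theorem isBoxPass_of_mem_boxColumn {ℓ : Fin S.γ.len} {q : Fin n} {u : S.Pass}
    (hu : u ∈ S.boxColumn q ℓ) : IsBoxPass u := by
  rcases List.mem_cons.1 hu with rfl | hu
  · exact ⟨_, _, rfl⟩
  · exact isBoxPass_of_mem_boxCrossing hu

theorem ne_pt_of_mem_boxCrossing {ℓ : Fin S.γ.len} {q : Fin n} {u : S.Pass}
    (hu : u ∈ S.boxCrossing ℓ q) (b : S.BasePoint) : u ≠ .pt b := by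
  rcases mem_boxCrossing hu with rfl | rfl <;> simp

theorem ne_pt_of_mem_boxColumn {k ℓ : Fin S.γ.len} (hk : k ≠ ℓ) {q : Fin n} {u : S.Pass}
    (hu : u ∈ S.boxColumn q k) (p : Fin n) : u ≠ .pt (.box ℓ.castSucc p) := by
  rcases List.mem_cons.1 hu with rfl | hu
  · simp [hk]
  · exact ne_pt_of_mem_boxCrossing hu _

theorem ne_passAt_box_of_mem_boxColumn {k ℓ : Fin S.γ.len} (hk : k ≠ ℓ) {q : Fin n} {u : S.Pass}
    (hu : u ∈ S.boxColumn q k) (o : Bool) : u ≠ passAt o (.box ℓ) := by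
  rcases List.mem_cons.1 hu with rfl | hu
  · exact passAt_ne_pt.symm
  · rcases mem_boxCrossing hu with rfl | rfl <;> cases o <;> simp [passAt, hk]

theorem isBoxPass_of_mem_boxBraid {q : Fin n} {u : S.Pass} (hu : u ∈ S.boxBraid q) :
    IsBoxPass u := by
  rcases List.mem_append.1 hu with hu | hu
  · obtain ⟨ℓ, -, hu⟩ := List.mem_flatMap.1 hu
    exact isBoxPass_of_mem_boxColumn hu
  · rw [List.mem_singleton.1 hu]
    exact ⟨_, _, rfl⟩

section Push

variable {o : Bool} {h : Fin n → S.Chord} {s : ℤˣ} {D : LinkDiagram R S.Chord S.BasePoint}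

/-- Induction on the number of layers pushed, a layer being a column of base points followed by a
crossing. The exchange and the legality are carried together because the legality of the next layer
needs the words produced by the previous ones; the first half holds independently of any diagram. -/
theorem pushState_prefix (hh : Function.Injective h) (hbox : ∀ q ℓ, h q ≠ .box ℓ) (ℓ : ℕ)
    (hℓ : ℓ ≤ S.γ.len) :
    PushState o h
      (LinkDiagram.totalExchange (((List.finRange S.γ.len).take ℓ).flatMap (pushLayer o h)))
      (fun q => ((List.finRange S.γ.len).take ℓ).flatMap (S.boxColumn q))
      (fun q => ((List.finRange S.γ.len).drop ℓ).flatMap (S.boxColumn q) ++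
          [.pt (.box (Fin.last _) (S.γ.perm q))])
      (S.γ.track ℓ).symm ∧
    ∀ (s : ℤˣ) (D : LinkDiagram R S.Chord S.BasePoint), Crossable D o h s → D.label = t →
      (∀ ℓ, D.sign (.box ℓ) = 1) → (∀ q, D.Along (passAt o (h q) :: S.boxBraid q)) →
      D.Realizes (S.loopMap t) (((List.finRange S.γ.len).take ℓ).flatMap (pushLayer o h)) := by
  induction ℓ with
  | zero =>
    refine ⟨⟨fun q => ?_, fun q => ?_, fun u _ => rfl⟩, fun _ _ _ _ _ _ => trivial⟩
    · simp only [List.take_zero, List.flatMap_nil, LinkDiagram.totalExchange, List.drop_zero,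
        List.nil_append, Equiv.Perm.coe_one, List.map_id]
      rfl
    · rfl
  | succ ℓ ih =>
    obtain ⟨hE, hR⟩ := ih (by omega)
    have hlt : ℓ < S.γ.len := hℓ
    set L : Fin S.γ.len := ⟨ℓ, hlt⟩ with hL
    have htake : (List.finRange S.γ.len).take (ℓ + 1) = (List.finRange S.γ.len).take ℓ ++ [L] := by
      rw [List.take_add_one]
      simp [hlt, hL]
    have hdrop : (List.finRange S.γ.len).drop ℓ = L :: (List.finRange S.γ.len).drop (ℓ + 1) := by
      rw [List.drop_eq_getElem_cons (by simpa using hlt)]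
      simp [hL]
    have mtake : ∀ k ∈ (List.finRange S.γ.len).take ℓ, k ≠ L := by
      intro k hk
      obtain ⟨i, hi, rfl⟩ := List.mem_take_iff_getElem.1 hk
      simp only [lt_inf_iff] at hi
      simp only [List.getElem_finRange, hL, ne_eq, Fin.ext_iff, Fin.val_cast]
      omega
    have mdrop : ∀ k ∈ (List.finRange S.γ.len).drop (ℓ + 1), k ≠ L := by
      intro k hk
      obtain ⟨i, hi, rfl⟩ := List.mem_drop_iff_getElem.1 hk
      simp only [List.getElem_finRange, hL, ne_eq, Fin.ext_iff, Fin.val_cast]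
      omega
    set rest : Fin n → List S.Pass := fun q =>
      ((List.finRange S.γ.len).drop (ℓ + 1)).flatMap (S.boxColumn q) ++
        [.pt (.box (Fin.last _) (S.γ.perm q))] with hrest
    -- Different layers involve different base points and crossings, so pushing layer `L` fixes the
    -- layers still waiting, and by `mpre` also those already pushed.
    have mrest : ∀ q, ∀ u ∈ rest q, IsBoxPass u ∧ (∀ p, u ≠ .pt (.box L.castSucc p)) ∧
        ∀ o, u ≠ passAt o (.box L) := by
      intro q u hu
      rcases List.mem_append.1 hu with hu | hu
      · obtain ⟨k, hk, hu⟩ := List.mem_flatMap.1 hu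
        exact ⟨isBoxPass_of_mem_boxColumn hu, ne_pt_of_mem_boxColumn (mdrop k hk) hu,
          ne_passAt_box_of_mem_boxColumn (mdrop k hk) hu⟩
      · rw [List.mem_singleton.1 hu]
        refine ⟨⟨_, _, rfl⟩, fun p => ?_, fun o => passAt_ne_pt.symm⟩
        simp [Fin.ext_iff, hL, hlt.ne']
    have mpre : ∀ q, ∀ u ∈ ((List.finRange S.γ.len).take ℓ).flatMap (S.boxColumn q),
        IsBoxPass u ∧ (∀ p, u ≠ .pt (.box L.castSucc p)) ∧ ∀ o, u ≠ passAt o (.box L) := by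
      intro q u hu
      obtain ⟨k, hk, hu⟩ := List.mem_flatMap.1 hu
      exact ⟨isBoxPass_of_mem_boxColumn hu, ne_pt_of_mem_boxColumn (mtake k hk) hu,
        ne_passAt_box_of_mem_boxColumn (mtake k hk) hu⟩
    have hsuf : ∀ q, ((List.finRange S.γ.len).drop ℓ).flatMap (S.boxColumn q) ++
        [.pt (.box (Fin.last _) (S.γ.perm q))] =
        .pt (.box L.castSucc (S.γ.track L.castSucc q)) :: (S.boxCrossing L q ++ rest q) := by
      intro q
      simp [hdrop, hrest, boxColumn]
    have hcol := hE.column hh L.castSucc hsuf (by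
      intro q u hu
      rcases List.mem_append.1 hu with hu | hu
      · exact ⟨fun p => (mpre q u hu).1.ne_passAt (hbox p) o, (mpre q u hu).2.1⟩
      rcases List.mem_append.1 hu with hu | hu
      · exact ⟨fun p => (isBoxPass_of_mem_boxCrossing hu).ne_passAt (hbox p) o,
          fun p => ne_pt_of_mem_boxCrossing hu _⟩
      · exact ⟨fun p => (mrest q u hu).1.ne_passAt (hbox p) o, (mrest q u hu).2.1⟩)
    have hcr := hcol.crossing L hh hbox (fun q => rfl) (by
      intro q u hu
      rcases List.mem_append.1 hu with hu | hu
      · rcases List.mem_append.1 hu with hu | hu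
        · exact ⟨fun o' p => (mpre q u hu).1.ne_passAt (hbox p) o', (mpre q u hu).2.2⟩
        · rw [List.mem_singleton.1 hu]
          exact ⟨fun _ _ => passAt_ne_pt.symm, fun _ => passAt_ne_pt.symm⟩
      · exact ⟨fun o' p => (mrest q u hu).1.ne_passAt (hbox p) o', (mrest q u hu).2.2⟩)
    have hmoves : ((List.finRange S.γ.len).take (ℓ + 1)).flatMap (pushLayer o h) =
        ((List.finRange S.γ.len).take ℓ).flatMap (pushLayer o h) ++
          (pushColumn o h L.castSucc ++ [pushCrossing o h L]) := by
      simp [htake, pushLayer]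
    refine ⟨?_, fun s D hC hDt hs hD => ?_⟩
    · rw [hmoves, LinkDiagram.totalExchange_append, LinkDiagram.totalExchange_append, mul_assoc]
      convert hcr using 1
      · simp [LinkDiagram.totalExchange]
      · funext q
        simp [htake, boxColumn]
    · rw [hmoves, LinkDiagram.realizes_append, LinkDiagram.realizes_append]
      refine ⟨hR s D hC hDt hs hD, hE.realizes_column t hh hDt hD _ hsuf, ?_⟩
      rw [LinkDiagram.conj_conj]
      exact hcol.realizes_crossing t L hC hs hD fun q => rfl

theorem pushBox_eq (o : Bool) (h : Fin n → S.Chord) :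
    S.pushBox o h =
      (List.finRange S.γ.len).flatMap (pushLayer o h) ++ pushColumn o h (Fin.last _) := rfl

/-- The effect on the passages of pushing the box through a strand. -/
theorem pushState_pushBox (hh : Function.Injective h) (hbox : ∀ q ℓ, h q ≠ .box ℓ) :
    PushState o h (LinkDiagram.totalExchange (S.pushBox o h)) S.boxBraid (fun _ => [])
      S.γ.perm.symm := by
  -- The statement on passages does not involve coefficients, so any ring and any labels serve.
  have hE := (pushState_prefix (R := ℤ) (o := o) (fun _ => 1) hh hbox S.γ.len le_rfl).1
  have e : (List.finRange S.γ.len).take S.γ.len = List.finRange S.γ.len :=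
    List.take_of_length_le (by simp)
  have e' : (List.finRange S.γ.len).drop S.γ.len = [] := List.drop_of_length_le (by simp)
  rw [e, e'] at hE
  rw [pushBox_eq, LinkDiagram.totalExchange_append]
  refine hE.column hh (Fin.last _) (suf' := fun _ => []) (fun q => rfl) ?_
  intro q u hu
  rw [List.append_nil] at hu
  obtain ⟨k, hk, hu⟩ := List.mem_flatMap.1 hu
  refine ⟨fun p => (isBoxPass_of_mem_boxColumn hu).ne_passAt (hbox p) o, fun p => ?_⟩
  rcases List.mem_cons.1 hu with rfl | hu
  · simp [Fin.ext_iff, k.2.ne]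
  · exact ne_pt_of_mem_boxCrossing hu _

theorem realizes_pushBox (hC : Crossable D o h s) (hDt : D.label = t)
    (hs : ∀ ℓ, D.sign (.box ℓ) = 1) (hD : ∀ q, D.Along (passAt o (h q) :: S.boxBraid q)) :
    D.Realizes (S.loopMap t) (S.pushBox o h) := by
  obtain ⟨hE, hR⟩ := pushState_prefix (o := o) t hC.injective hC.ne_box S.γ.len le_rfl
  have e : (List.finRange S.γ.len).take S.γ.len = List.finRange S.γ.len :=
    List.take_of_length_le (by simp)
  have e' : (List.finRange S.γ.len).drop S.γ.len = [] := List.drop_of_length_le (by simp)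
  rw [e, e'] at hE
  rw [e] at hR
  rw [pushBox_eq, LinkDiagram.realizes_append]
  refine ⟨hR s D hC hDt hs hD, ?_⟩
  exact hE.realizes_column t hC.injective hDt hD (Fin.last _) (suf' := fun _ => [])
    (fun q => rfl)

end Push

/-! ## Pushing the box through several strands -/

/-- Push the box through several strands, successively. -/
def pushAll (H : List (Bool × (Fin n → S.Chord))) : List (DiagramMove S.Chord S.BasePoint) :=
  H.flatMap fun x => S.pushBox x.1 x.2

/-- Crossings of satellite strands with different strands outside the box. -/
structure Separated (H : List (Bool × (Fin n → S.Chord))) : Prop where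
  injective : ∀ x ∈ H, Function.Injective x.2
  ne_box : ∀ x ∈ H, ∀ q ℓ, x.2 q ≠ .box ℓ
  pairwise : H.Pairwise fun x y => ∀ q q', x.2 q ≠ y.2 q'

theorem Separated.tail {x : Bool × (Fin n → S.Chord)} {H : List (Bool × (Fin n → S.Chord))}
    (h : Separated (x :: H)) : Separated H :=
  ⟨fun y hy => h.injective y (by simp [hy]), fun y hy => h.ne_box y (by simp [hy]),
    (List.pairwise_cons.1 h.pairwise).2⟩

theorem not_touched_passAt {h : Fin n → S.Chord} {x : S.Chord} (hx : ∀ ℓ, x ≠ .box ℓ)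
    (hx' : ∀ q, x ≠ h q) (o : Bool) : ¬ Touched h (passAt o x) := by
  rintro (hb | ⟨o', q, e⟩)
  · exact hb.ne_passAt hx o rfl
  · exact hx' q (passAt_inj.1 e).2

/-- The satellite strand entering the box in position `q`, before the box is pushed through the
strands in `H`. -/
def approach (H : List (Bool × (Fin n → S.Chord))) (q : Fin n) : List S.Pass :=
  (H.map fun x => passAt x.1 (x.2 q)).reverse

/-- Pushing through one group fixes all passages at the others, as the groups are separated. Hence
the single pushes combine: the box moves from the end to the beginning of `approach H q`, which
lists the groups in the reverse order because the box travels against the orientation, and each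
group is permuted on its opposite strand. -/
theorem totalExchange_pushAll {H : List (Bool × (Fin n → S.Chord))} (hH : Separated H) :
    let E := LinkDiagram.totalExchange (pushAll H)
    (∀ q, (approach H q ++ S.boxBraid q).map E = S.boxBraid q ++ approach H q) ∧
    (∀ x ∈ H, ∀ q, E (passAt (!x.1) (x.2 q)) = passAt (!x.1) (x.2 (S.γ.perm.symm q))) ∧
    (∀ u, ¬ IsBoxPass u → (∀ x ∈ H, ∀ o q, u ≠ passAt o (x.2 q)) → E u = u) := by
  induction H with
  | nil => simp [pushAll, LinkDiagram.totalExchange, approach]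
  | cons x H ih =>
    obtain ⟨hw, hopp, hfix⟩ := ih hH.tail
    have hx := (List.pairwise_cons.1 hH.pairwise).1
    have hxb := hH.ne_box x (by simp)
    have h₀ := pushState_pushBox (o := x.1) (hH.injective x (by simp)) hxb
    intro E
    have hE : E = LinkDiagram.totalExchange (pushAll H) *
        LinkDiagram.totalExchange (S.pushBox x.1 x.2) := by
      rw [← LinkDiagram.totalExchange_append]
      rfl
    have hfx : ∀ o q, LinkDiagram.totalExchange (pushAll H) (passAt o (x.2 q)) =
        passAt o (x.2 q) := fun o q =>
      hfix _ (fun hb => hb.ne_passAt (hxb q) o rfl) fun y hy o' q' e =>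
        hx y hy q q' (passAt_inj.1 e).2
    have hfy : ∀ y ∈ H, ∀ o q, LinkDiagram.totalExchange (S.pushBox x.1 x.2)
        (passAt o (y.2 q)) = passAt o (y.2 q) := fun y hy o q =>
      h₀.fixed _ (not_touched_passAt (hH.ne_box y (by simp [hy]) q)
        (fun q' e => hx y hy q' q e.symm) o)
    refine ⟨fun q => ?_, fun y hy q => ?_, fun u hu hu' => ?_⟩
    · have h₁ : (approach H q).map (LinkDiagram.totalExchange (S.pushBox x.1 x.2)) =
          approach H q := by
        conv_rhs => rw [← List.map_id (approach H q)]
        refine List.map_congr_left fun u hu => ?_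
        obtain ⟨y, hy, rfl⟩ := List.mem_map.1 (List.mem_reverse.1 hu)
        exact hfy y hy _ _
      have h₂ : approach (x :: H) q ++ S.boxBraid q =
          approach H q ++ (passAt x.1 (x.2 q) :: S.boxBraid q) := by simp [approach]
      rw [hE, Equiv.Perm.coe_mul, ← List.map_map, h₂, List.map_append, h₁, h₀.word,
        ← List.append_assoc, List.map_append, hw]
      simp [approach, hfx]
    · rw [hE, Equiv.Perm.mul_apply]
      rcases List.mem_cons.1 hy with rfl | hy
      · rw [h₀.opp, hfx]
      · rw [hfy y hy, hopp y hy]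
    · rw [hE, Equiv.Perm.mul_apply, h₀.fixed, hfix u hu fun y hy => hu' y (by simp [hy])]
      rintro (hb | ⟨o, q, e⟩)
      · exact hu hb
      · exact hu' x (by simp) o q e

/-- `Crossable` sees the diagram only through signs and adjacencies on the opposite strand. It
therefore survives pushes through other groups and can be checked once, in the diagram at the
beginning of a stage. -/
theorem Crossable.of_follows_iff {D D' : LinkDiagram R S.Chord S.BasePoint} {o : Bool}
    {h : Fin n → S.Chord} {s : ℤˣ} (hC : Crossable D o h s) (hs : D'.sign = D.sign)
    (hf : ∀ q q', D'.follows (passAt (!o) (h q)) (passAt (!o) (h q')) ↔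
      D.follows (passAt (!o) (h q)) (passAt (!o) (h q'))) : Crossable D' o h s := by
  refine ⟨hC.injective, hC.ne_box, fun q => by rw [hs, hC.sign_eq], fun q q' hq => ?_, ?_⟩
  · have := hC.adj q q' hq
    unfold LinkDiagram.adj at *
    rw [hf, hf]
    exact this
  · rintro rfl h1 q q' hq
    have := hC.not_follows rfl h1 q q' hq
    rwa [over_eq_passAt, over_eq_passAt, ← Bool.not_false, hf]

theorem realizes_pushAll {H : List (Bool × (Fin n → S.Chord))} (hH : Separated H)
    {D : LinkDiagram R S.Chord S.BasePoint} (hDt : D.label = t)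
    (hs : ∀ ℓ, D.sign (.box ℓ) = 1) (hC : ∀ x ∈ H, ∃ s, Crossable D x.1 x.2 s)
    (hD : ∀ q, D.Along (approach H q ++ S.boxBraid q)) :
    D.Realizes (S.loopMap t) (pushAll H) := by
  induction H generalizing D with
  | nil => trivial
  | cons x H ih =>
    have hx := (List.pairwise_cons.1 hH.pairwise).1
    have hxb := hH.ne_box x (by simp)
    have h₀ := pushState_pushBox (o := x.1) (hH.injective x (by simp)) hxb
    have hfy : ∀ y ∈ H, ∀ o q, LinkDiagram.totalExchange (S.pushBox x.1 x.2)
        (passAt o (y.2 q)) = passAt o (y.2 q) := fun y hy o q =>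
      h₀.fixed _ (not_touched_passAt (hH.ne_box y (by simp [hy]) q)
        (fun q' e => hx y hy q' q e.symm) o)
    have h₂ : ∀ q, approach (x :: H) q ++ S.boxBraid q =
      approach H q ++ (passAt x.1 (x.2 q) :: S.boxBraid q) := by simp [approach]
    have hcons : pushAll (x :: H) = S.pushBox x.1 x.2 ++ pushAll H := rfl
    obtain ⟨s, hCx⟩ := hC x (by simp)
    rw [hcons, LinkDiagram.realizes_append]
    refine ⟨realizes_pushBox t hCx hDt hs fun q => (hD q).mono ?_, ?_⟩
    · rw [h₂]
      exact (List.suffix_append _ _).isInfix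
    · refine ih hH.tail (D := D.conj _) hDt hs (fun y hy => ?_) fun q => ?_
      · obtain ⟨s, hCy⟩ := hC y (by simp [hy])
        refine ⟨s, hCy.of_follows_iff rfl fun q q' => ?_⟩
        have e : ∀ q, (LinkDiagram.totalExchange (S.pushBox x.1 x.2)).symm
            (passAt (!y.1) (y.2 q)) = passAt (!y.1) (y.2 q) := fun q => by
          rw [Equiv.symm_apply_eq, hfy y hy]
        simp only [LinkDiagram.conj, e]
      · have h₁ : (approach H q).map (LinkDiagram.totalExchange (S.pushBox x.1 x.2)) =
            approach H q := by
          conv_rhs => rw [← List.map_id (approach H q)]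
          refine List.map_congr_left fun u hu => ?_
          obtain ⟨y, hy, rfl⟩ := List.mem_map.1 (List.mem_reverse.1 hu)
          exact hfy y hy _ _
        have := (hD q).conj (LinkDiagram.totalExchange (S.pushBox x.1 x.2))
        rw [h₂, List.map_append, h₁, h₀.word] at this
        -- The crossing just passed now lies behind the box and is dropped; what is left is the
        -- approach to the remaining groups.
        exact this.mono ⟨[], [passAt x.1 (x.2 q)], by simp⟩

end SatelliteBraid

namespace SatelliteBraid

variable {m n : ℕ} (S : SatelliteBraid m n) {R : Type*} [CommRing R] (t : S.BasePoint → Rˣ)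

/-! ## The groups of crossings through which the box is pushed -/

/-- The groups of crossings met by the box on its way through `β`. -/
def braidGroups : List (Bool × (Fin n → S.Chord)) :=
  (List.finRange S.β.len).reverse.flatMap fun ℓ =>
    if h : S.IsSat ℓ then
      [(decide (S.satPos ℓ = S.β.upper ℓ), fun q => Chord.sat ⟨ℓ, h⟩ q)] else []

/-- The groups of crossings met by the box on the returning strands. -/
def returningGroups : List (Bool × (Fin n → S.Chord)) :=
  S.strands.reverse.map fun j => (true, fun q => Chord.c (.inr q) j)

/-- The groups of crossings met by the box on the leaving strands. -/
def leavingGroups : List (Bool × (Fin n → S.Chord)) :=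
  S.strands.map fun i => (false, fun q => Chord.c (i.map id S.γ.perm.symm) (.inr q))

theorem pushAll_braidGroups : pushAll S.braidGroups = S.pushThroughBraid := by
  unfold pushAll braidGroups pushThroughBraid
  rw [List.flatMap_assoc]
  congr 1
  funext ℓ
  split_ifs <;> simp

theorem pushAll_returningGroups : pushAll S.returningGroups = S.pushThroughReturning := by
  rw [pushAll, returningGroups, pushThroughReturning, List.flatMap_map]

theorem pushAll_leavingGroups : pushAll S.leavingGroups = S.pushThroughLeaving := by
  rw [pushAll, leavingGroups, pushThroughLeaving, List.flatMap_map]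

theorem mem_braidGroups {x : Bool × (Fin n → S.Chord)} :
    x ∈ S.braidGroups ↔ ∃ ℓ : {ℓ : Fin S.β.len // S.IsSat ℓ},
      x = (decide (S.satPos ℓ = S.β.upper ℓ), fun q => Chord.sat ℓ q) := by
  simp only [braidGroups, List.mem_flatMap, List.mem_reverse, List.mem_finRange, true_and]
  constructor
  · rintro ⟨ℓ, hx⟩
    split_ifs at hx with h
    · exact ⟨⟨ℓ, h⟩, by simpa using hx⟩
    · simp at hx
  · rintro ⟨ℓ, rfl⟩
    exact ⟨ℓ, by simp [ℓ.2]⟩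

theorem mem_block {i : Fin (m + 1)} {x : S.Strand} :
    x ∈ S.block i ↔ Sum.elim Subtype.val (fun _ => S.k) x = i := by
  unfold block
  split_ifs with h
  · rcases x with x | x
    · simp only [List.mem_map, List.mem_finRange, true_and, reduceCtorEq, exists_false,
        Sum.elim_inl, false_iff]
      exact fun e => x.2 (e.trans h)
    · simp [h]
  · rcases x with x | x
    · simp [Subtype.ext_iff]
    · simpa using fun e => h e.symm

theorem mem_strands (x : S.Strand) : x ∈ S.strands := by
  simp [strands, mem_block]

theorem nodup_strands : S.strands.Nodup := by
  unfold strands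
  rw [List.nodup_flatMap]
  refine ⟨fun i _ => ?_, ?_⟩
  · unfold block
    split_ifs
    · exact (List.nodup_finRange n).map Sum.inr_injective
    · simp
  · refine (List.nodup_finRange _).imp fun {a b} hab x hx hx' => hab ?_
    rw [← S.mem_block.1 hx, ← S.mem_block.1 hx']

theorem separated_braidGroups : Separated S.braidGroups := by
  refine ⟨?_, ?_, ?_⟩
  · intro x hx
    obtain ⟨ℓ, rfl⟩ := S.mem_braidGroups.1 hx
    exact fun q q' e => by simpa using e
  · intro x hx
    obtain ⟨ℓ, rfl⟩ := S.mem_braidGroups.1 hx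
    simp
  · unfold braidGroups
    rw [List.pairwise_flatMap]
    refine ⟨fun ℓ _ => by split_ifs <;> simp, ?_⟩
    refine List.Pairwise.imp (R := (· ≠ ·)) ?_ (List.nodup_reverse.2 (List.nodup_finRange _))
    intro a b hab x hx y hy q q'
    split_ifs at hx hy <;> simp_all

theorem separated_returningGroups : Separated S.returningGroups := by
  refine ⟨?_, ?_, ?_⟩
  · intro x hx
    obtain ⟨j, -, rfl⟩ := List.mem_map.1 hx
    exact fun q q' e => by simpa using e
  · intro x hx
    obtain ⟨j, -, rfl⟩ := List.mem_map.1 hx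
    simp
  · unfold returningGroups
    rw [List.pairwise_map]
    exact (List.nodup_reverse.2 S.nodup_strands).imp fun hab => by simp [hab]

theorem map_perm_injective (e : Equiv.Perm (Fin n)) :
    Function.Injective (Sum.map id e : S.Strand → S.Strand) :=
  Sum.map_injective.2 ⟨Function.injective_id, e.injective⟩

theorem separated_leavingGroups : Separated S.leavingGroups := by
  refine ⟨?_, ?_, ?_⟩
  · intro x hx
    obtain ⟨j, -, rfl⟩ := List.mem_map.1 hx
    exact fun q q' e => by simpa using e
  · intro x hx
    obtain ⟨j, -, rfl⟩ := List.mem_map.1 hx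
    simp
  · unfold leavingGroups
    rw [List.pairwise_map]
    exact S.nodup_strands.imp fun hab q q' e =>
      hab (S.map_perm_injective _ (Chord.c.inj e).1)

/-! ## The words of the diagram -/

/-- A strand in a position different from `satPos ℓ` is the other strand at a satellite crossing. It
passes over where the satellites pass under and conversely, so the clause on opposite passages in
`totalExchange_pushAll` applies to it. -/
theorem mem_outerCrossing {ℓ : Fin S.β.len} {p : Fin (m + 1)} (hp : p ≠ S.satPos ℓ) {u : S.Pass}
    (hu : u ∈ S.outerCrossing ℓ p) :
    (∃ o h, u = passAt o (.outer ⟨ℓ, h⟩)) ∨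
      ∃ h q, u = passAt (!decide (S.satPos ℓ = S.β.upper ℓ)) (.sat ⟨ℓ, h⟩ q) := by
  unfold outerCrossing at hu
  split_ifs at hu with h₁ h₂ h₂ h₂
  · obtain ⟨q, -, rfl⟩ := List.mem_map.1 hu
    refine Or.inr ⟨h₂, q, ?_⟩
    have : S.satPos ℓ = S.β.upper ℓ := h₂.resolve_left fun e => hp (h₁.trans e.symm)
    simp [this, passAt]
  · exact Or.inl ⟨false, h₂, List.mem_singleton.1 hu⟩
  · rename_i h₃
    obtain ⟨q, -, rfl⟩ := List.mem_map.1 hu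
    refine Or.inr ⟨h₂, q, ?_⟩
    have : S.satPos ℓ ≠ S.β.upper ℓ := fun e => hp (h₃.trans e.symm)
    simp [this, passAt]
  · exact Or.inl ⟨true, h₂, List.mem_singleton.1 hu⟩
  · simp at hu

theorem track_ne_satPos {i : Fin (m + 1)} (hi : i ≠ S.k) (ℓ : Fin S.β.len) :
    S.β.track ℓ i ≠ S.satPos ℓ := fun e => hi (Equiv.injective _ e)

theorem mem_outerBraid {i : {i : Fin (m + 1) // i ≠ S.k}} {u : S.Pass}
    (hu : u ∈ S.outerBraid i) :
    (∃ ℓ p, u = .pt (.outer ℓ p)) ∨ (∃ o ℓ, u = passAt o (.outer ℓ)) ∨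
      ∃ ℓ q, u = passAt (!decide (S.satPos ℓ.1 = S.β.upper ℓ.1)) (.sat ℓ q) := by
  rcases List.mem_append.1 hu with hu | hu
  · obtain ⟨ℓ, -, hu⟩ := List.mem_flatMap.1 hu
    rcases List.mem_cons.1 hu with rfl | hu
    · exact Or.inl ⟨_, _, rfl⟩
    · rcases S.mem_outerCrossing (S.track_ne_satPos i.2 ℓ) hu with ⟨o, h, rfl⟩ | ⟨h, q, rfl⟩
      · exact Or.inr (Or.inl ⟨_, _, rfl⟩)
      · exact Or.inr (Or.inr ⟨⟨ℓ, h⟩, q, rfl⟩)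
  · rw [List.mem_singleton.1 hu]
    exact Or.inl ⟨_, _, rfl⟩

theorem satBraid_eq (q : Fin n) : S.satBraid q = approach S.braidGroups q := by
  unfold approach braidGroups satBraid
  rw [List.map_flatMap, List.reverse_flatMap, List.reverse_reverse]
  congr 1
  funext ℓ
  simp only [Function.comp_apply]
  split_ifs with h₁ h₂
  · have : S.satPos ℓ ≠ S.β.upper ℓ := fun e => S.β.lower_ne_upper ℓ (h₂.symm.trans e)
    simp [this, passAt]
  · simp [h₁.resolve_left h₂, passAt]
  · simp

theorem mem_satBraid {p : Fin n} {u : S.Pass} (hu : u ∈ S.satBraid p) :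
    ∃ ℓ : {ℓ : Fin S.β.len // S.IsSat ℓ},
      u = passAt (decide (S.satPos ℓ.1 = S.β.upper ℓ.1)) (.sat ℓ p) := by
  rw [satBraid_eq, approach, List.mem_reverse] at hu
  obtain ⟨x, hx, rfl⟩ := List.mem_map.1 hu
  obtain ⟨ℓ, rfl⟩ := S.mem_braidGroups.1 hx
  exact ⟨ℓ, rfl⟩

theorem mem_leavingPass {x : S.Strand} {u : S.Pass} (hu : u ∈ S.leavingPass x) :
    (∃ j i, u = .pt (.leaving j i)) ∨ ∃ l, u = passAt false (.c l x) := by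
  obtain ⟨i, -, hu⟩ := List.mem_flatMap.1 hu
  rcases List.mem_append.1 hu with hu | hu
  · rcases x with x | x
    · exact Or.inl ⟨x, i, by simpa using hu⟩
    · simp at hu
  · obtain ⟨l, -, rfl⟩ := List.mem_map.1 hu
    exact Or.inr ⟨l, rfl⟩

theorem mem_returningPass {x : S.Strand} {u : S.Pass} (hu : u ∈ S.returningPass x) :
    (∃ j i, u = .pt (.returning j i)) ∨ ∃ l, u = passAt true (.c x l) := by
  obtain ⟨i, -, hu⟩ := List.mem_flatMap.1 hu
  rcases List.mem_append.1 hu with hu | hu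
  · rcases x with x | x
    · exact Or.inl ⟨x, i, by simpa using hu⟩
    · simp at hu
  · obtain ⟨l, -, rfl⟩ := List.mem_map.1 hu
    exact Or.inr ⟨l, rfl⟩

theorem returningPass_inr (q : Fin n) :
    S.returningPass (.inr q) = approach S.returningGroups q := by
  simp [returningPass, approach, returningGroups, strands, List.map_flatMap, passAt,
    Function.comp_def]

theorem leavingPass_inr (q : Fin n) :
    S.leavingPass (.inr q) = S.strands.reverse.map fun l => .under (.c l (.inr q)) := by
  simp [leavingPass, strands, List.map_flatMap, List.reverse_flatMap, Function.comp_def]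

end SatelliteBraid

namespace SatelliteBraid

variable {m n : ℕ} (S : SatelliteBraid m n) {R : Type*} [CommRing R] (t : S.BasePoint → Rˣ)

/-! ## The diagram along the purple-box loop -/

theorem rename_passAt (f : S.Chord → S.Chord) (o : Bool) (x : S.Chord) :
    (passAt o x : S.Pass).rename f = passAt o (f x) := by
  cases o <;> rfl

/-- The rows of the chords `c_{ij}` are permuted. -/
def rowPlace (e : Equiv.Perm (Fin n)) : S.Chord → S.Chord
  | .c i j => .c (i.map id e) j
  | .box ℓ => .box ℓ
  | .outer ℓ => .outer ℓ
  | .sat ℓ q => .sat ℓ q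

/-- The columns of the chords `c_{ij}` are permuted. -/
def columnPlace (e : Equiv.Perm (Fin n)) : S.Chord → S.Chord
  | .c i j => .c i (j.map id e)
  | .box ℓ => .box ℓ
  | .outer ℓ => .outer ℓ
  | .sat ℓ q => .sat ℓ q

/-- The word of the strand `i` inside `β` after the box has been pushed through `β`. -/
def outerBraid' (i : {i : Fin (m + 1) // i ≠ S.k}) : List S.Pass :=
  (S.outerBraid i).map (Passage.rename (S.place S.γ.perm.symm))

/-- The first passage through the square grid after the box has been pushed along the returning
strands. -/
def leavingPass' (x : S.Strand) : List S.Pass :=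
  (S.leavingPass x).map (Passage.rename (S.rowPlace S.γ.perm.symm))

/-- The second passage through the square grid after the box has been pushed along the leaving
strands. -/
def returningPass' (x : S.Strand) : List S.Pass :=
  (S.returningPass x).map (Passage.rename (S.columnPlace S.γ.perm.symm))

theorem mem_outerBraid' {i : {i : Fin (m + 1) // i ≠ S.k}} {u : S.Pass}
    (hu : u ∈ S.outerBraid' i) :
    (∃ ℓ p, u = .pt (.outer ℓ p)) ∨ (∃ o ℓ, u = passAt o (.outer ℓ)) ∨
      ∃ o ℓ q, u = passAt o (.sat ℓ q) := by
  obtain ⟨v, hv, rfl⟩ := List.mem_map.1 hu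
  rcases S.mem_outerBraid hv with ⟨ℓ, p, rfl⟩ | ⟨o, ℓ, rfl⟩ | ⟨ℓ, q, rfl⟩
  · exact Or.inl ⟨_, _, rfl⟩
  · exact Or.inr (Or.inl ⟨o, ℓ, S.rename_passAt _ _ _⟩)
  · exact Or.inr (Or.inr ⟨_, ℓ, _, S.rename_passAt _ _ _⟩)

theorem mem_leavingPass' {x : S.Strand} {u : S.Pass} (hu : u ∈ S.leavingPass' x) :
    (∃ j i, u = .pt (.leaving j i)) ∨ ∃ l, u = passAt false (.c l x) := by
  obtain ⟨v, hv, rfl⟩ := List.mem_map.1 hu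
  rcases S.mem_leavingPass hv with ⟨j, i, rfl⟩ | ⟨l, rfl⟩
  · exact Or.inl ⟨_, _, rfl⟩
  · exact Or.inr ⟨_, S.rename_passAt _ _ _⟩

/-- This explains the inverse permutation in `leavingGroups`: the previous stage permuted the rows,
and the groups have to be listed as they are met now. -/
theorem leavingPass'_inr (q : Fin n) :
    S.leavingPass' (.inr q) = approach S.leavingGroups q := by
  simp [leavingPass', leavingPass_inr, approach, leavingGroups, passAt, Function.comp_def,
    Passage.rename, rowPlace]

theorem map_eq_self_of_forall {α : Type*} {f : α → α} {l : List α} (h : ∀ u ∈ l, f u = u) :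
    l.map f = l := by
  conv_rhs => rw [← List.map_id l]
  exact List.map_congr_left h

theorem not_isBoxPass_passAt {o : Bool} {x : S.Chord} (hx : ∀ ℓ, x ≠ .box ℓ) :
    ¬ IsBoxPass (passAt o x) := fun h => h.ne_passAt hx o rfl

/-- The exchange of passages while the box is pushed through `β`. -/
noncomputable def braidExchange : Equiv.Perm S.Pass :=
  LinkDiagram.totalExchange S.pushThroughBraid

/-- The exchange of passages while the box is pushed along the returning strands. -/
noncomputable def returningExchange : Equiv.Perm S.Pass :=
  LinkDiagram.totalExchange S.pushThroughReturning

/-- The exchange of passages while the box is pushed along the leaving strands. -/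
noncomputable def leavingExchange : Equiv.Perm S.Pass :=
  LinkDiagram.totalExchange S.pushThroughLeaving

theorem braidExchange_apply_c (o : Bool) (i j : S.Strand) :
    S.braidExchange (passAt o (.c i j)) = passAt o (.c i j) := by
  rw [braidExchange, ← pushAll_braidGroups]
  refine (totalExchange_pushAll S.separated_braidGroups).2.2 _
    (S.not_isBoxPass_passAt (by simp)) ?_
  intro x hx o q
  obtain ⟨ℓ, rfl⟩ := S.mem_braidGroups.1 hx
  simp [passAt_inj]

theorem braidExchange_apply_outer (o : Bool) (ℓ) :
    S.braidExchange (passAt o (.outer ℓ)) = passAt o (.outer ℓ) := by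
  rw [braidExchange, ← pushAll_braidGroups]
  refine (totalExchange_pushAll S.separated_braidGroups).2.2 _
    (S.not_isBoxPass_passAt (by simp)) ?_
  intro x hx o q
  obtain ⟨ℓ, rfl⟩ := S.mem_braidGroups.1 hx
  simp [passAt_inj]

theorem braidExchange_apply_pt (b : S.BasePoint) (hb : ∀ ℓ q, b ≠ .box ℓ q) :
    S.braidExchange (.pt b) = .pt b := by
  rw [braidExchange, ← pushAll_braidGroups]
  refine (totalExchange_pushAll S.separated_braidGroups).2.2 _ ?_ fun _ _ _ _ => passAt_ne_pt.symm
  rintro ⟨ℓ, q, e⟩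
  exact hb ℓ q e

theorem braidExchange_apply_sat (ℓ : {ℓ : Fin S.β.len // S.IsSat ℓ}) (q : Fin n) :
    S.braidExchange (passAt (!decide (S.satPos ℓ.1 = S.β.upper ℓ.1)) (.sat ℓ q)) =
      passAt (!decide (S.satPos ℓ.1 = S.β.upper ℓ.1)) (.sat ℓ (S.γ.perm.symm q)) := by
  rw [braidExchange, ← pushAll_braidGroups]
  exact (totalExchange_pushAll S.separated_braidGroups).2.1 _ (S.mem_braidGroups.2 ⟨ℓ, rfl⟩) q

theorem returningExchange_apply_pt (b : S.BasePoint) (hb : ∀ ℓ q, b ≠ .box ℓ q) :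
    S.returningExchange (.pt b) = .pt b := by
  rw [returningExchange, ← pushAll_returningGroups]
  refine (totalExchange_pushAll S.separated_returningGroups).2.2 _ ?_
    fun _ _ _ _ => passAt_ne_pt.symm
  rintro ⟨ℓ, q, e⟩
  exact hb ℓ q e

theorem leavingExchange_apply_pt (b : S.BasePoint) (hb : ∀ ℓ q, b ≠ .box ℓ q) :
    S.leavingExchange (.pt b) = .pt b := by
  rw [leavingExchange, ← pushAll_leavingGroups]
  refine (totalExchange_pushAll S.separated_leavingGroups).2.2 _ ?_
    fun _ _ _ _ => passAt_ne_pt.symm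
  rintro ⟨ℓ, q, e⟩
  exact hb ℓ q e

theorem returningExchange_apply_passAt (o : Bool) (x : S.Chord) (hx : ∀ ℓ, x ≠ .box ℓ)
    (hx' : ∀ q j, x ≠ .c (.inr q) j) : S.returningExchange (passAt o x) = passAt o x := by
  rw [returningExchange, ← pushAll_returningGroups]
  refine (totalExchange_pushAll S.separated_returningGroups).2.2 _
    (S.not_isBoxPass_passAt hx) ?_
  intro y hy o q e
  obtain ⟨j, -, rfl⟩ := List.mem_map.1 hy
  exact hx' q j (passAt_inj.1 e).2

theorem leavingExchange_apply_passAt (o : Bool) (x : S.Chord) (hx : ∀ ℓ, x ≠ .box ℓ)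
    (hx' : ∀ q i, x ≠ .c i (.inr q)) : S.leavingExchange (passAt o x) = passAt o x := by
  rw [leavingExchange, ← pushAll_leavingGroups]
  refine (totalExchange_pushAll S.separated_leavingGroups).2.2 _
    (S.not_isBoxPass_passAt hx) ?_
  intro y hy o q e
  obtain ⟨j, -, rfl⟩ := List.mem_map.1 hy
  exact hx' q _ (passAt_inj.1 e).2

theorem returningExchange_apply_under (i j : S.Strand) :
    S.returningExchange (passAt false (.c i j)) =
      passAt false (.c (i.map id S.γ.perm.symm) j) := by
  rcases i with i | i
  · exact S.returningExchange_apply_passAt _ _ (by simp) (by simp)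
  · rw [returningExchange, ← pushAll_returningGroups]
    exact (totalExchange_pushAll S.separated_returningGroups).2.1 _
      (List.mem_map.2 ⟨j, List.mem_reverse.2 (S.mem_strands j), rfl⟩) i

theorem leavingExchange_apply_over (i j : S.Strand) :
    S.leavingExchange (passAt true (.c i j)) =
      passAt true (.c i (j.map id S.γ.perm.symm)) := by
  rcases j with j | j
  · exact S.leavingExchange_apply_passAt _ _ (by simp) (by simp)
  · rw [leavingExchange, ← pushAll_leavingGroups]
    -- The chords with row `i` form the group listed at the strand `i.map id γ.perm`, since the
    -- inverse permutation is applied to the rows.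
    have := (totalExchange_pushAll S.separated_leavingGroups).2.1 _
      (List.mem_map.2 ⟨i.map id S.γ.perm, S.mem_strands _, rfl⟩) j
    simpa using this

theorem map_braidExchange_outerBraid (i) :
    (S.outerBraid i).map S.braidExchange = S.outerBraid' i := by
  refine List.map_congr_left fun u hu => ?_
  rcases S.mem_outerBraid hu with ⟨ℓ, p, rfl⟩ | ⟨o, ℓ, rfl⟩ | ⟨ℓ, q, rfl⟩
  · exact S.braidExchange_apply_pt _ (by simp)
  · rw [braidExchange_apply_outer, rename_passAt]
    rfl
  · rw [braidExchange_apply_sat, rename_passAt]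
    rfl

theorem map_braidExchange_leavingPass (x) :
    (S.leavingPass x).map S.braidExchange = S.leavingPass x := by
  refine map_eq_self_of_forall fun u hu => ?_
  rcases S.mem_leavingPass hu with ⟨j, i, rfl⟩ | ⟨l, rfl⟩
  · exact S.braidExchange_apply_pt _ (by simp)
  · exact S.braidExchange_apply_c _ _ _

theorem map_braidExchange_returningPass (x) :
    (S.returningPass x).map S.braidExchange = S.returningPass x := by
  refine map_eq_self_of_forall fun u hu => ?_
  rcases S.mem_returningPass hu with ⟨j, i, rfl⟩ | ⟨l, rfl⟩
  · exact S.braidExchange_apply_pt _ (by simp)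
  · exact S.braidExchange_apply_c _ _ _

theorem map_braidExchange_satBraid (q) :
    (S.satBraid q ++ S.boxBraid q).map S.braidExchange = S.boxBraid q ++ S.satBraid q := by
  rw [braidExchange, ← pushAll_braidGroups, satBraid_eq]
  exact (totalExchange_pushAll S.separated_braidGroups).1 q

theorem map_returningExchange_outerBraid' (i) :
    (S.outerBraid' i).map S.returningExchange = S.outerBraid' i := by
  refine map_eq_self_of_forall fun u hu => ?_
  rcases S.mem_outerBraid' hu with ⟨ℓ, p, rfl⟩ | ⟨o, ℓ, rfl⟩ | ⟨o, ℓ, q, rfl⟩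
  · exact S.returningExchange_apply_pt _ (by simp)
  · exact S.returningExchange_apply_passAt _ _ (by simp) (by simp)
  · exact S.returningExchange_apply_passAt _ _ (by simp) (by simp)

theorem map_returningExchange_satBraid (q) :
    (S.satBraid q).map S.returningExchange = S.satBraid q := by
  refine map_eq_self_of_forall fun u hu => ?_
  obtain ⟨ℓ, rfl⟩ := S.mem_satBraid hu
  exact S.returningExchange_apply_passAt _ _ (by simp) (by simp)

theorem map_returningExchange_leavingPass (x) :
    (S.leavingPass x).map S.returningExchange = S.leavingPass' x := by
  refine List.map_congr_left fun u hu => ?_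
  rcases S.mem_leavingPass hu with ⟨j, i, rfl⟩ | ⟨l, rfl⟩
  · exact S.returningExchange_apply_pt _ (by simp)
  · rw [returningExchange_apply_under, rename_passAt]
    rfl

theorem map_returningExchange_returningPass_inl (x) :
    (S.returningPass (.inl x)).map S.returningExchange = S.returningPass (.inl x) := by
  refine map_eq_self_of_forall fun u hu => ?_
  rcases S.mem_returningPass hu with ⟨j, i, rfl⟩ | ⟨l, rfl⟩
  · exact S.returningExchange_apply_pt _ (by simp)
  · exact S.returningExchange_apply_passAt _ _ (by simp) (by simp)

theorem map_returningExchange_returningPass_inr (q) :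
    (S.returningPass (.inr q) ++ S.boxBraid q).map S.returningExchange =
      S.boxBraid q ++ S.returningPass (.inr q) := by
  rw [returningExchange, ← pushAll_returningGroups, returningPass_inr]
  exact (totalExchange_pushAll S.separated_returningGroups).1 q

theorem map_leavingExchange_outerBraid' (i) :
    (S.outerBraid' i).map S.leavingExchange = S.outerBraid' i := by
  refine map_eq_self_of_forall fun u hu => ?_
  rcases S.mem_outerBraid' hu with ⟨ℓ, p, rfl⟩ | ⟨o, ℓ, rfl⟩ | ⟨o, ℓ, q, rfl⟩
  · exact S.leavingExchange_apply_pt _ (by simp)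
  · exact S.leavingExchange_apply_passAt _ _ (by simp) (by simp)
  · exact S.leavingExchange_apply_passAt _ _ (by simp) (by simp)

theorem map_leavingExchange_satBraid (q) :
    (S.satBraid q).map S.leavingExchange = S.satBraid q := by
  refine map_eq_self_of_forall fun u hu => ?_
  obtain ⟨ℓ, rfl⟩ := S.mem_satBraid hu
  exact S.leavingExchange_apply_passAt _ _ (by simp) (by simp)

theorem map_leavingExchange_leavingPass'_inl (x) :
    (S.leavingPass' (.inl x)).map S.leavingExchange = S.leavingPass' (.inl x) := by
  refine map_eq_self_of_forall fun u hu => ?_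
  rcases S.mem_leavingPass' hu with ⟨j, i, rfl⟩ | ⟨l, rfl⟩
  · exact S.leavingExchange_apply_pt _ (by simp)
  · exact S.leavingExchange_apply_passAt _ _ (by simp) (by simp)

theorem map_leavingExchange_leavingPass'_inr (q) :
    (S.leavingPass' (.inr q) ++ S.boxBraid q).map S.leavingExchange =
      S.boxBraid q ++ S.leavingPass' (.inr q) := by
  rw [leavingExchange, ← pushAll_leavingGroups, leavingPass'_inr]
  exact (totalExchange_pushAll S.separated_leavingGroups).1 q

theorem map_leavingExchange_returningPass (x) :
    (S.returningPass x).map S.leavingExchange = S.returningPass' x := by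
  refine List.map_congr_left fun u hu => ?_
  rcases S.mem_returningPass hu with ⟨j, i, rfl⟩ | ⟨l, rfl⟩
  · exact S.leavingExchange_apply_pt _ (by simp)
  · rw [leavingExchange_apply_over, rename_passAt]
    rfl

theorem exit_injective : Function.Injective S.exit := by
  rintro (i | i) (j | j) h
  · simpa [exit, Subtype.ext_iff] using h
  · simp [exit] at h
  · simp [exit] at h
  · simpa [exit] using h

/-- The permutation of the strands in one turn around the figure-eight unknot. -/
noncomputable def exitPerm : Equiv.Perm S.Strand :=
  Equiv.ofBijective S.exit (Finite.injective_iff_bijective.1 S.exit_injective)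

theorem exitPerm_apply (i : S.Strand) : S.exitPerm i = S.exit i := rfl

theorem outerBraid'_ne_nil (i) : S.outerBraid' i ≠ [] := by
  simp [outerBraid', outerBraid]

theorem boxBraid_ne_nil (q) : S.boxBraid q ≠ [] := by
  simp [boxBraid]

theorem isTraversal_diagram : (S.diagram t).IsTraversal S.strandWord S.exitPerm := fun _ _ =>
  Iff.rfl

/-- The words of the diagram after the box has been pushed through `β`. -/
def wordAfterBraid (i : S.Strand) : List S.Pass :=
  match i with
  | .inl i => S.outerBraid' i ++ S.leavingPass (S.exit (.inl i)) ++ S.returningPass (S.exit (.inl i))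
  | .inr q => S.satBraid q ++ S.leavingPass (S.exit (.inr q)) ++
      (S.returningPass (S.exit (.inr q)) ++ S.boxBraid (S.γ.perm q))

/-- The words of the diagram after the box has been pushed along the returning strands. -/
def wordAfterReturning (i : S.Strand) : List S.Pass :=
  match i with
  | .inl i => S.outerBraid' i ++ S.leavingPass' (S.exit (.inl i)) ++
      S.returningPass (S.exit (.inl i))
  | .inr q => S.satBraid q ++ (S.leavingPass' (S.exit (.inr q)) ++ S.boxBraid (S.γ.perm q)) ++
      S.returningPass (S.exit (.inr q))

/-- The words of the diagram after the purple-box loop. -/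
def wordAfterLoop (i : S.Strand) : List S.Pass :=
  match i with
  | .inl i => S.outerBraid' i ++ S.leavingPass' (S.exit (.inl i)) ++
      S.returningPass' (S.exit (.inl i))
  | .inr q => S.satBraid q ++ (S.boxBraid (S.γ.perm q) ++ S.leavingPass' (S.exit (.inr q))) ++
      S.returningPass' (S.exit (.inr q))

/-- The exchange leaves the box at the beginning of each satellite word. Rotating the words moves
the box of strand `γ.perm q` to the end of the word of strand `q`, that is, onto the returning
strands. -/
theorem isTraversal_afterBraid :
    ((S.diagram t).conj S.braidExchange).IsTraversal S.wordAfterBraid S.exitPerm := by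
  set V : S.Strand → List S.Pass := fun i => match i with
    | .inl _ => []
    | .inr q => S.boxBraid q with hV
  set W : S.Strand → List S.Pass := fun i => match i with
    | .inl i => S.outerBraid' i ++ S.leavingPass (S.exit (.inl i)) ++
        S.returningPass (S.exit (.inl i))
    | .inr q => S.satBraid q ++ S.leavingPass (S.exit (.inr q)) ++
        S.returningPass (S.exit (.inr q)) with hW
  have h₁ : (fun i => (S.strandWord i).map S.braidExchange) = fun i => V i ++ W i := by
    funext i
    rcases i with i | q
    · simp [hV, hW, strandWord, map_braidExchange_outerBraid, map_braidExchange_leavingPass,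
        map_braidExchange_returningPass]
    · rw [strandWord, List.map_append, List.map_append, map_braidExchange_satBraid,
        map_braidExchange_leavingPass, map_braidExchange_returningPass]
      simp [hV, hW]
  have h₂ : (fun i => W i ++ V (S.exitPerm i)) = S.wordAfterBraid := by
    funext i
    rcases i with i | q
    · simp [hV, hW, wordAfterBraid, exitPerm_apply, exit]
    · simp [hV, hW, wordAfterBraid, exitPerm_apply, exit]
  rw [← h₂]
  refine LinkDiagram.IsTraversal.rotate ?_ ?_ ?_
  · rw [← h₁]
    exact (S.isTraversal_diagram t).conj _
  · rintro (i | q)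
    · simp [hV, hW, S.outerBraid'_ne_nil]
    · simp [hV, S.boxBraid_ne_nil]
  · rintro (i | q)
    · simp [hW, S.outerBraid'_ne_nil]
    · simp [hV, exitPerm_apply, exit, S.boxBraid_ne_nil]

theorem isTraversal_afterReturning :
    (((S.diagram t).conj S.braidExchange).conj S.returningExchange).IsTraversal
      S.wordAfterReturning S.exitPerm := by
  have := (S.isTraversal_afterBraid t).conj S.returningExchange
  convert this using 2 with i
  rcases i with i | q
  · simp only [wordAfterReturning, wordAfterBraid, List.map_append,
      map_returningExchange_outerBraid', map_returningExchange_leavingPass]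
    rw [exit, map_returningExchange_returningPass_inl]
  · rw [wordAfterBraid, List.map_append, exit, map_returningExchange_returningPass_inr,
      List.map_append, map_returningExchange_satBraid, map_returningExchange_leavingPass]
    simp [wordAfterReturning, exit]

theorem isTraversal_afterLoop :
    ((((S.diagram t).conj S.braidExchange).conj S.returningExchange).conj
      S.leavingExchange).IsTraversal S.wordAfterLoop S.exitPerm := by
  have := (S.isTraversal_afterReturning t).conj S.leavingExchange
  convert this using 2 with i
  rcases i with i | q
  · simp only [wordAfterReturning, wordAfterLoop, List.map_append,
      map_leavingExchange_outerBraid', map_leavingExchange_returningPass]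
    rw [exit, map_leavingExchange_leavingPass'_inl]
  · rw [wordAfterReturning, List.map_append, List.map_append, exit,
      map_leavingExchange_leavingPass'_inr, map_leavingExchange_satBraid,
      map_leavingExchange_returningPass]
    simp [wordAfterLoop, exit]

/-! ## The final diagram -/

theorem map_rename_leavingPass (x : S.Strand) :
    (S.leavingPass' x).map (Passage.rename S.identification) =
      S.leavingPass (x.map id S.γ.perm) := by
  have e : ∀ l, S.identification (S.rowPlace S.γ.perm.symm (.c l x)) =
      .c l (x.map id S.γ.perm) := by
    intro l
    simp [identification, rowPlace, place]
  unfold leavingPass' leavingPass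
  rw [List.map_map, List.map_flatMap]
  congr 1
  funext i
  rcases x with x | x
  · simp [Passage.rename, e]
  · simp [Passage.rename, e]

theorem map_rename_returningPass (x : S.Strand) :
    (S.returningPass' x).map (Passage.rename S.identification) =
      S.returningPass (x.map id S.γ.perm) := by
  have e : ∀ l, S.identification (S.columnPlace S.γ.perm.symm (.c x l)) =
      .c (x.map id S.γ.perm) l := by
    intro l
    simp [identification, columnPlace, place]
  unfold returningPass' returningPass
  rw [List.map_map, List.map_flatMap]
  congr 1
  funext i
  rcases x with x | x
  · simp [Passage.rename, e]
  · simp [Passage.rename, e]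

theorem map_rename_outerBraid (i) :
    (S.outerBraid' i).map (Passage.rename S.identification) = S.outerBraid i := by
  unfold outerBraid'
  rw [List.map_map]
  refine map_eq_self_of_forall fun u _ => ?_
  rcases u with x | x | b
  · exact congrArg Passage.over (S.identification.apply_symm_apply x)
  · exact congrArg Passage.under (S.identification.apply_symm_apply x)
  · rfl

theorem map_rename_boxBraid (q) :
    (S.boxBraid q).map (Passage.rename S.identification) = S.boxBraid q := by
  refine map_eq_self_of_forall fun u hu => ?_
  have := isBoxPass_of_mem_boxBraid hu
  rcases u with x | x | b
  · obtain ⟨ℓ, rfl⟩ := this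
    rfl
  · obtain ⟨ℓ, rfl⟩ := this
    rfl
  · rfl

theorem map_rename_satBraid (q) :
    (S.satBraid q).map (Passage.rename S.identification) = S.satBraid (S.γ.perm q) := by
  unfold satBraid
  rw [List.map_flatMap]
  congr 1
  funext ℓ
  split_ifs <;> rfl

/-- The box is back at the right end of `β`, but the strand that first entered it in position `q`
now enters it in position `γ.perm q`. Its word is thus the initial word of the strand `γ.perm q`. -/
theorem map_rename_wordAfterLoop (i : S.Strand) :
    (S.wordAfterLoop i).map (Passage.rename S.identification) =
      S.strandWord (i.map id S.γ.perm) := by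
  rcases i with i | q
  · simp only [wordAfterLoop, List.map_append, map_rename_outerBraid, map_rename_leavingPass,
      map_rename_returningPass]
    rfl
  · simp only [wordAfterLoop, List.map_append, map_rename_satBraid, map_rename_leavingPass,
      map_rename_returningPass, map_rename_boxBraid, ← List.append_assoc]
    rfl

theorem exit_map_perm (i : S.Strand) :
    S.exit (i.map id S.γ.perm) = (S.exit i).map id S.γ.perm := by
  rcases i with i | q <;> rfl

theorem degree_place (e : Equiv.Perm (Fin n)) (x : S.Chord) : (S.place e x).degree = x.degree := by
  rcases x with _ | _ | _ | _ <;> rfl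

/-- Renaming the crossings, as a permutation of the passages. -/
def renameEquiv (e : Equiv.Perm S.Chord) : Equiv.Perm S.Pass where
  toFun := Passage.rename e
  invFun := Passage.rename e.symm
  left_inv u := by rcases u <;> simp [Passage.rename]
  right_inv u := by rcases u <;> simp [Passage.rename]

theorem run_purpleLoop : (S.diagram t).run S.purpleLoop =
    (((S.diagram t).conj S.braidExchange).conj S.returningExchange).conj S.leavingExchange := by
  rw [LinkDiagram.run_eq_conj, LinkDiagram.conj_conj, LinkDiagram.conj_conj, purpleLoop,
    LinkDiagram.totalExchange_append, LinkDiagram.totalExchange_append]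
  rfl

/-- The shift of strands by `γ.perm` commutes with `exit`, so consecutive words remain consecutive
and the set of adjacent pairs is the initial one. -/
theorem relabel_run_purpleLoop :
    ((S.diagram t).run S.purpleLoop).relabel S.identification = S.diagram t := by
  rw [run_purpleLoop]
  have h := (S.isTraversal_afterLoop t).conj (S.renameEquiv S.identification)
  have hW : (fun i => (S.wordAfterLoop i).map (S.renameEquiv S.identification)) =
      fun i => S.strandWord (i.map id S.γ.perm) := funext S.map_rename_wordAfterLoop
  rw [hW] at h
  refine LinkDiagram.ext ?_ ?_ rfl
  · funext u v
    refine propext ((h u v).trans ?_)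
    constructor
    · rintro ⟨i, hi⟩
      refine ⟨i.map id S.γ.perm, ?_⟩
      rwa [exit_map_perm]
    · rintro ⟨i, hi⟩
      refine ⟨i.map id S.γ.perm.symm, ?_⟩
      beta_reduce
      rw [exitPerm_apply, ← exit_map_perm]
      simpa using hi
  · funext x
    exact congrArg (fun k => (-1 : ℤˣ) ^ k) (S.degree_place _ x)

end SatelliteBraid

namespace SatelliteBraid

variable {m n : ℕ} (S : SatelliteBraid m n) {R : Type*} [CommRing R] (t : S.BasePoint → Rˣ)

/-! ## Legality of the purple-box loop -/

theorem pair_infix_finRange {q q' : Fin n} (h : (q : ℕ) + 1 = q') :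
    [q, q'] <:+: List.finRange n := by
  refine ⟨(List.finRange n).take q, (List.finRange n).drop (q + 2), ?_⟩
  have h₁ : (List.finRange n).drop q = q :: q' :: (List.finRange n).drop (q + 2) := by
    rw [List.drop_eq_getElem_cons (by simp), List.drop_eq_getElem_cons (by simp [h])]
    simp [h]
    omega
  rw [List.append_assoc, List.cons_append, List.cons_append, List.nil_append, ← h₁,
    List.take_append_drop]

theorem pair_infix_reverse_finRange {q q' : Fin n} (h : (q : ℕ) + 1 = q') :
    [q', q] <:+: (List.finRange n).reverse := by
  have := List.reverse_infix.2 (pair_infix_finRange h)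
  simpa using this

theorem infix_flatMap {α β : Type*} {l : List α} {a : α} (ha : a ∈ l) (f : α → List β) :
    f a <:+: l.flatMap f := by
  obtain ⟨l₁, l₂, rfl⟩ := List.append_of_mem ha
  exact ⟨l₁.flatMap f, l₂.flatMap f, by simp⟩

theorem outerCrossing_infix (i : {i : Fin (m + 1) // i ≠ S.k}) (ℓ : Fin S.β.len) :
    S.outerCrossing ℓ (S.β.track ℓ i) <:+: S.strandWord (.inl i) := by
  have h₁ : S.outerCrossing ℓ (S.β.track ℓ i) <:+: S.outerBraid i := by
    have := infix_flatMap (List.mem_finRange ℓ) (fun ℓ : Fin S.β.len =>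
      (.pt (.outer ℓ.castSucc (S.β.track ℓ i)) : S.Pass) :: S.outerCrossing ℓ (S.β.track ℓ i))
    exact ((List.suffix_cons _ _).isInfix.trans this).trans (List.prefix_append _ _).isInfix
  refine h₁.trans ⟨[], S.leavingPass (S.exit (.inl i)) ++ S.returningPass (S.exit (.inl i)), ?_⟩
  simp [strandWord]

theorem leavingPass_pair {q q' : Fin n} (h : (q : ℕ) + 1 = q') (x : S.Strand) :
    [.under (.c (.inr q') x), .under (.c (.inr q) x)] <:+: S.leavingPass x := by
  refine List.IsInfix.trans ?_ (infix_flatMap (List.mem_reverse.2 (List.mem_finRange S.k)) _)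
  refine List.IsInfix.trans ?_ (List.suffix_append _ _).isInfix
  have := (pair_infix_reverse_finRange h).map
    fun q => (.under (.c (.inr q) x) : S.Pass)
  simpa [block, Function.comp_def] using this

theorem returningPass_pair {q q' : Fin n} (h : (q : ℕ) + 1 = q') (x : S.Strand) :
    [.over (.c x (.inr q)), .over (.c x (.inr q'))] <:+: S.returningPass x := by
  refine List.IsInfix.trans ?_ (infix_flatMap (List.mem_finRange S.k) _)
  refine List.IsInfix.trans ?_ (List.suffix_append _ _).isInfix
  have := (pair_infix_finRange h).map fun q => (.over (.c x (.inr q)) : S.Pass)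
  simpa [block, Function.comp_def] using this

theorem over_sat_not_mem_inr {ℓ : {ℓ : Fin S.β.len // S.IsSat ℓ}}
    (hℓ : S.satPos ℓ.1 ≠ S.β.upper ℓ.1) (q p : Fin n) :
    (.over (.sat ℓ q) : S.Pass) ∉ S.strandWord (.inr p) := by
  intro h
  rcases List.mem_append.1 h with h | h
  · rcases List.mem_append.1 h with h | h
    · rcases List.mem_append.1 h with h | h
      · obtain ⟨ℓ', e⟩ := S.mem_satBraid h
        rw [over_eq_passAt, passAt_inj] at e
        obtain ⟨e₁, e₂⟩ := e
        obtain ⟨rfl, -⟩ := Chord.sat.inj e₂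
        simp [hℓ] at e₁
      · obtain ⟨ℓ', e⟩ := isBoxPass_of_mem_boxBraid h
        simp at e
    · rcases S.mem_leavingPass h with ⟨j, i, e⟩ | ⟨l, e⟩ <;> simp [passAt] at e
  · rcases S.mem_returningPass h with ⟨j, i, e⟩ | ⟨l, e⟩ <;> simp [passAt] at e

theorem over_sat_mem_outerCrossing {ℓ : {ℓ : Fin S.β.len // S.IsSat ℓ}} {q : Fin n}
    {k : Fin S.β.len} {p : Fin (m + 1)} (h : (.over (.sat ℓ q) : S.Pass) ∈ S.outerCrossing k p) :
    k = ℓ.1 := by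
  unfold outerCrossing at h
  split_ifs at h
  · simp at h
  · simp at h
  · obtain ⟨q', -, e⟩ := List.mem_map.1 h
    simp only [Passage.over.injEq, Chord.sat.injEq] at e
    rw [← e.1]
  · simp at h
  · simp at h

theorem pairwise_outerCrossing (ℓ : {ℓ : Fin S.β.len // S.IsSat ℓ}) {q q' : Fin n}
    (hq : q ≤ q') (k : Fin S.β.len) (p : Fin (m + 1)) :
    (S.outerCrossing k p).Pairwise fun u v =>
      ¬ (u = .over (.sat ℓ q) ∧ v = .over (.sat ℓ q')) := by
  unfold outerCrossing
  split_ifs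
  · rw [List.pairwise_map]
    exact List.pairwise_of_forall fun _ _ => by simp
  · simp
  -- The only case in which these passages occur: the descending strand meets the satellites from
  -- top to bottom, so the indices strictly decrease.
  · rw [List.pairwise_map, List.pairwise_reverse]
    refine (List.pairwise_lt_finRange n).imp fun {a b} hab h => ?_
    simp only [Passage.over.injEq, Chord.sat.injEq] at h
    rw [h.1.2, h.2.2] at hab
    exact absurd hab (not_lt.2 hq)
  · simp
  · simp

theorem not_infix_strandWord_inl (ℓ : {ℓ : Fin S.β.len // S.IsSat ℓ}) {q q' : Fin n}
    (hq : q ≤ q') (i) :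
    ¬ [.over (.sat ℓ q), .over (.sat ℓ q')] <:+: S.strandWord (.inl i) := by
  intro h
  have hp : (S.strandWord (.inl i)).Pairwise fun u v =>
      ¬ (u = .over (.sat ℓ q) ∧ v = .over (.sat ℓ q')) := by
    have hgrid : ∀ v ∈ S.leavingPass (S.exit (.inl i)) ++ S.returningPass (S.exit (.inl i)),
        v ≠ .over (.sat ℓ q') := by
      rintro v hv rfl
      rcases List.mem_append.1 hv with h | h
      · rcases S.mem_leavingPass h with ⟨j, i, e⟩ | ⟨l, e⟩ <;> simp [passAt] at e
      · rcases S.mem_returningPass h with ⟨j, i, e⟩ | ⟨l, e⟩ <;> simp [passAt] at e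
    unfold strandWord
    rw [List.append_assoc, List.pairwise_append]
    refine ⟨?_, ?_, fun u _ v hv e => hgrid v hv e.2⟩
    · unfold outerBraid
      rw [List.pairwise_append]
      refine ⟨?_, by simp, by simp⟩
      rw [List.pairwise_flatMap]
      refine ⟨fun k _ => ?_, (List.nodup_finRange _).imp fun {a b} hab u hu v hv e => hab ?_⟩
      · rw [List.pairwise_cons]
        exact ⟨by simp, S.pairwise_outerCrossing ℓ hq _ _⟩
      · obtain ⟨rfl, rfl⟩ := e
        simp only [List.mem_cons, reduceCtorEq, false_or] at hu hv
        rw [S.over_sat_mem_outerCrossing hu, S.over_sat_mem_outerCrossing hv]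
    · exact List.pairwise_of_forall_mem_list fun u _ v hv e => hgrid v hv e.2
  have := hp.sublist h.sublist
  simp at this

theorem strandWord_inl_eq_cons (i) : ∃ b l, S.strandWord (.inl i) = .pt b :: l := by
  unfold strandWord outerBraid
  rcases List.finRange S.β.len with _ | ⟨ℓ, l⟩
  · exact ⟨_, _, rfl⟩
  · exact ⟨_, _, rfl⟩

/-- The satellites pass under here, so the overpassages lie on the word of a descending outer
strand, where their indices decrease. A pair across a junction is impossible as well: an outer word
begins with a base point, and a satellite word contains no such overpassage. -/
theorem not_follows_over_sat (ℓ : {ℓ : Fin S.β.len // S.IsSat ℓ})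
    (hℓ : S.satPos ℓ.1 ≠ S.β.upper ℓ.1) {q q' : Fin n} (hq : q ≤ q') :
    ¬ (S.diagram t).follows (.over (.sat ℓ q)) (.over (.sat ℓ q')) := by
  have h₀ : ∀ i, ¬ [.over (.sat ℓ q), .over (.sat ℓ q')] <:+: S.strandWord i := by
    rintro (i | p) h
    · exact S.not_infix_strandWord_inl ℓ hq i h
    · exact S.over_sat_not_mem_inr hℓ q p (h.subset (by simp))
  rintro ⟨i, h⟩
  rcases List.infix_append_iff.1 h with h | h | ⟨l₁, l₂, h, h₁, h₂⟩
  · exact h₀ _ h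
  · exact h₀ _ h
  · rcases l₁ with _ | ⟨a, l₁⟩
    · rw [List.nil_append] at h
      subst h
      exact h₀ _ h₂.isInfix
    rcases l₂ with _ | ⟨b, l₂⟩
    · rw [List.append_nil] at h
      rw [← h] at h₁
      exact h₀ _ h₁.isInfix
    -- Both halves are nonempty, so the second passage is the first letter of the next word.
    have hb : b = .over (.sat ℓ q') := by
      rcases l₁ with _ | ⟨c, l₁⟩ <;> simp at h
      exact h.2.1.symm
    subst hb
    rcases hx : S.exit i with x | x
    · obtain ⟨b, l, e⟩ := S.strandWord_inl_eq_cons x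
      rw [hx, e] at h₂
      simp [List.cons_prefix_cons] at h₂
    · rw [hx] at h₂
      exact S.over_sat_not_mem_inr hℓ q' x (h₂.subset (by simp))

theorem crossable_braidGroups {x : Bool × (Fin n → S.Chord)} (hx : x ∈ S.braidGroups) :
    ∃ s, Crossable (S.diagram t) x.1 x.2 s := by
  have hinj := S.separated_braidGroups.injective x hx
  have hbox := S.separated_braidGroups.ne_box x hx
  obtain ⟨ℓ, rfl⟩ := S.mem_braidGroups.1 hx
  -- Crossings of `β` have degree `0`, hence sign `1`. If the satellites pass over, the other strand
  -- ascends and meets them from bottom to top; otherwise it descends and meets them from top to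
  -- bottom.
  refine ⟨1, hinj, hbox, fun q => rfl, fun q q' hq => ?_, fun ho _ q q' hq => ?_⟩
  · by_cases hu : S.satPos ℓ.1 = S.β.upper ℓ.1
    · have hk : (S.β.track ℓ.1).symm (S.β.lower ℓ.1) ≠ S.k := by
        intro e
        rw [Equiv.symm_apply_eq] at e
        exact S.β.lower_ne_upper ℓ.1 (e.trans hu)
      have h₁ := (S.isTraversal_diagram t).along (.inl ⟨_, hk⟩)
      have h₂ := h₁.mono (S.outerCrossing_infix _ ℓ.1)
      have h₃ : S.outerCrossing ℓ.1 (S.β.lower ℓ.1) =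
          (List.finRange n).map fun q => .under (.sat ℓ q) := by
        simp [outerCrossing, ℓ.2]
      simp only [Equiv.apply_symm_apply, h₃] at h₂
      have := h₂ _ _ ((pair_infix_finRange hq).map _)
      simpa [hu, LinkDiagram.adj, passAt] using this
    · have hl := ℓ.2.resolve_right hu
      have hk : (S.β.track ℓ.1).symm (S.β.upper ℓ.1) ≠ S.k := by
        intro e
        rw [Equiv.symm_apply_eq] at e
        exact hu e.symm
      have h₁ := (S.isTraversal_diagram t).along (.inl ⟨_, hk⟩)
      have h₂ := h₁.mono (S.outerCrossing_infix _ ℓ.1)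
      have h₃ : S.outerCrossing ℓ.1 (S.β.upper ℓ.1) =
          (List.finRange n).reverse.map fun q => .over (.sat ℓ q) := by
        simp [outerCrossing, ℓ.2, (S.β.lower_ne_upper ℓ.1).symm]
      simp only [Equiv.apply_symm_apply, h₃] at h₂
      have := h₂ _ _ ((pair_infix_reverse_finRange hq).map _)
      have hne : (-1 : ℤˣ) ≠ 1 := by decide
      simpa [hu, LinkDiagram.adj, passAt, hne] using this
  · refine S.not_follows_over_sat t ℓ (by simpa using ho) ?_
    rw [Fin.le_def]
    omega

theorem crossable_returningGroups {x : Bool × (Fin n → S.Chord)} (hx : x ∈ S.returningGroups) :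
    ∃ s, Crossable ((S.diagram t).conj S.braidExchange) x.1 x.2 s := by
  have hinj := S.separated_returningGroups.injective x hx
  have hbox := S.separated_returningGroups.ne_box x hx
  obtain ⟨j, -, rfl⟩ := List.mem_map.1 hx
  -- The chords `c_{ij}` have degree `1`, hence sign `-1`. A leaving strand meets the top returning
  -- strand first.
  refine ⟨-1, hinj, hbox, fun q => rfl, fun q q' hq => ?_, fun ho => by simp at ho⟩
  obtain ⟨i, rfl⟩ := S.exitPerm.surjective j
  have h₁ := (S.isTraversal_afterBraid t).along i
  have h₂ : S.leavingPass (S.exitPerm i) <:+: S.wordAfterBraid i := by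
    rcases i with i | p
    · exact ⟨S.outerBraid' i, S.returningPass (S.exit (.inl i)), rfl⟩
    · exact ⟨S.satBraid p, S.returningPass (S.exit (.inr p)) ++ S.boxBraid (S.γ.perm p), rfl⟩
  have := h₁.mono h₂ _ _ (S.leavingPass_pair hq _)
  have hne : (-1 : ℤˣ) ≠ 1 := by decide
  simpa [LinkDiagram.adj, passAt, hne] using this

theorem crossable_leavingGroups {x : Bool × (Fin n → S.Chord)} (hx : x ∈ S.leavingGroups) :
    ∃ s, Crossable (((S.diagram t).conj S.braidExchange).conj S.returningExchange) x.1 x.2 s := by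
  have hinj := S.separated_leavingGroups.injective x hx
  have hbox := S.separated_leavingGroups.ne_box x hx
  obtain ⟨j, -, rfl⟩ := List.mem_map.1 hx
  have hne : (-1 : ℤˣ) ≠ 1 := by decide
  refine ⟨-1, hinj, hbox, fun q => rfl, fun q q' hq => ?_, fun _ h => absurd h hne⟩
  obtain ⟨i, hi⟩ := S.exitPerm.surjective (j.map id S.γ.perm.symm)
  have h₁ := (S.isTraversal_afterReturning t).along i
  have h₂ : S.returningPass (S.exitPerm i) <:+: S.wordAfterReturning i := by
    rcases i with i | p
    · exact (List.suffix_append _ _).isInfix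
    · exact (List.suffix_append _ _).isInfix
  have := h₁.mono h₂ _ _ (S.returningPass_pair hq _)
  rw [hi] at this
  simpa [LinkDiagram.adj, passAt] using this

theorem realizes_purpleLoop : (S.diagram t).Realizes (S.loopMap t) S.purpleLoop := by
  rw [purpleLoop, LinkDiagram.realizes_append, LinkDiagram.realizes_append,
    LinkDiagram.totalExchange_append, ← LinkDiagram.conj_conj, and_assoc]
  change _ ∧ ((S.diagram t).conj S.braidExchange).Realizes _ _ ∧
    (((S.diagram t).conj S.braidExchange).conj S.returningExchange).Realizes _ _
  rw [← pushAll_braidGroups, ← pushAll_returningGroups, ← pushAll_leavingGroups]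
  refine ⟨?_, ?_, ?_⟩
  · refine realizes_pushAll t S.separated_braidGroups rfl (fun _ => rfl)
      (fun x hx => S.crossable_braidGroups t hx) fun q => ?_
    refine ((S.isTraversal_diagram t).along (.inr q)).mono ?_
    rw [← satBraid_eq]
    exact ⟨[], S.leavingPass (S.exit (.inr q)) ++ S.returningPass (S.exit (.inr q)),
      by simp [strandWord]⟩
  · refine realizes_pushAll t S.separated_returningGroups rfl (fun _ => rfl)
      (fun x hx => S.crossable_returningGroups t hx) fun q => ?_
    -- The box on the returning strand `q` stands at the end of the word of the strand that leaves
    -- in position `q`.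
    obtain ⟨p, rfl⟩ := S.γ.perm.surjective q
    refine ((S.isTraversal_afterBraid t).along (.inr p)).mono ?_
    rw [← returningPass_inr]
    exact (List.suffix_append _ _).isInfix
  · refine realizes_pushAll t S.separated_leavingGroups rfl (fun _ => rfl)
      (fun x hx => S.crossable_leavingGroups t hx) fun q => ?_
    obtain ⟨p, rfl⟩ := S.γ.perm.surjective q
    refine ((S.isTraversal_afterReturning t).along (.inr p)).mono ?_
    rw [← leavingPass'_inr]
    exact ⟨S.satBraid p, S.returningPass (S.exit (.inr p)), rfl⟩

end SatelliteBraid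

/-! ## Path matrices -/

namespace PositiveBraid

variable {n : ℕ} (b : PositiveBraid n) {A : Type*} [Ring A]

theorem crossingMatrix_mulVec (ℓ : Fin b.len) (a : A) (v : Fin n → A) (i : Fin n) :
    (b.crossingMatrix ℓ a).mulVec v i =
      if i = b.lower ℓ then v (b.upper ℓ)
      else if i = b.upper ℓ then v (b.lower ℓ) + a * v (b.upper ℓ) else v i := by
  have hne := b.lower_ne_upper ℓ
  simp only [Matrix.mulVec, dotProduct, crossingMatrix]
  split_ifs with h₁ h₂
  · simp
  · rw [Finset.sum_eq_add (b.lower ℓ) (b.upper ℓ) hne]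
    · simp [hne.symm]
    · rintro j - ⟨h₃, h₄⟩
      simp [h₃, h₄]
    · simp
    · simp
  · simp

theorem vecMul_crossingMatrix (ℓ : Fin b.len) (a : A) (v : Fin n → A) (j : Fin n) :
    Matrix.vecMul v (b.crossingMatrix ℓ a) j =
      if j = b.lower ℓ then v (b.upper ℓ)
      else if j = b.upper ℓ then v (b.lower ℓ) + v (b.upper ℓ) * a else v j := by
  have hne := b.lower_ne_upper ℓ
  simp only [Matrix.vecMul, dotProduct, crossingMatrix]
  by_cases h₁ : j = b.lower ℓ
  · rw [if_pos h₁, Finset.sum_eq_single (b.upper ℓ)]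
    · simp [hne.symm, h₁]
    · intro i _ hi
      simp +contextual [h₁, hne, hi]
    · simp
  by_cases h₂ : j = b.upper ℓ
  · rw [if_neg h₁, if_pos h₂, Finset.sum_eq_add (b.lower ℓ) (b.upper ℓ) hne]
    · simp [hne.symm, h₂]
    · rintro i - ⟨h₃, h₄⟩
      simp [h₃, h₄, h₂]
    · simp
    · simp
  · rw [if_neg h₁, if_neg h₂, Finset.sum_eq_single j]
    · simp [h₁, h₂]
    · intro i _ hi
      simp [h₂, hi]
    · simp

/-- The block `(0 1; 1 a)` has the two-sided inverse `(-a 1; 1 0)` over any ring, so no determinant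
is involved. -/
theorem isUnit_crossingMatrix (ℓ : Fin b.len) (a : A) : IsUnit (b.crossingMatrix ℓ a) := by
  have hne := b.lower_ne_upper ℓ
  let Q : Matrix (Fin n) (Fin n) A := fun i j =>
    if i = b.lower ℓ then (if j = b.lower ℓ then -a else if j = b.upper ℓ then 1 else 0)
    else if i = b.upper ℓ then (if j = b.lower ℓ then 1 else 0)
    else if i = j then 1 else 0
  refine ⟨⟨b.crossingMatrix ℓ a, Q, ?_, ?_⟩, rfl⟩
  · ext i j
    change (b.crossingMatrix ℓ a).mulVec (fun k => Q k j) i = _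
    rw [crossingMatrix_mulVec, Matrix.one_apply]
    simp only [Q, if_true, if_neg hne.symm]
    by_cases h₁ : i = b.lower ℓ
    · subst h₁
      simp [eq_comm]
    by_cases h₂ : i = b.upper ℓ
    · subst h₂
      by_cases h₃ : j = b.lower ℓ
      · simp [h₁, h₃]
      · simp [h₁, h₃, eq_comm]
    · simp [h₁, h₂]
  · ext i j
    change Matrix.vecMul (Q i) (b.crossingMatrix ℓ a) j = _
    rw [vecMul_crossingMatrix, Matrix.one_apply]
    simp only [Q, if_true, if_neg hne.symm]
    by_cases h₁ : j = b.lower ℓ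
    · subst h₁
      by_cases h₃ : i = b.lower ℓ
      · simp [h₃]
      · by_cases h₄ : i = b.upper ℓ
        · simp [h₄, hne.symm]
        · simp [h₃, h₄]
    by_cases h₂ : j = b.upper ℓ
    · subst h₂
      by_cases h₃ : i = b.lower ℓ
      · simp [h₃, h₁, hne]
      · by_cases h₄ : i = b.upper ℓ
        · simp [h₄, hne.symm]
        · simp [h₃, h₄, hne.symm]
    · by_cases h₃ : i = b.lower ℓ
      · subst h₃
        simp [h₁, h₂, Ne.symm h₁]
      · by_cases h₄ : i = b.upper ℓ
        · subst h₄
          simp [h₁, h₂, h₃, Ne.symm h₂]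
        · simp [h₃, h₄, h₁, h₂]

theorem map_crossingMatrix {B : Type*} [Ring B] (f : A →+* B) (ℓ : Fin b.len) (a : A) :
    (b.crossingMatrix ℓ a).map f = b.crossingMatrix ℓ (f a) := by
  ext i j
  simp only [Matrix.map_apply, crossingMatrix]
  split_ifs <;> simp

/-- Reassociation of `D P D ⋯ P D`: the path matrix groups a crossing with the column after it,
whereas the box is pushed with each crossing grouped with the column before it. -/
theorem _root_.List.prod_ofFn_interleave {M : Type*} [Monoid M] {r : ℕ} (d : Fin (r + 1) → M)
    (p : Fin r → M) :
    d 0 * (List.ofFn fun ℓ => p ℓ * d ℓ.succ).prod =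
      (List.ofFn fun ℓ => d ℓ.castSucc * p ℓ).prod * d (Fin.last r) := by
  induction r with
  | zero => simp
  | succ r ih =>
    have := ih (fun ℓ => d ℓ.succ) (fun ℓ => p ℓ.succ)
    rw [List.ofFn_succ, List.prod_cons, List.ofFn_succ, List.prod_cons]
    simp only [Fin.succ_castSucc] at this ⊢
    rw [mul_assoc (p 0), Fin.succ_zero_eq_one] at *
    simp only [Fin.succ_last] at this
    rw [this]
    simp [mul_assoc]

end PositiveBraid

/-! ### Factorisation of the box matrix and algebra maps that fix it -/

namespace SatelliteBraid

variable {m n : ℕ} (S : SatelliteBraid m n) {R : Type*} [CommRing R] (t : S.BasePoint → Rˣ)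

/-- The diagonal matrix of the `ℓ`-th column of base points in the box. -/
noncomputable def columnMatrix (ℓ : Fin (S.γ.len + 1)) : Matrix (Fin n) (Fin n) (S.Alg R) :=
  Matrix.diagonal fun q => algebraMap R (S.Alg R) (t (.box ℓ q))

/-- The path matrix of the `ℓ`-th column of base points and the `ℓ`-th crossing of the box. -/
noncomputable def layerMatrix (ℓ : Fin S.γ.len) : Matrix (Fin n) (Fin n) (S.Alg R) :=
  S.columnMatrix t ℓ.castSucc * S.γ.crossingMatrix ℓ (FreeAlgebra.ι R (.box ℓ))

theorem boxMatrix_eq : S.boxMatrix t =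
    ((List.finRange S.γ.len).map (S.layerMatrix t)).prod * S.columnMatrix t (Fin.last _) := by
  rw [← List.ofFn_eq_map]
  exact List.prod_ofFn_interleave (S.columnMatrix t)
    fun ℓ => S.γ.crossingMatrix ℓ (FreeAlgebra.ι R (.box ℓ))

theorem isUnit_columnMatrix (ℓ : Fin (S.γ.len + 1)) : IsUnit (S.columnMatrix t ℓ) := by
  refine ⟨⟨S.columnMatrix t ℓ, Matrix.diagonal fun q =>
    algebraMap R (S.Alg R) ((t (.box ℓ q))⁻¹ : Rˣ), ?_, ?_⟩, rfl⟩ <;>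
  simp [columnMatrix, ← map_mul]

theorem isUnit_boxMatrix : IsUnit (S.boxMatrix t) := by
  rw [boxMatrix_eq]
  refine IsUnit.mul ?_ (S.isUnit_columnMatrix t _)
  refine List.prod_induction IsUnit (fun _ _ => IsUnit.mul) isUnit_one ?_
  intro x hx
  obtain ⟨ℓ, -, rfl⟩ := List.mem_map.1 hx
  exact (S.isUnit_columnMatrix t _).mul (S.γ.isUnit_crossingMatrix _ _)

variable {S t}

theorem map_columnMatrix (φ : S.Alg R →ₐ[R] S.Alg R) (ℓ : Fin (S.γ.len + 1)) :
    φ.mapMatrix (S.columnMatrix t ℓ) = S.columnMatrix t ℓ := by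
  simp [columnMatrix, Matrix.diagonal_map]

theorem map_layerMatrix {φ : S.Alg R →ₐ[R] S.Alg R}
    (hφ : ∀ ℓ, φ (FreeAlgebra.ι R (.box ℓ)) = FreeAlgebra.ι R (.box ℓ)) (ℓ : Fin S.γ.len) :
    φ.mapMatrix (S.layerMatrix t ℓ) = S.layerMatrix t ℓ := by
  rw [layerMatrix, map_mul, map_columnMatrix]
  congr 1
  exact (S.γ.map_crossingMatrix (φ : S.Alg R →+* S.Alg R) ℓ _).trans (by simp [hφ])

theorem map_prod_layerMatrix {φ : S.Alg R →ₐ[R] S.Alg R}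
    (hφ : ∀ ℓ, φ (FreeAlgebra.ι R (.box ℓ)) = FreeAlgebra.ι R (.box ℓ)) (l : List (Fin S.γ.len)) :
    φ.mapMatrix (l.map (S.layerMatrix t)).prod = (l.map (S.layerMatrix t)).prod := by
  rw [map_list_prod, List.map_map]
  congr 2
  funext ℓ
  exact map_layerMatrix hφ ℓ

/-- All labels are scalars and all other entries come from crossings of the box. This is what allows
a later map to pass the matrix, `φ (P v) = P (φ v)`. -/
theorem map_boxMatrix {φ : S.Alg R →ₐ[R] S.Alg R}
    (hφ : ∀ ℓ, φ (FreeAlgebra.ι R (.box ℓ)) = FreeAlgebra.ι R (.box ℓ)) :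
    (S.boxMatrix t).map φ = S.boxMatrix t := by
  change φ.mapMatrix _ = _
  rw [boxMatrix_eq, map_mul, map_columnMatrix, map_prod_layerMatrix hφ]

theorem map_mulVec_alg {ι κ : Type*} [Fintype κ] (φ : S.Alg R →ₐ[R] S.Alg R)
    (P : Matrix ι κ (S.Alg R)) (v : κ → S.Alg R) (i : ι) :
    φ (P.mulVec v i) = (P.map φ).mulVec (fun j => φ (v j)) i := by
  simp [Matrix.mulVec, dotProduct]

theorem map_vecMul_alg {ι κ : Type*} [Fintype κ] (φ : S.Alg R →ₐ[R] S.Alg R)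
    (P : Matrix κ ι (S.Alg R)) (v : κ → S.Alg R) (i : ι) :
    φ (Matrix.vecMul v P i) = Matrix.vecMul (fun j => φ (v j)) (P.map φ) i := by
  simp [Matrix.vecMul, dotProduct]

end SatelliteBraid

namespace SatelliteBraid

variable {m n : ℕ} {S : SatelliteBraid m n} {R : Type*} [CommRing R] {t : S.BasePoint → Rˣ}

/-! ## The algebra maps of the purple-box loop -/

theorem loopMap_slide_self (b : S.BasePoint) (x : S.Chord) (o : Bool) :
    S.loopMap t (.slide b x o true) (FreeAlgebra.ι R x) =
      ((if o then t b else (t b)⁻¹ : Rˣ) : R) • FreeAlgebra.ι R x := by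
  simp [loopMap]

theorem loopMap_slide_of_ne (b : S.BasePoint) {x y : S.Chord} (o : Bool) (h : y ≠ x) :
    S.loopMap t (.slide b x o true) (FreeAlgebra.ι R y) = FreeAlgebra.ι R y := by
  simp [loopMap, h]

theorem loopMap_triple_of_ne (tm mb : S.Chord) {tb y : S.Chord} (h : y ≠ tb) :
    S.loopMap t (.triple tm tb mb) (FreeAlgebra.ι R y) = FreeAlgebra.ι R y := by
  simp [loopMap, h]

section

variable {o : Bool} {h : Fin n → S.Chord}

theorem composeMaps_slides {ℓ : Fin (S.γ.len + 1)} {τ : Fin n → Fin n}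
    (hh : Function.Injective fun q => h (τ q)) (L : List (Fin n)) (hL : L.Nodup) :
    let F := LinkDiagram.composeMaps (S.loopMap t)
      (L.map fun q => .slide (.box ℓ q) (h (τ q)) o true)
    (∀ q ∈ L, F (FreeAlgebra.ι R (h (τ q))) =
      ((if o then t (.box ℓ q) else (t (.box ℓ q))⁻¹ : Rˣ) : R) • FreeAlgebra.ι R (h (τ q))) ∧
    ∀ x, (∀ q ∈ L, x ≠ h (τ q)) → F (FreeAlgebra.ι R x) = FreeAlgebra.ι R x := by
  induction L with
  | nil => simp [LinkDiagram.composeMaps]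
  | cons q L ih =>
    obtain ⟨hq, hL⟩ := List.nodup_cons.1 hL
    obtain ⟨h₁, h₂⟩ := ih hL
    have hne : ∀ p ∈ L, h (τ p) ≠ h (τ q) := fun p hp e => hq (hh e ▸ hp)
    refine ⟨fun p hp => ?_, fun x hx => ?_⟩
    · rw [List.map_cons, LinkDiagram.composeMaps, AlgHom.comp_apply]
      rcases List.mem_cons.1 hp with rfl | hp
      · rw [loopMap_slide_self, map_smul, h₂ _ fun p' hp' => (hne p' hp').symm]
      · rw [loopMap_slide_of_ne _ _ (hne p hp), h₁ p hp]
    · rw [List.map_cons, LinkDiagram.composeMaps, AlgHom.comp_apply,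
        loopMap_slide_of_ne _ _ (hx q (by simp)), h₂ x fun p hp => hx p (by simp [hp])]

theorem composeMaps_pushColumn (hh : Function.Injective h) (ℓ : Fin (S.γ.len + 1)) (q : Fin n) :
    LinkDiagram.composeMaps (S.loopMap t) (pushColumn o h ℓ)
        (FreeAlgebra.ι R (h ((S.γ.track ℓ).symm q))) =
      ((if o then t (.box ℓ q) else (t (.box ℓ q))⁻¹ : Rˣ) : R) •
        FreeAlgebra.ι R (h ((S.γ.track ℓ).symm q)) :=
  (composeMaps_slides (τ := (S.γ.track ℓ).symm) (hh.comp (Equiv.injective _)) _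
    (List.nodup_finRange n)).1 q (List.mem_finRange q)

theorem composeMaps_pushColumn_of_ne (hh : Function.Injective h) (ℓ : Fin (S.γ.len + 1))
    {x : S.Chord} (hx : ∀ q, x ≠ h q) :
    LinkDiagram.composeMaps (S.loopMap t) (pushColumn o h ℓ) (FreeAlgebra.ι R x) =
      FreeAlgebra.ι R x :=
  (composeMaps_slides (τ := (S.γ.track ℓ).symm) (hh.comp (Equiv.injective _)) _
    (List.nodup_finRange n)).2 x fun _ _ => hx _

theorem loopMap_pushCrossing_of_ne (ℓ : Fin S.γ.len) {x : S.Chord} (hx : ∀ q, x ≠ h q) :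
    S.loopMap t (pushCrossing o h ℓ) (FreeAlgebra.ι R x) = FreeAlgebra.ι R x := by
  cases o
  · exact loopMap_triple_of_ne _ _ (hx _)
  · exact loopMap_triple_of_ne _ _ (hx _)

/-- The map adds `a * hU` to `hO`, which is the row `upper` of `P_j(a)` once the vector on the right
is listed by the positions after the crossing; the row `lower` is pure relisting. -/
theorem loopMap_pushCrossing_over (hh : Function.Injective h) (ℓ : Fin S.γ.len) :
    (fun q => S.loopMap t (pushCrossing true h ℓ)
      (FreeAlgebra.ι R (h ((S.γ.track ℓ).symm q)))) =
      (S.γ.crossingMatrix ℓ (FreeAlgebra.ι R (.box ℓ))).mulVec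
        fun q => FreeAlgebra.ι R (h ((S.γ.track (ℓ + 1)).symm q)) := by
  have hne := S.γ.lower_ne_upper ℓ
  have e : ∀ q, (S.γ.track (ℓ + 1)).symm q =
      (S.γ.track ℓ).symm (Equiv.swap (S.γ.lower ℓ) (S.γ.upper ℓ) q) := fun q => by
    rw [S.γ.track_succ]; rfl
  funext q
  rw [PositiveBraid.crossingMatrix_mulVec]
  simp only [e]
  by_cases h₂ : q = S.γ.upper ℓ
  · rw [if_neg (h₂.trans_ne hne.symm), if_pos h₂, h₂, Equiv.swap_apply_left,
      Equiv.swap_apply_right]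
    simp [pushCrossing, loopMap]
  · have : S.loopMap t (pushCrossing true h ℓ)
        (FreeAlgebra.ι R (h ((S.γ.track ℓ).symm q))) =
        FreeAlgebra.ι R (h ((S.γ.track ℓ).symm q)) :=
      loopMap_triple_of_ne _ _ fun e => h₂ (Equiv.injective _ (hh e))
    rw [this]
    by_cases h₁ : q = S.γ.lower ℓ
    · rw [if_pos h₁, h₁, Equiv.swap_apply_right]
    · rw [if_neg h₁, if_neg h₂, Equiv.swap_apply_of_ne_of_ne h₁ h₂]

/-- The map sends `hU` to `hU - hO * a`, and multiplication by `P_j(a)` from the right restores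
`hU`. Keeping the matrix on the side of the image avoids inverses. -/
theorem loopMap_pushCrossing_under (hh : Function.Injective h) (hbox : ∀ q ℓ, h q ≠ .box ℓ)
    (ℓ : Fin S.γ.len) :
    Matrix.vecMul (fun q => S.loopMap t (pushCrossing false h ℓ)
      (FreeAlgebra.ι R (h ((S.γ.track ℓ).symm q))))
      (S.γ.crossingMatrix ℓ (FreeAlgebra.ι R (.box ℓ))) =
        fun q => FreeAlgebra.ι R (h ((S.γ.track (ℓ + 1)).symm q)) := by
  have hne := S.γ.lower_ne_upper ℓ
  have e : ∀ q, (S.γ.track (ℓ + 1)).symm q =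
      (S.γ.track ℓ).symm (Equiv.swap (S.γ.lower ℓ) (S.γ.upper ℓ) q) := fun q => by
    rw [S.γ.track_succ]; rfl
  have h₀ : ∀ q, q ≠ S.γ.lower ℓ → S.loopMap t (pushCrossing false h ℓ)
        (FreeAlgebra.ι R (h ((S.γ.track ℓ).symm q))) =
        FreeAlgebra.ι R (h ((S.γ.track ℓ).symm q)) := fun q hq =>
      loopMap_triple_of_ne _ _ fun e => hq (Equiv.injective _ (hh e))
  funext q
  rw [PositiveBraid.vecMul_crossingMatrix, e]
  by_cases h₁ : q = S.γ.lower ℓ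
  · rw [if_pos h₁, h₁, Equiv.swap_apply_left, h₀ _ hne.symm]
  by_cases h₂ : q = S.γ.upper ℓ
  · rw [if_neg h₁, if_pos h₂, h₂, Equiv.swap_apply_right, h₀ _ hne.symm]
    simp [pushCrossing, loopMap, hbox]
  · rw [if_neg h₁, if_neg h₂, h₀ _ h₁, Equiv.swap_apply_of_ne_of_ne h₁ h₂]

theorem composeMaps_of_forall_fixed {x : S.Chord} {l : List (DiagramMove S.Chord S.BasePoint)}
    (hl : ∀ s ∈ l, S.loopMap t s (FreeAlgebra.ι R x) = FreeAlgebra.ι R x) :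
    LinkDiagram.composeMaps (S.loopMap t) l (FreeAlgebra.ι R x) = FreeAlgebra.ι R x := by
  induction l with
  | nil => rfl
  | cons s l ih =>
    rw [LinkDiagram.composeMaps, AlgHom.comp_apply, hl s (by simp),
      ih fun s hs => hl s (by simp [hs])]

theorem loopMap_of_mem_pushBox {x : S.Chord} (hx : ∀ q, x ≠ h q)
    {s : DiagramMove S.Chord S.BasePoint} (hs : s ∈ S.pushBox o h) :
    S.loopMap t s (FreeAlgebra.ι R x) = FreeAlgebra.ι R x := by
  have hcol : ∀ ℓ, s ∈ pushColumn o h ℓ →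
      S.loopMap t s (FreeAlgebra.ι R x) = FreeAlgebra.ι R x := by
    intro ℓ hs
    obtain ⟨q, -, rfl⟩ := List.mem_map.1 hs
    exact loopMap_slide_of_ne _ _ (hx _)
  rw [pushBox_eq] at hs
  rcases List.mem_append.1 hs with hs | hs
  · obtain ⟨ℓ, -, hs⟩ := List.mem_flatMap.1 hs
    rcases List.mem_append.1 hs with hs | hs
    · exact hcol _ hs
    · rw [List.mem_singleton.1 hs]
      exact loopMap_pushCrossing_of_ne ℓ hx
  · exact hcol _ hs

theorem composeMaps_pushBox_of_ne {x : S.Chord} (hx : ∀ q, x ≠ h q) :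
    LinkDiagram.composeMaps (S.loopMap t) (S.pushBox o h) (FreeAlgebra.ι R x) =
      FreeAlgebra.ι R x :=
  composeMaps_of_forall_fixed fun _ hs => loopMap_of_mem_pushBox hx hs

theorem columnMatrix_mulVec (ℓ : Fin (S.γ.len + 1)) (hh : Function.Injective h) :
    (fun q => LinkDiagram.composeMaps (S.loopMap t) (pushColumn true h ℓ)
        (FreeAlgebra.ι R (h ((S.γ.track ℓ).symm q)))) =
      (S.columnMatrix t ℓ).mulVec fun q => FreeAlgebra.ι R (h ((S.γ.track ℓ).symm q)) := by
  funext q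
  rw [composeMaps_pushColumn hh, columnMatrix, Matrix.mulVec_diagonal, Algebra.smul_def]
  simp

/-- On the understrand the label acts by its inverse; being a scalar it is central and cancels
against the diagonal matrix. -/
theorem vecMul_columnMatrix (ℓ : Fin (S.γ.len + 1)) (hh : Function.Injective h) :
    Matrix.vecMul (fun q => LinkDiagram.composeMaps (S.loopMap t) (pushColumn false h ℓ)
        (FreeAlgebra.ι R (h ((S.γ.track ℓ).symm q)))) (S.columnMatrix t ℓ) =
      fun q => FreeAlgebra.ι R (h ((S.γ.track ℓ).symm q)) := by
  funext q
  rw [columnMatrix, Matrix.vecMul_diagonal, composeMaps_pushColumn hh, ← Algebra.commutes,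
    ← Algebra.smul_def, smul_smul]
  simp

/-- After the first `ℓ` layers the column is `Q v`. The maps of the next layer act afterwards, fix
the entries of `Q` and turn `v` into the next layer matrix times the relisted vector, so new factors
appear on the right of `Q`. -/
theorem composeMaps_layers_over (hh : Function.Injective h) (hbox : ∀ q ℓ, h q ≠ .box ℓ) (ℓ : ℕ)
    (hℓ : ℓ ≤ S.γ.len) :
    (fun q => LinkDiagram.composeMaps (S.loopMap t)
      (((List.finRange S.γ.len).take ℓ).flatMap (pushLayer true h)) (FreeAlgebra.ι R (h q))) =
      (((List.finRange S.γ.len).take ℓ).map (S.layerMatrix t)).prod.mulVec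
        fun q => FreeAlgebra.ι R (h ((S.γ.track ℓ).symm q)) := by
  induction ℓ with
  | zero =>
    funext q
    simp only [List.take_zero, List.flatMap_nil, List.map_nil, List.prod_nil, Matrix.one_mulVec]
    rfl
  | succ ℓ ih =>
    specialize ih (by omega)
    have hlt : ℓ < S.γ.len := hℓ
    set L : Fin S.γ.len := ⟨ℓ, hlt⟩ with hL
    have htake : (List.finRange S.γ.len).take (ℓ + 1) = (List.finRange S.γ.len).take ℓ ++ [L] := by
      rw [List.take_add_one]
      simp [hlt, hL]
    have hcol := columnMatrix_mulVec (t := t) L.castSucc hh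
    have hcr := loopMap_pushCrossing_over (t := t) hh L
    have hfix₁ : ∀ k, LinkDiagram.composeMaps (S.loopMap t) (pushColumn true h L.castSucc)
        (FreeAlgebra.ι R (.box k)) = FreeAlgebra.ι R (.box k) := fun k =>
      composeMaps_pushColumn_of_ne hh _ fun q => (hbox q k).symm
    have hfix₂ : ∀ k, S.loopMap t (pushCrossing true h L)
        (FreeAlgebra.ι R (.box k)) = FreeAlgebra.ι R (.box k) := fun k =>
      loopMap_pushCrossing_of_ne L fun q => (hbox q k).symm
    have hm₁ := map_prod_layerMatrix (t := t) hfix₁ ((List.finRange S.γ.len).take ℓ)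
    have hm₂ := map_prod_layerMatrix (t := t) hfix₂ ((List.finRange S.γ.len).take ℓ)
    have hm₃ := map_columnMatrix (t := t) (S.loopMap t (pushCrossing true h L)) L.castSucc
    rw [AlgHom.mapMatrix_apply] at hm₁ hm₂ hm₃
    rw [htake, List.flatMap_append, List.map_append, List.prod_append, List.map_singleton,
      List.prod_singleton, List.flatMap_singleton, pushLayer, LinkDiagram.composeMaps_append,
      LinkDiagram.composeMaps_append, layerMatrix]
    funext q
    rw [AlgHom.comp_apply, AlgHom.comp_apply, congrFun ih q, map_mulVec_alg, hm₁]
    change S.loopMap t (pushCrossing true h L) _ = _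
    have hcol' : (fun j => LinkDiagram.composeMaps (S.loopMap t) (pushColumn true h L.castSucc)
        (FreeAlgebra.ι R (h ((S.γ.track ℓ).symm j)))) =
      (S.columnMatrix t L.castSucc).mulVec fun q => FreeAlgebra.ι R (h ((S.γ.track ℓ).symm q)) :=
      hcol
    have hcr' : (fun q => S.loopMap t (pushCrossing true h L)
        (FreeAlgebra.ι R (h ((S.γ.track ℓ).symm q)))) = _ := hcr
    rw [hcol', Matrix.mulVec_mulVec, map_mulVec_alg, Matrix.map_mul, hm₂, hm₃, hcr',
      Matrix.mulVec_mulVec, mul_assoc]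

/-- The equation `w Q = v` for the image row `w` is preserved by applying the maps of the next
layer, which fix `Q`; multiplying by the new layer matrix then simplifies the right-hand side to the
relisted row. -/
theorem composeMaps_layers_under (hh : Function.Injective h) (hbox : ∀ q ℓ, h q ≠ .box ℓ)
    (ℓ : ℕ) (hℓ : ℓ ≤ S.γ.len) :
    Matrix.vecMul (fun q => LinkDiagram.composeMaps (S.loopMap t)
      (((List.finRange S.γ.len).take ℓ).flatMap (pushLayer false h)) (FreeAlgebra.ι R (h q)))
      (((List.finRange S.γ.len).take ℓ).map (S.layerMatrix t)).prod =
        fun q => FreeAlgebra.ι R (h ((S.γ.track ℓ).symm q)) := by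
  induction ℓ with
  | zero =>
    simp only [List.take_zero, List.flatMap_nil, List.map_nil, List.prod_nil, Matrix.vecMul_one]
    rfl
  | succ ℓ ih =>
    specialize ih (by omega)
    have hlt : ℓ < S.γ.len := hℓ
    set L : Fin S.γ.len := ⟨ℓ, hlt⟩ with hL
    have htake : (List.finRange S.γ.len).take (ℓ + 1) = (List.finRange S.γ.len).take ℓ ++ [L] := by
      rw [List.take_add_one]
      simp [hlt, hL]
    have hcol := vecMul_columnMatrix (t := t) L.castSucc hh
    have hcr := loopMap_pushCrossing_under (t := t) hh hbox L
    set Ψ := LinkDiagram.composeMaps (S.loopMap t)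
      (((List.finRange S.γ.len).take ℓ).flatMap (pushLayer false h)) with hΨ
    set F := LinkDiagram.composeMaps (S.loopMap t) (pushColumn false h L.castSucc) with hF
    set G := S.loopMap t (pushCrossing false h L) with hG
    set Q := (((List.finRange S.γ.len).take ℓ).map (S.layerMatrix t)).prod with hQ
    have hfix₁ : ∀ k, F (FreeAlgebra.ι R (.box k)) = FreeAlgebra.ι R (.box k) := fun k =>
      composeMaps_pushColumn_of_ne hh _ fun q => (hbox q k).symm
    have hfix₂ : ∀ k, G (FreeAlgebra.ι R (.box k)) = FreeAlgebra.ι R (.box k) := fun k =>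
      loopMap_pushCrossing_of_ne L fun q => (hbox q k).symm
    have hm₁ : Q.map F = Q := map_prod_layerMatrix hfix₁ _
    have hm₂ : Q.map G = Q := map_prod_layerMatrix hfix₂ _
    have hm₃ : (S.columnMatrix t L.castSucc).map G = _ := map_columnMatrix G L.castSucc
    have hcomp : LinkDiagram.composeMaps (S.loopMap t)
        (((List.finRange S.γ.len).take (ℓ + 1)).flatMap (pushLayer false h)) =
        G.comp (F.comp Ψ) := by
      rw [htake, List.flatMap_append, List.flatMap_singleton, pushLayer,
        LinkDiagram.composeMaps_append, LinkDiagram.composeMaps_append]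
      rfl
    have hprod : (((List.finRange S.γ.len).take (ℓ + 1)).map (S.layerMatrix t)).prod =
        Q * (S.columnMatrix t L.castSucc *
          S.γ.crossingMatrix L (FreeAlgebra.ι R (.box L))) := by
      rw [htake, List.map_append, List.prod_append, List.map_singleton, List.prod_singleton]
      rfl
    have h₁ : Matrix.vecMul (fun q => F (Ψ (FreeAlgebra.ι R (h q)))) Q =
        fun q => F (FreeAlgebra.ι R (h ((S.γ.track ℓ).symm q))) := by
      funext q
      rw [← congrFun ih q, map_vecMul_alg, hm₁]
    have h₂ : Matrix.vecMul (fun q => F (Ψ (FreeAlgebra.ι R (h q))))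
        (Q * S.columnMatrix t L.castSucc) =
        fun q => FreeAlgebra.ι R (h ((S.γ.track ℓ).symm q)) := by
      rw [← Matrix.vecMul_vecMul, h₁]
      exact hcol
    have h₃ : Matrix.vecMul (fun q => G (F (Ψ (FreeAlgebra.ι R (h q)))))
        (Q * S.columnMatrix t L.castSucc) =
        fun q => G (FreeAlgebra.ι R (h ((S.γ.track ℓ).symm q))) := by
      funext q
      rw [← congrFun h₂ q, map_vecMul_alg, Matrix.map_mul, hm₂, hm₃]
    rw [hcomp, hprod, ← mul_assoc, ← Matrix.vecMul_vecMul]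
    exact (congrArg (fun v => Matrix.vecMul v _) h₃).trans hcr

theorem composeMaps_pushBox_over (hh : Function.Injective h) (hbox : ∀ q ℓ, h q ≠ .box ℓ) :
    (fun q => LinkDiagram.composeMaps (S.loopMap t) (S.pushBox true h) (FreeAlgebra.ι R (h q))) =
      (S.boxMatrix t).mulVec fun q => FreeAlgebra.ι R (h (S.γ.perm.symm q)) := by
  have e : (List.finRange S.γ.len).take S.γ.len = List.finRange S.γ.len :=
    List.take_of_length_le (by simp)
  have h₁ := composeMaps_layers_over (t := t) hh hbox S.γ.len le_rfl
  rw [e] at h₁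
  have hfix : ∀ k, LinkDiagram.composeMaps (S.loopMap t) (pushColumn true h (Fin.last _))
      (FreeAlgebra.ι R (.box k)) = FreeAlgebra.ι R (.box k) := fun k =>
    composeMaps_pushColumn_of_ne hh _ fun q => (hbox q k).symm
  have hm := map_prod_layerMatrix (t := t) hfix (List.finRange S.γ.len)
  rw [AlgHom.mapMatrix_apply] at hm
  funext q
  rw [pushBox_eq, LinkDiagram.composeMaps_append, AlgHom.comp_apply, congrFun h₁ q,
    map_mulVec_alg, hm, boxMatrix_eq, ← Matrix.mulVec_mulVec]
  exact congrFun (congrArg (Matrix.mulVec _) (columnMatrix_mulVec (Fin.last _) hh)) q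

theorem composeMaps_pushBox_under (hh : Function.Injective h) (hbox : ∀ q ℓ, h q ≠ .box ℓ) :
    Matrix.vecMul (fun q => LinkDiagram.composeMaps (S.loopMap t) (S.pushBox false h)
      (FreeAlgebra.ι R (h q))) (S.boxMatrix t) =
        fun q => FreeAlgebra.ι R (h (S.γ.perm.symm q)) := by
  have e : (List.finRange S.γ.len).take S.γ.len = List.finRange S.γ.len :=
    List.take_of_length_le (by simp)
  have h₁ := composeMaps_layers_under (t := t) hh hbox S.γ.len le_rfl
  rw [e] at h₁
  have hfix : ∀ k, LinkDiagram.composeMaps (S.loopMap t) (pushColumn false h (Fin.last _))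
      (FreeAlgebra.ι R (.box k)) = FreeAlgebra.ι R (.box k) := fun k =>
    composeMaps_pushColumn_of_ne hh _ fun q => (hbox q k).symm
  have hm := map_prod_layerMatrix (t := t) hfix (List.finRange S.γ.len)
  rw [AlgHom.mapMatrix_apply] at hm
  rw [pushBox_eq, LinkDiagram.composeMaps_append, boxMatrix_eq, ← Matrix.vecMul_vecMul]
  refine Eq.trans (congrArg (fun v => Matrix.vecMul v _) ?_) (vecMul_columnMatrix (Fin.last _) hh)
  funext q
  have := congrArg (LinkDiagram.composeMaps (S.loopMap t) (pushColumn false h (Fin.last _)))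
    (congrFun h₁ q)
  rw [map_vecMul_alg, hm] at this
  exact this

end

theorem composeMaps_pushAll_of_ne {H : List (Bool × (Fin n → S.Chord))} {x : S.Chord}
    (hx : ∀ y ∈ H, ∀ q, x ≠ y.2 q) :
    LinkDiagram.composeMaps (S.loopMap t) (pushAll H) (FreeAlgebra.ι R x) =
      FreeAlgebra.ι R x := by
  refine composeMaps_of_forall_fixed fun s hs => ?_
  obtain ⟨y, hy, hs⟩ := List.mem_flatMap.1 hs
  exact loopMap_of_mem_pushBox (hx y hy) hs

/-- Earlier pushes do not affect the group, and later ones fix both the group and the box matrix, so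
only the push through the group itself contributes. -/
theorem composeMaps_pushAll {H : List (Bool × (Fin n → S.Chord))} (hH : Separated H)
    {y : Bool × (Fin n → S.Chord)} (hy : y ∈ H) :
    (y.1 = true → (fun q => LinkDiagram.composeMaps (S.loopMap t) (pushAll H)
        (FreeAlgebra.ι R (y.2 q))) =
      (S.boxMatrix t).mulVec fun q => FreeAlgebra.ι R (y.2 (S.γ.perm.symm q))) ∧
    (y.1 = false → Matrix.vecMul (fun q => LinkDiagram.composeMaps (S.loopMap t) (pushAll H)
        (FreeAlgebra.ι R (y.2 q))) (S.boxMatrix t) =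
      fun q => FreeAlgebra.ι R (y.2 (S.γ.perm.symm q))) := by
  induction H with
  | nil => simp at hy
  | cons x H ih =>
    have hx := (List.pairwise_cons.1 hH.pairwise).1
    have hcons : pushAll (x :: H) = S.pushBox x.1 x.2 ++ pushAll H := rfl
    rw [hcons, LinkDiagram.composeMaps_append]
    simp only [AlgHom.comp_apply]
    rcases List.mem_cons.1 hy with rfl | hy
    · have hfix : ∀ q, LinkDiagram.composeMaps (S.loopMap t) (pushAll H)
          (FreeAlgebra.ι R (y.2 q)) = FreeAlgebra.ι R (y.2 q) := fun q =>
        composeMaps_pushAll_of_ne fun z hz q' => hx z hz q q'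
      have hP := map_boxMatrix (t := t) (φ := LinkDiagram.composeMaps (S.loopMap t) (pushAll H))
        fun ℓ => composeMaps_pushAll_of_ne fun z hz q => (hH.ne_box z (by simp [hz]) q ℓ).symm
      obtain ⟨o, h⟩ := y
      refine ⟨?_, ?_⟩
      · rintro rfl
        funext q
        have := congrFun (composeMaps_pushBox_over (t := t) (hH.injective (true, h) (by simp))
          (hH.ne_box (true, h) (by simp))) q
        dsimp only at this hfix ⊢
        rw [this, map_mulVec_alg, hP]
        simp only [hfix]
      · rintro rfl
        funext q
        have := congrArg (LinkDiagram.composeMaps (S.loopMap t) (pushAll H))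
          (congrFun (composeMaps_pushBox_under (t := t) (hH.injective (false, h) (by simp))
          (hH.ne_box (false, h) (by simp))) q)
        dsimp only at this hfix ⊢
        rw [map_vecMul_alg, hP, hfix] at this
        exact this
    · have hfix : ∀ q, LinkDiagram.composeMaps (S.loopMap t) (S.pushBox x.1 x.2)
          (FreeAlgebra.ι R (y.2 q)) = FreeAlgebra.ι R (y.2 q) := fun q =>
        composeMaps_pushBox_of_ne fun q' e => hx y hy q' q e.symm
      simp only [hfix]
      exact ih hH.tail hy

end SatelliteBraid

namespace SatelliteBraid

variable {m n : ℕ} {S : SatelliteBraid m n} {R : Type*} [CommRing R] {t : S.BasePoint → Rˣ}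

/-! ## The purple-box monodromy -/

variable (S) in
/-- The identification of the chords of the final and the initial diagram, as an algebra map. -/
noncomputable def identificationMap (R : Type*) [CommRing R] : S.Alg R →ₐ[R] S.Alg R :=
  FreeAlgebra.lift R fun x => FreeAlgebra.ι R (S.identification x)

theorem identificationMap_ι (x : S.Chord) :
    S.identificationMap R (FreeAlgebra.ι R x) = FreeAlgebra.ι R (S.place S.γ.perm x) := by
  simp [identificationMap, identification]

theorem monodromy_apply (x : S.Alg R) :
    S.monodromy t x = S.identificationMap R
      (LinkDiagram.composeMaps (S.loopMap t) (pushAll S.leavingGroups)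
        (LinkDiagram.composeMaps (S.loopMap t) (pushAll S.returningGroups)
          (LinkDiagram.composeMaps (S.loopMap t) (pushAll S.braidGroups) x))) := by
  rw [monodromy, (S.realizes_purpleLoop t).inducedMap_eq, purpleLoop,
    LinkDiagram.composeMaps_append, LinkDiagram.composeMaps_append, pushAll_braidGroups,
    pushAll_returningGroups, pushAll_leavingGroups]
  rfl

theorem composeMaps_braidGroups_of_ne {x : S.Chord} (hx : ∀ ℓ q, x ≠ .sat ℓ q) :
    LinkDiagram.composeMaps (S.loopMap t) (pushAll S.braidGroups) (FreeAlgebra.ι R x) =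
      FreeAlgebra.ι R x := by
  refine composeMaps_pushAll_of_ne fun y hy q => ?_
  obtain ⟨ℓ, rfl⟩ := S.mem_braidGroups.1 hy
  exact hx ℓ q

theorem composeMaps_returningGroups_of_ne {x : S.Chord} (hx : ∀ q j, x ≠ .c (.inr q) j) :
    LinkDiagram.composeMaps (S.loopMap t) (pushAll S.returningGroups) (FreeAlgebra.ι R x) =
      FreeAlgebra.ι R x := by
  refine composeMaps_pushAll_of_ne fun y hy q => ?_
  obtain ⟨j, -, rfl⟩ := List.mem_map.1 hy
  exact hx q j

theorem composeMaps_leavingGroups_of_ne {x : S.Chord} (hx : ∀ i q, x ≠ .c i (.inr q)) :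
    LinkDiagram.composeMaps (S.loopMap t) (pushAll S.leavingGroups) (FreeAlgebra.ι R x) =
      FreeAlgebra.ι R x := by
  refine composeMaps_pushAll_of_ne fun y hy q => ?_
  obtain ⟨j, -, rfl⟩ := List.mem_map.1 hy
  exact hx _ q

theorem monodromy_outer (ℓ) :
    S.monodromy t (FreeAlgebra.ι R (.outer ℓ)) = FreeAlgebra.ι R (.outer ℓ) := by
  rw [monodromy_apply, composeMaps_braidGroups_of_ne (by simp),
    composeMaps_returningGroups_of_ne (by simp), composeMaps_leavingGroups_of_ne (by simp),
    identificationMap_ι]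
  rfl

theorem monodromy_box (ℓ) :
    S.monodromy t (FreeAlgebra.ι R (.box ℓ)) = FreeAlgebra.ι R (.box ℓ) := by
  rw [monodromy_apply, composeMaps_braidGroups_of_ne (by simp),
    composeMaps_returningGroups_of_ne (by simp), composeMaps_leavingGroups_of_ne (by simp),
    identificationMap_ι]
  rfl

theorem monodromy_c_inl (i j) :
    S.monodromy t (FreeAlgebra.ι R (.c (.inl i) (.inl j))) =
      FreeAlgebra.ι R (.c (.inl i) (.inl j)) := by
  rw [monodromy_apply, composeMaps_braidGroups_of_ne (by simp),
    composeMaps_returningGroups_of_ne (by simp), composeMaps_leavingGroups_of_ne (by simp),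
    identificationMap_ι]
  rfl

theorem identificationMap_box (ℓ) :
    S.identificationMap R (FreeAlgebra.ι R (.box ℓ)) = FreeAlgebra.ι R (.box ℓ) := by
  rw [identificationMap_ι]
  rfl

/-- The part of the monodromy after the passage of the box through `β`. -/
theorem exists_monodromy_eq_comp : ∃ φ : S.Alg R →ₐ[R] S.Alg R,
    (∀ x, S.monodromy t x = φ (LinkDiagram.composeMaps (S.loopMap t) (pushAll S.braidGroups) x)) ∧
    (∀ ℓ, φ (FreeAlgebra.ι R (.box ℓ)) = FreeAlgebra.ι R (.box ℓ)) ∧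
    ∀ ℓ q, φ (FreeAlgebra.ι R (.sat ℓ q)) = FreeAlgebra.ι R (.sat ℓ (S.γ.perm q)) := by
  refine ⟨(S.identificationMap R).comp ((LinkDiagram.composeMaps (S.loopMap t)
    (pushAll S.leavingGroups)).comp (LinkDiagram.composeMaps (S.loopMap t)
      (pushAll S.returningGroups))), monodromy_apply, fun ℓ => ?_, fun ℓ q => ?_⟩
  · rw [AlgHom.comp_apply, AlgHom.comp_apply, composeMaps_returningGroups_of_ne (by simp),
      composeMaps_leavingGroups_of_ne (by simp), identificationMap_box]
  · rw [AlgHom.comp_apply, AlgHom.comp_apply, composeMaps_returningGroups_of_ne (by simp),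
      composeMaps_leavingGroups_of_ne (by simp), identificationMap_ι]
    rfl

/-- The stages after `β` fix the group, and the identification turns the `γ.perm⁻¹` left by the push
into the identity. -/
theorem monodromy_group_over (ℓ : {ℓ : Fin S.β.len // S.IsSat ℓ})
    (hℓ : S.satPos ℓ.1 = S.β.upper ℓ.1) :
    (fun q => S.monodromy t (S.group R ℓ q)) = (S.boxMatrix t).mulVec (S.group R ℓ) := by
  obtain ⟨φ, hφ, hbox, hsat⟩ := exists_monodromy_eq_comp (S := S) (t := t)
  have h := (composeMaps_pushAll (t := t) S.separated_braidGroups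
    (S.mem_braidGroups.2 ⟨ℓ, rfl⟩)).1 (by simpa using hℓ)
  funext q
  rw [hφ]
  refine (congrArg φ (congrFun h q)).trans ?_
  rw [map_mulVec_alg, map_boxMatrix hbox]
  simp only [hsat, Equiv.apply_symm_apply]
  rfl

theorem vecMul_monodromy_group_under (ℓ : {ℓ : Fin S.β.len // S.IsSat ℓ})
    (hℓ : S.satPos ℓ.1 = S.β.lower ℓ.1) :
    Matrix.vecMul (fun q => S.monodromy t (S.group R ℓ q)) (S.boxMatrix t) = S.group R ℓ := by
  obtain ⟨φ, hφ, hbox, hsat⟩ := exists_monodromy_eq_comp (S := S) (t := t)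
  have hne : S.satPos ℓ.1 ≠ S.β.upper ℓ.1 := fun e =>
    S.β.lower_ne_upper ℓ.1 (hℓ.symm.trans e)
  have h := (composeMaps_pushAll (t := t) S.separated_braidGroups
    (S.mem_braidGroups.2 ⟨ℓ, rfl⟩)).2 (by simpa using hne)
  funext q
  have := congrArg φ (congrFun h q)
  rw [map_vecMul_alg, map_boxMatrix hbox, hsat, Equiv.apply_symm_apply] at this
  simp only [hφ]
  exact this

variable (S t) in
theorem isUnit_extendedBoxMatrix : IsUnit (S.extendedBoxMatrix t) := by
  obtain ⟨u, hu⟩ := S.isUnit_boxMatrix t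
  refine ⟨⟨S.extendedBoxMatrix t, Matrix.fromBlocks 1 0 0 (u⁻¹ : Units _).1, ?_, ?_⟩, rfl⟩
  · simp [extendedBoxMatrix, ← hu, Matrix.fromBlocks_multiply]
  · simp [extendedBoxMatrix, ← hu, Matrix.fromBlocks_multiply]

theorem map_extendedBoxMatrix {φ : S.Alg R →ₐ[R] S.Alg R}
    (hφ : ∀ ℓ, φ (FreeAlgebra.ι R (.box ℓ)) = FreeAlgebra.ι R (.box ℓ)) :
    (S.extendedBoxMatrix t).map φ = S.extendedBoxMatrix t := by
  rw [extendedBoxMatrix, Matrix.fromBlocks_map, map_boxMatrix hφ]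
  rw [Matrix.map_one _ (map_zero φ) (map_one φ), Matrix.map_zero _ (map_zero φ),
    Matrix.map_zero _ (map_zero φ)]

/-- Each column `j` of satellite rows is one group of overcrossings of the box, which yields left
multiplication; the other rows are fixed, which accounts for the identity block. -/
theorem map_returning_chordMatrix :
    (S.chordMatrix R).map (LinkDiagram.composeMaps (S.loopMap t) (pushAll S.returningGroups)) =
      S.extendedBoxMatrix t *
        Matrix.of fun (i j : S.Strand) => FreeAlgebra.ι R (Chord.c (i.map id S.γ.perm.symm) j) := by
  ext i j
  rcases i with i | q
  · rw [Matrix.map_apply, chordMatrix, composeMaps_returningGroups_of_ne (by simp),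
      Matrix.mul_apply, Fintype.sum_sum_type]
    simp [extendedBoxMatrix, Matrix.one_apply]
  · have h := (composeMaps_pushAll (t := t) S.separated_returningGroups
      (List.mem_map.2 ⟨j, List.mem_reverse.2 (S.mem_strands j), rfl⟩)).1 rfl
    refine (congrFun h q).trans ?_
    rw [Matrix.mul_apply, Fintype.sum_sum_type]
    simp [extendedBoxMatrix, Matrix.mulVec, dotProduct]

theorem map_leaving_chordMatrix :
    (Matrix.of fun (i j : S.Strand) => FreeAlgebra.ι R (Chord.c (i.map id S.γ.perm.symm) j)).map
        (LinkDiagram.composeMaps (S.loopMap t) (pushAll S.leavingGroups)) *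
          S.extendedBoxMatrix t =
      Matrix.of fun (i j : S.Strand) =>
        FreeAlgebra.ι R (Chord.c (i.map id S.γ.perm.symm) (j.map id S.γ.perm.symm)) := by
  ext i j
  rw [Matrix.mul_apply, Fintype.sum_sum_type]
  rcases j with j | q
  · simp only [extendedBoxMatrix, Matrix.map_apply, Matrix.of_apply, Matrix.fromBlocks_apply₁₁,
      Matrix.fromBlocks_apply₂₁, Matrix.zero_apply, mul_zero, Finset.sum_const_zero, add_zero,
      Matrix.one_apply]
    rw [Finset.sum_eq_single j]
    · rw [if_pos rfl, mul_one, composeMaps_leavingGroups_of_ne (by simp)]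
      rfl
    · intro k _ hk
      rw [if_neg hk, mul_zero]
    · simp
  · have h := (composeMaps_pushAll (t := t) S.separated_leavingGroups
      (List.mem_map.2 ⟨i, S.mem_strands i, rfl⟩)).2 rfl
    refine Eq.trans ?_ (congrFun h q)
    simp [extendedBoxMatrix, Matrix.vecMul, dotProduct]

/-- The passage through `β` fixes the chords `c_{ij}`. The returning stage gives the left factor,
which the leaving stage and the identification fix; the leaving stage gives the factor on the side
of the image, and the identification undoes both permutations of indices. -/
theorem map_monodromy_chordMatrix_mul :
    (S.chordMatrix R).map (S.monodromy t) * S.extendedBoxMatrix t =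
      S.extendedBoxMatrix t * S.chordMatrix R := by
  set Ψ := LinkDiagram.composeMaps (S.loopMap t) (pushAll S.returningGroups)
  set Φ := LinkDiagram.composeMaps (S.loopMap t) (pushAll S.leavingGroups) with hΦ
  have hbox : ∀ ℓ, Φ (FreeAlgebra.ι R (.box ℓ)) = FreeAlgebra.ι R (.box ℓ) := fun ℓ =>
    composeMaps_leavingGroups_of_ne (by simp)
  have h₁ : (S.chordMatrix R).map (S.monodromy t) =
      (((S.chordMatrix R).map Ψ).map Φ).map (S.identificationMap R) := by
    ext i j
    simp only [Matrix.map_apply, chordMatrix]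
    rw [monodromy_apply, composeMaps_braidGroups_of_ne (by simp)]
  have h₂ : S.extendedBoxMatrix t = (S.extendedBoxMatrix t).map (S.identificationMap R) :=
    (map_extendedBoxMatrix identificationMap_box).symm
  rw [h₁, map_returning_chordMatrix, Matrix.map_mul, map_extendedBoxMatrix hbox]
  nth_rw 2 [h₂]
  rw [← Matrix.map_mul, mul_assoc, map_leaving_chordMatrix, Matrix.map_mul, ← h₂]
  congr 1
  ext i j
  rw [Matrix.map_apply, Matrix.of_apply, identificationMap_ι]
  simp [place, chordMatrix]

end SatelliteBraid

theorem proposition5p2 {R : Type*} [CommRing R] {m n : ℕ} (S : SatelliteBraid m n)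
    (t : S.BasePoint → Rˣ) :
    -- the purple-box loop is a loop of legal Reidemeister III and base point moves
    ((S.diagram t).Legal S.purpleLoop ∧
      ((S.diagram t).run S.purpleLoop).relabel S.identification = S.diagram t) ∧
    -- degree 1 chords
    (IsUnit (S.extendedBoxMatrix t) ∧
      (S.chordMatrix R).map (S.monodromy t) =
        S.extendedBoxMatrix t * S.chordMatrix R * Ring.inverse (S.extendedBoxMatrix t)) ∧
    -- non-satellite crossings and the crossings in the box are fixed
    (∀ ℓ, S.monodromy t (FreeAlgebra.ι R (.outer ℓ)) = FreeAlgebra.ι R (.outer ℓ)) ∧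
    (∀ i j, S.monodromy t (FreeAlgebra.ι R (.c (.inl i) (.inl j))) =
      FreeAlgebra.ι R (.c (.inl i) (.inl j))) ∧
    (∀ ℓ, S.monodromy t (FreeAlgebra.ι R (.box ℓ)) = FreeAlgebra.ι R (.box ℓ)) ∧
    -- groups of satellite crossings where the satellited strand is the overcrossing
    (∀ ℓ, S.satPos ℓ.1 = S.β.upper ℓ.1 →
      (fun q => S.monodromy t (S.group R ℓ q)) = (S.boxMatrix t).mulVec (S.group R ℓ)) ∧
    -- groups of satellite crossings where the satellited strand is the undercrossing:
    -- as row vectors over the tensor algebra ...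
    (IsUnit (S.boxMatrix t) ∧ ∀ ℓ, S.satPos ℓ.1 = S.β.lower ℓ.1 →
      (fun q => S.monodromy t (S.group R ℓ q)) =
        Matrix.vecMul (S.group R ℓ) (Ring.inverse (S.boxMatrix t))) ∧
    -- ... and, equivalently up to the order of factors, as column vectors over every
    -- commutative algebra under the tensor algebra
    (∀ {K : Type*} [CommRing K] [Algebra R K] (f : S.Alg R →ₐ[R] K),
      IsUnit ((S.boxMatrix t).map f).transpose ∧
      ∀ ℓ, S.satPos ℓ.1 = S.β.lower ℓ.1 →
        (fun q => f (S.monodromy t (S.group R ℓ q))) =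
          (((S.boxMatrix t).map f).transpose)⁻¹.mulVec (fun q => f (S.group R ℓ q))) := by
  refine ⟨⟨(S.realizes_purpleLoop t).legal, S.relabel_run_purpleLoop t⟩,
    ⟨S.isUnit_extendedBoxMatrix t, ?_⟩, SatelliteBraid.monodromy_outer,
    SatelliteBraid.monodromy_c_inl, SatelliteBraid.monodromy_box,
    SatelliteBraid.monodromy_group_over, ⟨S.isUnit_boxMatrix t, fun ℓ hℓ => ?_⟩, ?_⟩
  · rw [← SatelliteBraid.map_monodromy_chordMatrix_mul, mul_assoc,
      Ring.mul_inverse_cancel _ (S.isUnit_extendedBoxMatrix t), mul_one]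
  -- The group is replaced by its image times the box matrix, which then cancels against the
  -- inverse.
  · conv_rhs => rw [← SatelliteBraid.vecMul_monodromy_group_under (t := t) ℓ hℓ]
    rw [Matrix.vecMul_vecMul, Ring.mul_inverse_cancel _ (S.isUnit_boxMatrix t),
      Matrix.vecMul_one]
  · intro K _ _ f
    have hu : IsUnit ((S.boxMatrix t).map f).transpose := by
      rw [Matrix.isUnit_transpose]
      exact (S.isUnit_boxMatrix t).map f.mapMatrix
    refine ⟨hu, fun ℓ hℓ => ?_⟩
    have h : ((S.boxMatrix t).map f).transpose.mulVec
        (fun q => f (S.monodromy t (S.group R ℓ q))) = fun q => f (S.group R ℓ q) := by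
      -- Here commutativity of `K` is essential: it converts the row equation into one for columns
      -- with the transposed matrix.
      rw [Matrix.mulVec_transpose]
      funext q
      rw [← congrFun (SatelliteBraid.vecMul_monodromy_group_under (t := t) ℓ hℓ) q]
      simp [Matrix.vecMul, dotProduct]
    rw [← h, Matrix.mulVec_mulVec, Matrix.nonsing_inv_mul _ ((Matrix.isUnit_iff_isUnit_det _).1 hu),
      Matrix.one_mulVec]
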